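/- **Setting.** Let $\mathcal X$ be a finite non-empty alphabet; all logarithms are to base 2. A source is a probability distribution $p$ on $\mathcal X$, with entropy $H(p)$; a message $X^n$ consists of $n$ i.i.d. draws from $p$. The source is *dyadic* if every $p(a)$ is of the form $2^{-k}$, $k\in\{0,1,2,\dots\}$. A compression scheme of length $n$ and rate at most $R$ is a pair $\mathrm{enc}:\mathcal X^n\to\{0,1\}^\ell$, $\mathrm{dec}:\{0,1\}^\ell\to\mathcal X^n$ with $\ell\le nR$; its error probability is $P_e=\Pr[\mathrm{dec}(\mathrm{enc}(X^n))\ne X^n]$. A local decoder adaptively probes bits of $\mathrm{enc}(x^n)$, given $(i,s)$, and outputs the fragment $x_i^{i+s-1}$; it must be correct whenever $\mathrm{dec}(\mathrm{enc}(x^n))=x^n$. Let $r_{wc}(s)$ be the maximum of the number of probed bits over all $i$ and all $x^n\in\mathcal X^n$. A local updater, given $i$ and a new fragment $\tilde x_i^{i+s-1}$, adaptively probes bits of $\mathrm{enc}(x^n)$ and overwrites bits so as to obtain the codeword of the updated message, correctly whenever $\mathrm{dec}(\mathrm{enc}(x^n))=x^n$; let $t_{avg}(s)$ be the maximum over $i$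 of the expected number of bits read plus bits written, when the message and the new fragment are independent and i.i.d. from $p$. Let $r^*_{wc}(1)=r^*_{wc}(1;p,R)$ be the infimum, over all sequences of compression schemes (one for each $n$) of rate at most $R$ with $P_e\to0$ as $n\to\infty$, equipped with local decoders, of $\liminf_{n\to\infty} r_{wc}(1)$. **Statement.** There is a family of compression schemes with local decoders and local updaters, one for each $\varepsilon$, each target rate $R$ and each $n$ (not depending otherwise on the source), with the following properties. 1. For every source $p$ on $\mathcal X$ there is a constant $C$ such that for every $\varepsilon>0$ the schemes with parameters $\varepsilon$ and $R=H(p)+\varepsilon$ have rate at most $H(p)+\varepsilon$ for every $n$ and $P_e\to0$ as $n\to\infty$; for all sufficiently large $n$ and all $1\le s\le n$ they satisfy $r_{wc}(s)\le C\max(s,\log\log n)$ and $t_{avg}(s)\le C\max(s,\log\log n)$, so that $r_{wc}(1)$ and $t_{avg}(1)$ are $O(\log\log n)$ with a constant independent of $\varepsilon$; and the encoder and the decoder are computed with a number of bit operations (size of a Boolean straight-line program) that is polynomial in $n$. 2. For every non-dyadic source $p$ with $p(a)>0$ for all $a\in\mathcal X$ there is a constant $\alpha_v>0$ (independent of $\varepsilon$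 and $n$) such that for every $\varepsilon>0$ (with $H(p)+\varepsilon<\log|\mathcal X|$ in case $|\mathcal X|$ is a power of two) and all sufficiently large $n$, the same schemes with $R=H(p)+\varepsilon$ satisfy $$r_{wc}(s)<s\cdot r^*_{wc}(1;p,H(p)+\varepsilon)\qquad\text{for all } s\le n \text{ with } s\ge\alpha_v\log\log n .$$ -/

import Mathlib

open Filter Topology

noncomputable section

namespace LocalSourceCoding

/-- An adaptive algorithm that probes the bits of a word of length `ℓ` one after the other and
finally outputs an element of `β`. `query j t₀ t₁` probes bit `j` and goes on with `t₀` if the bit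
is `0` and with `t₁` if it is `1`. -/
inductive DecisionTree (ℓ : ℕ) (β : Type*) where
  | leaf (b : β) : DecisionTree ℓ β
  | query (j : Fin ℓ) (t₀ t₁ : DecisionTree ℓ β) : DecisionTree ℓ β

namespace DecisionTree

variable {ℓ : ℕ} {β : Type*}

/-- The output of the algorithm on the word `c`. -/
def eval (c : Fin ℓ → Bool) : DecisionTree ℓ β → β
  | leaf b => b
  | query j t₀ t₁ => if c j then eval c t₁ else eval c t₀

/-- The number of bits of `c` that the algorithm probes when it is run on `c`. -/
def queries (c : Fin ℓ → Bool) : DecisionTree ℓ β → ℕ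
  | leaf _ => 0
  | query j t₀ t₁ => 1 + (if c j then queries c t₁ else queries c t₀)

end DecisionTree

/-- A fixed-length compression scheme for messages of `n` symbols of the alphabet `A`, with
codewords of `ℓ` bits. -/
structure CompressionScheme (A : Type*) (n ℓ : ℕ) where
  enc : (Fin n → A) → (Fin ℓ → Bool)
  dec : (Fin ℓ → Bool) → (Fin n → A)

section Sources

variable {A : Type*} [Fintype A]

/-- Entropy in bits of a distribution on a finite alphabet. -/
def entropy (p : A → ℝ) : ℝ := -∑ a, p a * Real.logb 2 (p a)

/-- A distribution is dyadic if each probability is a power of `1/2`. -/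
def IsDyadic (p : A → ℝ) : Prop := ∀ a, ∃ k : ℕ, p a = (1 / 2 : ℝ) ^ k

/-- The probability of the word `x` under `n` independent draws from `p`. -/
def iidProb (p : A → ℝ) {n : ℕ} (x : Fin n → A) : ℝ := ∏ i, p (x i)

open Classical in
/-- The probability that a message drawn i.i.d. from `p` is not reproduced. -/
def errorProb (p : A → ℝ) {n ℓ : ℕ} (S : CompressionScheme A n ℓ) : ℝ :=
  ∑ x : Fin n → A, if S.dec (S.enc x) ≠ x then iidProb p x else 0

end Sources

/-- A local decoder: `tree i s` is the adaptive algorithm that recovers the fragment of length `s`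
starting at position `i` (positions are `0, …, n - 1`). It has to be correct for each message that
the scheme itself reproduces. -/
structure LocalDecoder {A : Type*} {n ℓ : ℕ} (S : CompressionScheme A n ℓ) where
  tree : ∀ _i s : ℕ, DecisionTree ℓ (Fin s → A)
  correct : ∀ (i s : ℕ) (h : i + s ≤ n) (x : Fin n → A), S.dec (S.enc x) = x →
    (tree i s).eval (S.enc x) = fun k : Fin s => x ⟨i + (k : ℕ), by omega⟩

/-- The worst-case local decodability `r_wc(s)`: the largest number of probed bits, over all
fragments of length `s` and all messages. -/
def LocalDecoder.worstCase {A : Type*} [Fintype A] {n ℓ : ℕ} {S : CompressionScheme A n ℓ}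
    (D : LocalDecoder S) (s : ℕ) : ℕ := by
  classical
  exact (Finset.range (n + 1 - s)).sup fun i =>
    (Finset.univ : Finset (Fin n → A)).sup fun x => (D.tree i s).queries (S.enc x)

/-- The message `x` with the fragment of length `s` at position `i` replaced by `y`. -/
def replaceFragment {A : Type*} {n : ℕ} (x : Fin n → A) (i : ℕ) {s : ℕ} (y : Fin s → A) :
    Fin n → A :=
  fun k => if h : i ≤ (k : ℕ) ∧ (k : ℕ) < i + s then y ⟨k - i, by omega⟩ else x k

/-- The word `c` after the bits prescribed by `w` have been written. -/
def applyWrites {ℓ : ℕ} (w : Fin ℓ → Option Bool) (c : Fin ℓ → Bool) : Fin ℓ → Bool :=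
  fun j => (w j).getD (c j)

/-- The number of bits that `w` writes. -/
def writeCount {ℓ : ℕ} (w : Fin ℓ → Option Bool) : ℕ :=
  (Finset.univ.filter fun j => (w j).isSome = true).card

/-- A local updater: `tree i s y` adaptively probes bits of the current codeword and then outputs
the bits to write, so that the new codeword is that of the message with the fragment of length `s`
at position `i` replaced by `y`. It knows `i`, `s`, `y` but neither the message nor the codeword,
and it has to be correct for each current message that the scheme reproduces. -/
structure LocalUpdater {A : Type*} {n ℓ : ℕ} (S : CompressionScheme A n ℓ) where
  tree : ∀ (_i s : ℕ) (_y : Fin s → A), DecisionTree ℓ (Fin ℓ → Option Bool)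
  correct : ∀ (i s : ℕ) (_h : i + s ≤ n) (y : Fin s → A) (x : Fin n → A),
    S.dec (S.enc x) = x →
    applyWrites ((tree i s y).eval (S.enc x)) (S.enc x) = S.enc (replaceFragment x i y)

/-- The number of bits read plus the number of bits written by an update. -/
def LocalUpdater.cost {A : Type*} {n ℓ : ℕ} {S : CompressionScheme A n ℓ}
    (U : LocalUpdater S) (i : ℕ) {s : ℕ} (y : Fin s → A) (x : Fin n → A) : ℕ :=
  (U.tree i s y).queries (S.enc x) + writeCount ((U.tree i s y).eval (S.enc x))

/-- The average update efficiency `t_avg(s)`: the largest expected cost over all positions of the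
fragment, where the message and the new fragment are independent and i.i.d. from `p`. -/
def LocalUpdater.average {A : Type*} [Fintype A] {n ℓ : ℕ} {S : CompressionScheme A n ℓ}
    (U : LocalUpdater S) (p : A → ℝ) (s : ℕ) : ℝ :=
  ⨆ i : Fin (n + 1 - s), ∑ x : Fin n → A, ∑ y : Fin s → A,
    iidProb p x * iidProb p y * (U.cost i y x : ℝ)

/-- A compression scheme for messages of length `n` with a local decoder and a local updater. -/
structure LocalCode (A : Type*) (n : ℕ) where
  len : ℕ
  scheme : CompressionScheme A n len
  decoder : LocalDecoder scheme
  updater : LocalUpdater scheme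

/-- A straight-line program of `m` bit operations (NAND gates), with input bits indexed by `ι` and
output bits indexed by `κ`. A gate reads constants, input bits and results of earlier gates. -/
structure BitProgram (ι κ : Type*) (m : ℕ) where
  left : Fin m → Bool ⊕ ι ⊕ Fin m
  right : Fin m → Bool ⊕ ι ⊕ Fin m
  out : κ → Bool ⊕ ι ⊕ Fin m
  left_lt : ∀ g g', left g = Sum.inr (Sum.inr g') → g' < g
  right_lt : ∀ g g', right g = Sum.inr (Sum.inr g') → g' < g

/-- The value of a wire, given the input bits `u` and the results `v` of the gates. -/
def wireValue {ι : Type*} {m : ℕ} (u : ι → Bool) (v : Fin m → Bool) :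
    Bool ⊕ ι ⊕ Fin m → Bool
  | Sum.inl b => b
  | Sum.inr (Sum.inl k) => u k
  | Sum.inr (Sum.inr g) => v g

/-- On input `u` the program outputs `w`. -/
def BitProgram.Outputs {ι κ : Type*} {m : ℕ} (P : BitProgram ι κ m) (u : ι → Bool)
    (w : κ → Bool) : Prop :=
  ∃ v : Fin m → Bool,
    (∀ g, v g = !(wireValue u v (P.left g) && wireValue u v (P.right g))) ∧
      ∀ k, wireValue u v (P.out k) = w k

open Classical in
/-- The bits that represent a message: for each position and each letter, whether that letter
stands at that position. -/
def messageBits {A : Type*} {n : ℕ} (x : Fin n → A) : Fin n × A → Bool :=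
  fun q => decide (x q.1 = q.2)

/-- Encoding takes at most `m` bit operations. -/
def EncodesWithin {A : Type*} {n ℓ : ℕ} (S : CompressionScheme A n ℓ) (m : ℕ) : Prop :=
  ∃ m' ≤ m, ∃ P : BitProgram (Fin n × A) (Fin ℓ) m',
    ∀ x : Fin n → A, P.Outputs (messageBits x) (S.enc x)

/-- Decoding takes at most `m` bit operations. -/
def DecodesWithin {A : Type*} {n ℓ : ℕ} (S : CompressionScheme A n ℓ) (m : ℕ) : Prop :=
  ∃ m' ≤ m, ∃ P : BitProgram (Fin ℓ) (Fin n × A) m',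
    ∀ c : Fin ℓ → Bool, P.Outputs c (messageBits (S.dec c))

/-- `r*_wc(1)` at rate `R`: the least worst-case local decodability of a single symbol that any
sequence of compression schemes of rate at most `R` with vanishing probability of error can have
(for infinitely many blocklengths). -/
def optimalWorstCase {A : Type*} [Fintype A] (p : A → ℝ) (R : ℝ) : ℕ∞ :=
  ⨅ (ℓ : ℕ → ℕ) (S : ∀ n, CompressionScheme A n (ℓ n)) (D : ∀ n, LocalDecoder (S n))
    (_ : ∀ n : ℕ, (ℓ n : ℝ) ≤ n * R)
    (_ : Tendsto (fun n => errorProb p (S n)) atTop (𝓝 0)),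
    liminf (fun n => ((D n).worstCase 1 : ℕ∞)) atTop

/-- `log log n`, with logarithms to the base `2`. -/
def loglog (n : ℕ) : ℝ := Real.logb 2 (Real.logb 2 n)

end LocalSourceCoding

end

open LocalSourceCoding

/-! The upper bounds come from one two-level code. A message is cut into blocks of `b` symbols, with
`b` proportional to log log n; `b` blocks form a group, and `lg n` groups form a section. A block is
stored in a slot just large enough for typical blocks, those whose type class has at most `2 ^ (b *
h)` words, where `h` lies slightly above the entropy. This notion of typicality involves no source,
so the code is universal. Atypical blocks are written raw into a short list of their group, and
groups that overflow their list are written raw into a list of their section; pointers lead to the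
entries. Pointers and lists take a vanishing fraction of the codeword.

For large n, a block is atypical with probability at most `θ ^ b`, `θ < 1`
(`exists_prob_not_typical_le`). By independence (`prob_card_lt_le`, applied at both levels) a group
overflows with probability at most `2 ^ (-6 b)`, and some section overflows with probability at most
`2 ^ (-4 lg n)`; only the latter event causes an error (`exists_failure_bounds`).

To read a block one reads at most two pointers and one slot or entry, O(log log n) bits in the worst
case. An update rewrites the touched blocks; if exceptions interfere it rewrites the touched groups,
and failing that the touched sections. These repairs are so rare that they do not affect the order
of the average cost (`average_layout_le`). Each bit of the codeword comes from a cascade of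
functions of O(log n) bits, hence from a circuit of polynomial size.

For the lower bound, suppose that each symbol can be read with `r = ⌊log |A|⌋` probes. A tree with
`r` probes has at most `2 ^ r` outputs, so `|A| = 2 ^ r` and all trees are complete with distinct
leaves. Since nearly error-free schemes reproduce messages with any two letters at any two
positions, trees of different symbols share no bit, and the codeword has at least `n * r` bits,
against the rate. Thus an optimal scheme needs at least `lg |A| = ⌊log |A|⌋ + 1` probes per symbol
(`le_optimalWorstCase`). Long fragments of the two-level code cost at most about `log |A|` bits per
symbol plus a pointer overhead, and the block length is chosen so that this stays below `lg |A|`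
(`exists_worstCase_layout_lt`). -/

noncomputable section

namespace LocalSourceCoding

/-! ### Decision trees: composition and the structure of trees with few probes -/

namespace DecisionTree

variable {ℓ : ℕ} {β γ : Type*}

/-- The length of the longest branch. -/
def depth : DecisionTree ℓ β → ℕ
  | leaf _ => 0
  | query _ t₀ t₁ => 1 + max t₀.depth t₁.depth

/-- Run `t` and continue with the algorithm that depends on its output. -/
def bind : DecisionTree ℓ β → (β → DecisionTree ℓ γ) → DecisionTree ℓ γ
  | leaf b, k => k b
  | query j t₀ t₁, k => query j (bind t₀ k) (bind t₁ k)

/-- Apply a function to the output of a decision tree. -/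
def map (f : β → γ) (t : DecisionTree ℓ β) : DecisionTree ℓ γ := t.bind fun b => leaf (f b)

theorem queries_le_depth (c : Fin ℓ → Bool) (t : DecisionTree ℓ β) : t.queries c ≤ t.depth := by
  induction t with
  | leaf b => simp [queries]
  | query j t₀ t₁ h₀ h₁ =>
    simp only [queries, depth]
    split_ifs <;> omega

@[simp] theorem eval_bind (c : Fin ℓ → Bool) (t : DecisionTree ℓ β)
    (k : β → DecisionTree ℓ γ) : (t.bind k).eval c = (k (t.eval c)).eval c := by
  induction t with
  | leaf b => rfl
  | query j t₀ t₁ h₀ h₁ =>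
    simp only [bind, eval]
    split_ifs <;> assumption

theorem queries_bind (c : Fin ℓ → Bool) (t : DecisionTree ℓ β)
    (k : β → DecisionTree ℓ γ) :
    (t.bind k).queries c = t.queries c + (k (t.eval c)).queries c := by
  induction t with
  | leaf b => simp [bind, queries, eval]
  | query j t₀ t₁ h₀ h₁ =>
    simp only [bind, queries, eval]
    split_ifs <;> omega

theorem depth_bind_le (t : DecisionTree ℓ β) (k : β → DecisionTree ℓ γ) (d : ℕ)
    (hk : ∀ b, (k b).depth ≤ d) : (t.bind k).depth ≤ t.depth + d := by
  induction t with
  | leaf b => simpa [bind, depth] using hk b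
  | query j t₀ t₁ h₀ h₁ =>
    simp only [bind, depth]
    omega

@[simp] theorem eval_map (c : Fin ℓ → Bool) (t : DecisionTree ℓ β) (f : β → γ) :
    (t.map f).eval c = f (t.eval c) := by
  simp [map, eval]

theorem depth_map (t : DecisionTree ℓ β) (f : β → γ) : (t.map f).depth ≤ t.depth := by
  simpa [map] using depth_bind_le t (fun b => (leaf (f b) : DecisionTree ℓ γ)) 0
    (by simp [depth])

/-- Probe the bits at positions `f 0, f 1, …` and output their values. -/
def readFam : ∀ {m : ℕ}, (Fin m → Fin ℓ) → DecisionTree ℓ (Fin m → Bool)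
  | 0, _ => leaf Fin.elim0
  | _ + 1, f => query (f 0)
      ((readFam fun i => f i.succ).map fun v => Fin.cons false v)
      ((readFam fun i => f i.succ).map fun v => Fin.cons true v)

@[simp] theorem eval_readFam (c : Fin ℓ → Bool) {m : ℕ} (f : Fin m → Fin ℓ) :
    (readFam f).eval c = fun i => c (f i) := by
  induction m with
  | zero => funext i; exact i.elim0
  | succ m ih =>
    funext i
    simp only [readFam, eval, eval_map, ih]
    cases h : c (f 0) <;> refine Fin.cases ?_ (fun i => ?_) i <;> simp [h]

theorem depth_readFam {m : ℕ} (f : Fin m → Fin ℓ) : (readFam f).depth ≤ m := by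
  induction m with
  | zero => simp [readFam, depth]
  | succ m ih =>
    have h := ih fun i => f i.succ
    have h₀ := depth_map (readFam fun i => f i.succ) fun v =>
      (Fin.cons false v : Fin (m + 1) → Bool)
    have h₁ := depth_map (readFam fun i => f i.succ) fun v =>
      (Fin.cons true v : Fin (m + 1) → Bool)
    simp only [readFam, depth]
    omega

/-- Run the algorithms `t start, …, t (start + k - 1)` one after the other and collect their
outputs. -/
def collect (b₀ : β) (t : ℕ → DecisionTree ℓ β) :
    ℕ → ℕ → DecisionTree ℓ (ℕ → β)
  | 0, _ => leaf fun _ => b₀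
  | k + 1, start => (t start).bind fun v =>
      (collect b₀ t k (start + 1)).map fun f => Function.update f start v

theorem eval_collect (b₀ : β) (t : ℕ → DecisionTree ℓ β) (c : Fin ℓ → Bool) (k start j : ℕ)
    (h₁ : start ≤ j) (h₂ : j < start + k) :
    (collect b₀ t k start).eval c j = (t j).eval c := by
  induction k generalizing start with
  | zero => omega
  | succ k ih =>
    simp only [collect, eval_bind, eval_map]
    by_cases hj : j = start
    · subst hj; simp
    · rw [Function.update_of_ne hj]
      exact ih (start + 1) (by omega) (by omega)

theorem depth_collect (b₀ : β) (t : ℕ → DecisionTree ℓ β) (d : ℕ)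
    (hd : ∀ j, (t j).depth ≤ d) (k start : ℕ) : (collect b₀ t k start).depth ≤ k * d := by
  induction k generalizing start with
  | zero => simp [collect, depth]
  | succ k ih =>
    refine (depth_bind_le _ _ (k * d) fun v => (depth_map _ _).trans (ih _)).trans ?_
    have := hd start
    rw [Nat.succ_mul]; omega

/-- The set of bits that the algorithm probes when it is run on `c`. -/
def probed (c : Fin ℓ → Bool) : DecisionTree ℓ β → Finset (Fin ℓ)
  | leaf _ => ∅
  | query j t₀ t₁ => insert j (if c j then probed c t₁ else probed c t₀)

theorem card_image_eval_le [DecidableEq β] (t : DecisionTree ℓ β) (r : ℕ) (W : Finset (Fin ℓ → Bool))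
    (h : ∀ c ∈ W, t.queries c ≤ r) : (W.image fun c => t.eval c).card ≤ 2 ^ r := by
  induction t generalizing r W with
  | leaf b =>
    refine le_trans (Finset.card_le_card (t := {b}) ?_) (by simpa using Nat.one_le_two_pow)
    intro y; simp [eval]; tauto
  | query j t₀ t₁ h₀ h₁ =>
    rcases W.eq_empty_or_nonempty with rfl | ⟨c₀, hc₀⟩
    · simp
    obtain ⟨r, rfl⟩ : ∃ r', r = r' + 1 := by
      have := h c₀ hc₀
      simp only [queries] at this
      exact ⟨r - 1, by omega⟩
    have e₁ := h₁ r (W.filter fun c => c j = true) fun c hc => by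
      have := h c (Finset.mem_filter.1 hc).1
      simp only [queries, (Finset.mem_filter.1 hc).2] at this
      simp at this; omega
    have e₀ := h₀ r (W.filter fun c => ¬ c j = true) fun c hc => by
      have := h c (Finset.mem_filter.1 hc).1
      simp only [queries, (Finset.mem_filter.1 hc).2] at this
      simp at this; omega
    have key : (W.image fun c => (query j t₀ t₁).eval c) ⊆
        ((W.filter fun c => c j = true).image fun c => t₁.eval c) ∪
        ((W.filter fun c => ¬ c j = true).image fun c => t₀.eval c) := by
      intro y hy
      obtain ⟨c, hc, rfl⟩ := Finset.mem_image.1 hy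
      by_cases hj : c j = true
      · exact Finset.mem_union_left _ (Finset.mem_image.2
          ⟨c, Finset.mem_filter.2 ⟨hc, hj⟩, by simp [eval, hj]⟩)
      · exact Finset.mem_union_right _ (Finset.mem_image.2
          ⟨c, Finset.mem_filter.2 ⟨hc, hj⟩, by simp [eval, hj]⟩)
    have := (Finset.card_le_card key).trans (Finset.card_union_le _ _)
    rw [pow_succ]; omega

/-- A decision tree that makes at most `r` probes on each word of `W` and has `2 ^ r` outputs is a
complete binary tree with distinct leaves. -/
theorem complete_of_card_image [DecidableEq β] (t : DecisionTree ℓ β) (r : ℕ) (W : Finset (Fin ℓ → Bool))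
    (h : ∀ c ∈ W, t.queries c ≤ r) (hr : 2 ^ r ≤ (W.image fun c => t.eval c).card) :
    (∀ c ∈ W, ∀ j ∈ t.probed c, ∃ c' ∈ W, j ∈ t.probed c' ∧ c' j ≠ c j) ∧
    (∀ c ∈ W, ∀ c' ∈ W, t.eval c = t.eval c' → ∀ j ∈ t.probed c, c' j = c j) ∧
    ∀ c ∈ W, r ≤ (t.probed c).card := by
  induction t generalizing r W with
  | leaf b =>
    have : (W.image fun c => (leaf b : DecisionTree ℓ β).eval c).card ≤ 1 := by
      refine Finset.card_le_card (t := {b}) ?_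
      intro y; simp [eval]; tauto
    have hr0 : r = 0 := by
      by_contra h0
      have : 2 ^ 1 ≤ 2 ^ r := Nat.pow_le_pow_right (by norm_num) (by omega)
      omega
    simp [probed, hr0]
  | query j t₀ t₁ h₀ h₁ =>
    rcases W.eq_empty_or_nonempty with rfl | ⟨c₀, hc₀⟩
    · simp
    obtain ⟨r, rfl⟩ : ∃ r', r = r' + 1 := by
      have := h c₀ hc₀
      simp only [queries] at this
      exact ⟨r - 1, by omega⟩
    set W₁ := W.filter fun c => c j = true with hW₁
    set W₀ := W.filter fun c => ¬ c j = true with hW₀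
    have q₁ : ∀ c ∈ W₁, t₁.queries c ≤ r := fun c hc => by
      have := h c (Finset.mem_filter.1 hc).1
      simp only [queries, (Finset.mem_filter.1 hc).2] at this
      simp at this; omega
    have q₀ : ∀ c ∈ W₀, t₀.queries c ≤ r := fun c hc => by
      have := h c (Finset.mem_filter.1 hc).1
      simp only [queries, (Finset.mem_filter.1 hc).2] at this
      simp at this; omega
    have e₁ := card_image_eval_le t₁ r W₁ q₁
    have e₀ := card_image_eval_le t₀ r W₀ q₀
    have key : (W.image fun c => (query j t₀ t₁).eval c) ⊆
        (W₁.image fun c => t₁.eval c) ∪ (W₀.image fun c => t₀.eval c) := by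
      intro y hy
      obtain ⟨c, hc, rfl⟩ := Finset.mem_image.1 hy
      by_cases hj : c j = true
      · exact Finset.mem_union_left _ (Finset.mem_image.2
          ⟨c, Finset.mem_filter.2 ⟨hc, hj⟩, by simp [eval, hj]⟩)
      · exact Finset.mem_union_right _ (Finset.mem_image.2
          ⟨c, Finset.mem_filter.2 ⟨hc, hj⟩, by simp [eval, hj]⟩)
    have hu := Finset.card_le_card key
    have hui := Finset.card_union_add_card_inter (W₁.image fun c => t₁.eval c)
      (W₀.image fun c => t₀.eval c)
    rw [pow_succ] at hr
    -- Each half has at most `2 ^ r` outputs and together they have `2 ^ (r + 1)`: both bounds are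
    -- attained and no output is shared.
    have hdisj : (W₁.image fun c => t₁.eval c) ∩ (W₀.image fun c => t₀.eval c) = ∅ := by
      rw [← Finset.card_eq_zero]; omega
    obtain ⟨a₁, b₁, d₁⟩ := h₁ r W₁ q₁ (by omega)
    obtain ⟨a₀, b₀, d₀⟩ := h₀ r W₀ q₀ (by omega)
    have hpos : 0 < 2 ^ r := by positivity
    obtain ⟨c₁, hc₁⟩ : W₁.Nonempty := by
      rw [← Finset.image_nonempty (f := fun c => t₁.eval c), ← Finset.card_pos]; omega
    obtain ⟨c₂, hc₂⟩ : W₀.Nonempty := by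
      rw [← Finset.image_nonempty (f := fun c => t₀.eval c), ← Finset.card_pos]; omega
    -- On this half the bit `j` is constant, whereas each bit probed by the saturated subtree takes
    -- both values; so `j` is not probed again.
    have n₁ : ∀ c ∈ W₁, j ∉ t₁.probed c := fun c hc hj => by
      obtain ⟨c', hc', -, hne⟩ := a₁ c hc j hj
      exact hne ((Finset.mem_filter.1 hc').2.trans (Finset.mem_filter.1 hc).2.symm)
    have n₀ : ∀ c ∈ W₀, j ∉ t₀.probed c := fun c hc hj => by
      obtain ⟨c', hc', -, hne⟩ := a₀ c hc j hj
      have x := (Finset.mem_filter.1 hc').2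
      have y := (Finset.mem_filter.1 hc).2
      simp only [Bool.not_eq_true] at x y
      exact hne (x.trans y.symm)
    have p₁ : ∀ c, c j = true → (query j t₀ t₁).probed c = insert j (t₁.probed c) :=
      fun c hc => by simp [probed, hc]
    have p₀ : ∀ c, ¬ c j = true → (query j t₀ t₁).probed c = insert j (t₀.probed c) :=
      fun c hc => by simp [probed, hc]
    have v₁ : ∀ c, c j = true → (query j t₀ t₁).eval c = t₁.eval c :=
      fun c hc => by simp [eval, hc]
    have v₀ : ∀ c, ¬ c j = true → (query j t₀ t₁).eval c = t₀.eval c :=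
      fun c hc => by simp [eval, hc]
    have mW₁ : ∀ c, c ∈ W → c j = true → c ∈ W₁ := fun c h h' => Finset.mem_filter.2 ⟨h, h'⟩
    have mW₀ : ∀ c, c ∈ W → ¬ c j = true → c ∈ W₀ := fun c h h' => Finset.mem_filter.2 ⟨h, h'⟩
    refine ⟨fun c hc i hi => ?_, fun c hc c' hc' hv i hi => ?_, fun c hc => ?_⟩
    · by_cases hj : c j = true
      · rw [p₁ c hj, Finset.mem_insert] at hi
        rcases hi with rfl | hi
        · have := (Finset.mem_filter.1 hc₂)
          exact ⟨c₂, this.1, by rw [p₀ _ this.2]; simp, fun e => this.2 (e.trans hj)⟩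
        · obtain ⟨c', hc', hi', hne⟩ := a₁ c (mW₁ c hc hj) i hi
          have := (Finset.mem_filter.1 hc')
          exact ⟨c', this.1, by rw [p₁ _ this.2]; simp [hi'], hne⟩
      · rw [p₀ c hj, Finset.mem_insert] at hi
        rcases hi with rfl | hi
        · have := (Finset.mem_filter.1 hc₁)
          exact ⟨c₁, this.1, by rw [p₁ _ this.2]; simp, fun e => hj (e.symm.trans this.2)⟩
        · obtain ⟨c', hc', hi', hne⟩ := a₀ c (mW₀ c hc hj) i hi
          have := (Finset.mem_filter.1 hc')
          exact ⟨c', this.1, by rw [p₀ _ this.2]; simp [hi'], hne⟩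
    · have hne : ∀ x ∈ W₁, ∀ y ∈ W₀, t₁.eval x ≠ t₀.eval y := fun x hx y hy e => by
        have : t₁.eval x ∈ (∅ : Finset β) := by
          rw [← hdisj]
          exact Finset.mem_inter.2 ⟨Finset.mem_image_of_mem _ hx,
            Finset.mem_image.2 ⟨y, hy, e.symm⟩⟩
        simp at this
      by_cases hj : c j = true <;> by_cases hj' : c' j = true
      · rw [p₁ c hj, Finset.mem_insert] at hi
        rcases hi with rfl | hi
        · rw [hj, hj']
        · exact b₁ c (mW₁ c hc hj) c' (mW₁ c' hc' hj') (by rwa [v₁ _ hj, v₁ _ hj'] at hv) i hi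
      · exact absurd (by rwa [v₁ _ hj, v₀ _ hj'] at hv) (hne c (mW₁ c hc hj) c' (mW₀ c' hc' hj'))
      · exact absurd (by rw [v₀ _ hj, v₁ _ hj'] at hv; exact hv.symm)
          (hne c' (mW₁ c' hc' hj') c (mW₀ c hc hj))
      · rw [p₀ c hj, Finset.mem_insert] at hi
        rcases hi with rfl | hi
        · simp only [Bool.not_eq_true] at hj hj'; rw [hj, hj']
        · exact b₀ c (mW₀ c hc hj) c' (mW₀ c' hc' hj') (by rwa [v₀ _ hj, v₀ _ hj'] at hv) i hi
    · by_cases hj : c j = true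
      · rw [p₁ c hj, Finset.card_insert_of_notMem (n₁ c (mW₁ c hc hj))]
        have := d₁ c (mW₁ c hc hj); omega
      · rw [p₀ c hj, Finset.card_insert_of_notMem (n₀ c (mW₀ c hc hj))]
        have := d₀ c (mW₀ c hc hj); omega

end DecisionTree

/-! ### Independence under product distributions -/

section Expectation

theorem extend_comp_embedding {ι κ B : Type*} (e : κ ↪ ι) (x : ι → B) (z : κ → B) :
    Function.extend e z x ∘ e = z := by
  funext k; simp [e.injective.extend_apply]

theorem extend_extend_self {ι κ B : Type*} (e : κ ↪ ι) (x : ι → B) (z : κ → B) :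
    Function.extend e (x ∘ e) (Function.extend e z x) = x := by
  funext i
  by_cases h : ∃ k, e k = i
  · obtain ⟨k, rfl⟩ := h
    simp [e.injective.extend_apply]
  · rw [Function.extend_apply' _ _ _ h, Function.extend_apply' _ _ _ h]

/-- Exchanging a fragment with a second word only permutes the factors. The product form needs no
division, so letters of probability zero are harmless. -/
theorem prod_extend {A ι κ : Type*} [Fintype ι] [Fintype κ] {p : A → ℝ} (e : κ ↪ ι) (x : ι → A) (z : κ → A) :
    (∏ i, p (Function.extend e z x i)) * ∏ k, p (x (e k)) = (∏ i, p (x i)) * ∏ k, p (z k) := by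
  classical
  rw [← Finset.prod_mul_prod_compl (Finset.univ.map e) fun i => p (x i),
    ← Finset.prod_mul_prod_compl (Finset.univ.map e) fun i => p (Function.extend e z x i),
    Finset.prod_map, Finset.prod_map]
  have h₁ : ∏ k, p (Function.extend e z x (e k)) = ∏ k, p (z k) :=
    Finset.prod_congr rfl fun k _ => by rw [e.injective.extend_apply]
  have h₂ : ∏ i ∈ (Finset.univ.map e)ᶜ, p (Function.extend e z x i) =
      ∏ i ∈ (Finset.univ.map e)ᶜ, p (x i) :=
    Finset.prod_congr rfl fun i hi => by
      rw [Function.extend_apply']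
      simpa using hi
  rw [h₁, h₂]; ring

variable {A : Type*} [Fintype A] {ι κ : Type*} [Fintype ι] [Fintype κ]

/-- The expectation of `f` for a word with independent letters drawn from `p`. -/
def expect (p : A → ℝ) (f : (ι → A) → ℝ) : ℝ := by
  classical exact ∑ x : ι → A, (∏ i, p (x i)) * f x

theorem expect_def [DecidableEq ι] (p : A → ℝ) (f : (ι → A) → ℝ) :
    expect p f = ∑ x : ι → A, (∏ i, p (x i)) * f x := by
  unfold expect; convert rfl

variable {p : A → ℝ}

theorem prod_nonneg_of_mem (hp : p ∈ stdSimplex ℝ A) (x : ι → A) : 0 ≤ ∏ i, p (x i) :=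
  Finset.prod_nonneg fun i _ => hp.1 (x i)

theorem expect_mono (hp : p ∈ stdSimplex ℝ A) {f g : (ι → A) → ℝ} (h : ∀ x, f x ≤ g x) :
    expect p f ≤ expect p g :=
  Finset.sum_le_sum fun x _ => mul_le_mul_of_nonneg_left (h x) (prod_nonneg_of_mem hp x)

theorem expect_nonneg (hp : p ∈ stdSimplex ℝ A) {f : (ι → A) → ℝ} (h : ∀ x, 0 ≤ f x) :
    0 ≤ expect p f :=
  Finset.sum_nonneg fun x _ => mul_nonneg (prod_nonneg_of_mem hp x) (h x)

theorem expect_add (f g : (ι → A) → ℝ) :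
    expect p (fun x => f x + g x) = expect p f + expect p g := by
  simp only [expect, mul_add, Finset.sum_add_distrib]

theorem expect_const_mul (c : ℝ) (f : (ι → A) → ℝ) :
    expect p (fun x => c * f x) = c * expect p f := by
  simp only [expect, Finset.mul_sum]
  exact Finset.sum_congr rfl fun x _ => by ring

theorem expect_sum {σ : Type*} (s : Finset σ) (f : σ → (ι → A) → ℝ) :
    expect p (fun x => ∑ j ∈ s, f j x) = ∑ j ∈ s, expect p (f j) := by
  simp only [expect, Finset.mul_sum]
  exact Finset.sum_comm

theorem expect_prod (f : ι → A → ℝ) :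
    expect p (fun x => ∏ i, f i (x i)) = ∏ i, ∑ a, p a * f i a := by
  classical
  rw [expect_def, Fintype.prod_sum]
  exact Finset.sum_congr rfl fun x _ => by rw [Finset.prod_mul_distrib]

theorem expect_one (hp : p ∈ stdSimplex ℝ A) : expect p (fun _ : ι → A => 1) = 1 := by
  have := expect_prod (p := p) (ι := ι) fun _ _ => 1
  simpa [hp.2] using this

theorem expect_const (hp : p ∈ stdSimplex ℝ A) (c : ℝ) :
    expect p (fun _ : ι → A => c) = c := by
  have := expect_const_mul (p := p) c (fun _ : ι → A => 1)
  rw [expect_one hp] at this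
  simpa using this

theorem expect_fun_mul_const (f : (ι → A) → ℝ) (c : ℝ) :
    expect p (fun x => f x * c) = expect p f * c := by
  simp only [expect, Finset.sum_mul]
  exact Finset.sum_congr rfl fun x _ => by ring

/-- Exchanging a fragment of one word with an independent word preserves the joint law. -/
theorem expect_swap (e : κ ↪ ι) (G : (ι → A) → (κ → A) → ℝ) :
    expect p (fun x => expect p fun z => G x z) =
      expect p (fun x => expect p fun z => G (Function.extend e z x) (x ∘ e)) := by
  classical
  simp only [expect_def, Finset.mul_sum]
  rw [← Fintype.sum_prod_type', ← Fintype.sum_prod_type']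
  -- The exchange is an involution on pairs of words, and it preserves their weights by
  -- `prod_extend`.
  let E : (ι → A) × (κ → A) ≃ (ι → A) × (κ → A) :=
    Function.Involutive.toPerm (fun q => (Function.extend e q.2 q.1, q.1 ∘ e)) fun q => by
      ext1
      · exact extend_extend_self e q.1 q.2
      · exact extend_comp_embedding e q.1 q.2
  refine (Fintype.sum_equiv E _ _ fun q => ?_).symm
  have := prod_extend (p := p) e q.1 q.2
  change _ = (∏ i, p (Function.extend e q.2 q.1 i)) * ((∏ k, p ((q.1 ∘ e) k)) *
    G (Function.extend e q.2 q.1) (q.1 ∘ e))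
  rw [← mul_assoc, ← mul_assoc]
  simp only [Function.comp_apply]
  rw [this]

/-- A message updated with an independent fragment has the same law as the message itself. -/
theorem expect_extend (hp : p ∈ stdSimplex ℝ A) (e : κ ↪ ι) (f : (ι → A) → ℝ) :
    expect p (fun x => expect p fun z => f (Function.extend e z x)) = expect p f := by
  rw [← expect_swap e fun x _ => f x]
  simp only [expect_const hp]

/-- A fragment of the word and the other letters are independent. -/
theorem expect_mul_of_extend (hp : p ∈ stdSimplex ℝ A) (e : κ ↪ ι) (f : (κ → A) → ℝ)
    (h : (ι → A) → ℝ) (hh : ∀ x z, h (Function.extend e z x) = h x) :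
    expect p (fun x => f (x ∘ e) * h x) = expect p f * expect p h := by
  have h₁ : expect p (fun x => f (x ∘ e) * h x) =
      expect p (fun x => expect p fun _ : κ → A => f (x ∘ e) * h x) := by
    simp only [expect_const hp]
  rw [h₁, expect_swap e]
  -- After the exchange the fragment is the independent word `z`, and `h` does not see it.
  simp only [extend_comp_embedding, hh, expect_fun_mul_const, expect_const_mul]

theorem expect_comp_embedding (hp : p ∈ stdSimplex ℝ A) (e : κ ↪ ι) (f : (κ → A) → ℝ) :
    expect p (fun x : ι → A => f (x ∘ e)) = expect p f := by
  simpa [expect_one hp] using expect_mul_of_extend hp e f (fun _ => 1) fun _ _ => rfl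

/-- Fragments at disjoint positions are independent. -/
theorem expect_prod_of_disjoint (hp : p ∈ stdSimplex ℝ A) {σ : Type*} (F : Finset σ)
    (e : σ → κ ↪ ι) (he : ∀ j ∈ F, ∀ j' ∈ F, j ≠ j' → ∀ k k', e j k ≠ e j' k')
    (f : σ → (κ → A) → ℝ) :
    expect p (fun x => ∏ j ∈ F, f j (x ∘ e j)) = ∏ j ∈ F, expect p (f j) := by
  classical
  induction F using Finset.induction_on with
  | empty => simpa using expect_one hp
  | insert a F ha ih =>
    simp only [Finset.prod_insert ha]
    rw [expect_mul_of_extend hp (e a) (f a) (fun x => ∏ j ∈ F, f j (x ∘ e j)), ih]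
    · exact fun j hj j' hj' => he j (Finset.mem_insert_of_mem hj) j' (Finset.mem_insert_of_mem hj')
    · intro x z
      refine Finset.prod_congr rfl fun j hj => ?_
      congr 1
      funext k
      refine Function.extend_apply' _ _ _ ?_
      rintro ⟨k', hk'⟩
      exact he a (Finset.mem_insert_self _ _) j (Finset.mem_insert_of_mem hj)
        (fun h => ha (h ▸ hj)) k' k hk'

open Classical in
/-- The probability of an event. -/
def prob (p : A → ℝ) (E : (ι → A) → Prop) : ℝ := expect p fun x => if E x then 1 else 0

theorem prob_nonneg (hp : p ∈ stdSimplex ℝ A) (E : (ι → A) → Prop) : 0 ≤ prob p E :=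
  expect_nonneg hp fun x => by split_ifs <;> norm_num

theorem prob_mono (hp : p ∈ stdSimplex ℝ A) {E F : (ι → A) → Prop} (h : ∀ x, E x → F x) :
    prob p E ≤ prob p F :=
  expect_mono hp fun x => by
    by_cases h₁ : E x
    · simp [h₁, h x h₁]
    · simp only [h₁, if_false]; split_ifs <;> norm_num

theorem prob_false : prob p (fun _ : ι → A => False) = 0 := by
  simp [prob, expect]

theorem prob_or_le (hp : p ∈ stdSimplex ℝ A) (E F : (ι → A) → Prop) :
    prob p (fun x => E x ∨ F x) ≤ prob p E + prob p F := by
  unfold prob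
  rw [← expect_add]
  refine expect_mono hp fun x => ?_
  by_cases h₁ : E x <;> by_cases h₂ : F x <;> simp [h₁, h₂]

theorem prob_exists_le (hp : p ∈ stdSimplex ℝ A) {σ : Type*} (s : Finset σ)
    (E : σ → (ι → A) → Prop) :
    prob p (fun x => ∃ j ∈ s, E j x) ≤ ∑ j ∈ s, prob p (E j) := by
  classical
  unfold prob
  rw [← expect_sum]
  refine expect_mono hp fun x => ?_
  have h0 : ∀ j ∈ s, (0 : ℝ) ≤ if E j x then 1 else 0 := fun j _ => by split_ifs <;> norm_num
  split_ifs with h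
  · obtain ⟨j, hj, hE⟩ := h
    refine le_trans ?_ (Finset.single_le_sum h0 hj)
    simp [hE]
  · exact Finset.sum_nonneg h0

theorem prob_comp_embedding (hp : p ∈ stdSimplex ℝ A) (e : κ ↪ ι) (E : (κ → A) → Prop) :
    prob p (fun x : ι → A => E (x ∘ e)) = prob p E := by
  classical exact expect_comp_embedding hp e fun z => if E z then 1 else 0

/-- The probability that more than `k` of `m` independent events of probability at most `δ`
happen. -/
theorem prob_card_lt_le (hp : p ∈ stdSimplex ℝ A) {m : ℕ} (e : Fin m → κ ↪ ι)
    (he : ∀ j j', j ≠ j' → ∀ k k', e j k ≠ e j' k') (E : Fin m → (κ → A) → Prop)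
    [∀ x : ι → A, DecidablePred fun j => E j (x ∘ e j)]
    {δ : ℝ} (h0 : 0 ≤ δ) (hδ : ∀ j, prob p (E j) ≤ δ) (k : ℕ) :
    prob p (fun x => k < (Finset.univ.filter fun j => E j (x ∘ e j)).card) ≤
      2 ^ m * δ ^ (k + 1) := by
  classical
  -- If more than `k` events happen, then some `k + 1` of them happen jointly: union bound over the
  -- sets of `k + 1` events, of which there are at most `2 ^ m`.
  have h₁ : prob p (fun x => k < (Finset.univ.filter fun j => E j (x ∘ e j)).card) ≤
      ∑ F ∈ Finset.powersetCard (k + 1) (Finset.univ : Finset (Fin m)),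
        prob p (fun x => ∀ j ∈ F, E j (x ∘ e j)) := by
    refine le_trans (prob_mono hp fun x hx => ?_) (prob_exists_le hp _ _)
    obtain ⟨F, hF, hc⟩ := Finset.exists_subset_card_eq hx
    exact ⟨F, Finset.mem_powersetCard.2 ⟨Finset.subset_univ _, hc⟩,
      fun j hj => (Finset.mem_filter.1 (hF hj)).2⟩
  refine h₁.trans ?_
  have h₂ : ∀ F ∈ Finset.powersetCard (k + 1) (Finset.univ : Finset (Fin m)),
      prob p (fun x => ∀ j ∈ F, E j (x ∘ e j)) ≤ δ ^ (k + 1) := by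
    intro F hF
    have := expect_prod_of_disjoint hp F e (fun j _ j' _ => he j j')
      (fun j z => if E j z then (1 : ℝ) else 0)
    have hcalc : prob p (fun x => ∀ j ∈ F, E j (x ∘ e j)) = ∏ j ∈ F, prob p (E j) := by
      unfold prob
      rw [← this]
      congr 1
      funext x
      by_cases hx : ∀ j ∈ F, E j (x ∘ e j)
      · rw [if_pos hx]
        exact (Finset.prod_eq_one fun j hj => if_pos (hx j hj)).symm
      · rw [if_neg hx]
        push Not at hx
        obtain ⟨j, hj, hx⟩ := hx
        rw [Finset.prod_eq_zero hj]
        rw [if_neg hx]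
    rw [hcalc, ← (Finset.mem_powersetCard.1 hF).2, ← Finset.prod_const]
    exact Finset.prod_le_prod (fun j _ => prob_nonneg hp _) fun j _ => hδ j
  refine (Finset.sum_le_sum h₂).trans ?_
  rw [Finset.sum_const, Finset.card_powersetCard, Finset.card_univ, Fintype.card_fin, nsmul_eq_mul]
  refine mul_le_mul_of_nonneg_right ?_ (pow_nonneg h0 _)
  exact_mod_cast Nat.choose_le_two_pow m (k + 1)

end Expectation

/-! ### Lower bound for reading a single symbol -/

section LowerBound

variable {A : Type*} [Fintype A]

theorem errorProb_eq_prob (p : A → ℝ) {n ℓ : ℕ} (S : CompressionScheme A n ℓ) :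
    errorProb p S = prob p fun x : Fin n → A => S.dec (S.enc x) ≠ x := by
  classical
  unfold errorProb prob
  rw [expect_def]
  refine Finset.sum_congr rfl fun x _ => ?_
  by_cases h : S.dec (S.enc x) = x <;> simp [h, iidProb]

theorem prob_word {p : A → ℝ} {κ : Type*} [Fintype κ] (u : κ → A) :
    prob p (fun x : κ → A => x = u) = ∏ k, p (u k) := by
  classical
  unfold prob
  rw [expect_def, Finset.sum_eq_single u]
  · simp
  · intro x _ hx; simp [hx]
  · simp

/-- Each combination of letters at two positions occurs in a message that is reproduced, unless
the probability of error is large. -/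
theorem exists_correct_of_errorProb_lt {p : A → ℝ} (hp : p ∈ stdSimplex ℝ A) {n ℓ : ℕ}
    (S : CompressionScheme A n ℓ) {i k : Fin n} (hik : i ≠ k) {u v : A}
    (hlt : errorProb p S < p u * p v) :
    ∃ x, S.dec (S.enc x) = x ∧ x i = u ∧ x k = v := by
  by_contra hno
  push Not at hno
  let e : Fin 2 ↪ Fin n := ⟨![i, k], by
    intro a b hab
    fin_cases a <;> fin_cases b <;> simp_all⟩
  have h₁ : prob p (fun x : Fin n → A => x ∘ e = ![u, v]) = p u * p v := by
    rw [prob_comp_embedding hp e fun z => z = ![u, v], prob_word]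
    simp
  rw [errorProb_eq_prob, ← h₁] at hlt
  refine absurd hlt (not_lt.2 (prob_mono hp fun x hx hgood => ?_))
  have h0 := congrFun hx 0
  have h1 := congrFun hx 1
  simp [e] at h0 h1
  exact hno x hgood h0 h1

theorem LocalDecoder.queries_le_worstCase {n ℓ : ℕ} {S : CompressionScheme A n ℓ}
    (D : LocalDecoder S) {i s : ℕ} (h : i + s ≤ n) (x : Fin n → A) :
    (D.tree i s).queries (S.enc x) ≤ D.worstCase s := by
  classical
  unfold LocalDecoder.worstCase
  refine le_trans ?_ (Finset.le_sup (b := i) (by simp; omega))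
  exact Finset.le_sup (f := fun x => (D.tree i s).queries (S.enc x)) (Finset.mem_univ x)

theorem LocalDecoder.worstCase_le {n ℓ : ℕ} {S : CompressionScheme A n ℓ}
    (D : LocalDecoder S) (s d : ℕ) (h : ∀ i, (D.tree i s).depth ≤ d) : D.worstCase s ≤ d := by
  classical
  unfold LocalDecoder.worstCase
  exact Finset.sup_le fun i _ => Finset.sup_le fun x _ =>
    ((D.tree i s).queries_le_depth _).trans (h i)

/-- A scheme that decodes each letter with few probes has rate at least `log |A|`. -/
theorem log_card_lt_worstCase [Nonempty A] {p : A → ℝ} (hp : p ∈ stdSimplex ℝ A)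
    {δ : ℝ} (hδ : 0 < δ) (hpδ : ∀ a, δ ≤ p a) {R : ℝ}
    (hR : ∀ k : ℕ, Fintype.card A = 2 ^ k → R < k) {n ℓ : ℕ} (hn : 2 ≤ n)
    {S : CompressionScheme A n ℓ} (D : LocalDecoder S) (hℓ : (ℓ : ℝ) ≤ n * R)
    (herr : errorProb p S < δ * δ) : Nat.log 2 (Fintype.card A) < D.worstCase 1 := by
  classical
  by_contra hle
  push Not at hle
  set r := Nat.log 2 (Fintype.card A) with hr
  have hcard : 2 ^ r ≤ Fintype.card A := Nat.pow_log_le_self 2 Fintype.card_ne_zero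
  have hex : ∀ i k : Fin n, i ≠ k → ∀ u v, ∃ x, S.dec (S.enc x) = x ∧ x i = u ∧ x k = v :=
    fun i k hik u v => exists_correct_of_errorProb_lt hp S hik
      (herr.trans_le (mul_le_mul (hpδ u) (hpδ v) hδ.le (hδ.le.trans (hpδ u))))
  have hother : ∀ i : Fin n, ∃ k, i ≠ k := fun i => by
    by_cases h : (i : ℕ) = 0
    · exact ⟨⟨1, by omega⟩, fun e => by rw [e] at h; simp at h⟩
    · exact ⟨⟨0, by omega⟩, fun e => by rw [e] at h; simp at h⟩
  set W : Finset (Fin ℓ → Bool) :=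
    (Finset.univ.filter fun x : Fin n → A => S.dec (S.enc x) = x).image S.enc with hW
  have hmem : ∀ x, S.dec (S.enc x) = x → S.enc x ∈ W := fun x hx =>
    Finset.mem_image_of_mem _ (Finset.mem_filter.2 ⟨Finset.mem_univ _, hx⟩)
  have heval : ∀ (i : Fin n) (x : Fin n → A), S.dec (S.enc x) = x →
      (D.tree i 1).eval (S.enc x) = fun _ => x i := fun i x hx => by
    rw [D.correct i 1 (by omega) x hx]
    funext k
    congr 1
    ext; simp
  have hq : ∀ i : Fin n, ∀ c ∈ W, (D.tree i 1).queries c ≤ r := fun i c hc => by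
    obtain ⟨x, -, rfl⟩ := Finset.mem_image.1 hc
    exact (D.queries_le_worstCase (by omega) x).trans hle
  have himg : ∀ i : Fin n, Fintype.card A ≤ (W.image fun c => (D.tree i 1).eval c).card := by
    intro i
    have hinj : Function.Injective fun (a : A) (_ : Fin 1) => a := fun a b h => congrFun h 0
    rw [← Finset.card_univ, ← Finset.card_image_of_injective _ hinj]
    refine Finset.card_le_card fun y hy => ?_
    obtain ⟨a, -, rfl⟩ := Finset.mem_image.1 hy
    obtain ⟨k, hk⟩ := hother i
    obtain ⟨x, hx, rfl, -⟩ := hex i k hk a a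
    exact Finset.mem_image.2 ⟨_, hmem x hx, heval i x hx⟩
  -- A tree that names all letters with `r` probes forces `|A| ≤ 2 ^ r`, so all the trees are
  -- saturated.
  have hcard' : Fintype.card A = 2 ^ r :=
    le_antisymm ((himg ⟨0, by omega⟩).trans
      (DecisionTree.card_image_eval_le _ r W (hq _))) hcard
  have hcomp := fun i : Fin n => DecisionTree.complete_of_card_image (D.tree i 1) r W (hq i)
    (hcard.trans (himg i))
  let Q : Fin n → Finset (Fin ℓ) := fun i => W.biUnion fun c => (D.tree i 1).probed c
  -- If the trees of two symbols shared the bit `j`, there would be codewords on which they read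
  -- opposite values of it. A reproduced message that combines the two letters would need both
  -- values, because in a saturated tree the output determines the probed bits.
  have hdisj : ∀ i k : Fin n, i ≠ k → Disjoint (Q i) (Q k) := by
    intro i k hik
    rw [Finset.disjoint_left]
    intro j hji hjk
    obtain ⟨c, hc, hj⟩ := Finset.mem_biUnion.1 hji
    obtain ⟨c', hc', hj'⟩ := Finset.mem_biUnion.1 hjk
    obtain ⟨c'', hc'', hj'', hne⟩ : ∃ c'' ∈ W, j ∈ (D.tree k 1).probed c'' ∧ c'' j ≠ c j := by
      by_cases h : c' j = c j
      · obtain ⟨c'', h₁, h₂, h₃⟩ := (hcomp k).1 c' hc' j hj'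
        exact ⟨c'', h₁, h₂, by rwa [← h]⟩
      · exact ⟨c', hc', hj', h⟩
    obtain ⟨x, hx, rfl⟩ := Finset.mem_image.1 hc
    obtain ⟨x', hx', rfl⟩ := Finset.mem_image.1 hc''
    obtain ⟨z, hz, hzi, hzk⟩ := hex i k hik (x i) (x' k)
    have e₁ := (hcomp i).2.1 _ hc _ (hmem z hz) (by
      rw [heval i x (Finset.mem_filter.1 hx).2, heval i z hz, hzi]) j hj
    have e₂ := (hcomp k).2.1 _ hc'' _ (hmem z hz) (by
      rw [heval k x' (Finset.mem_filter.1 hx').2, heval k z hz, hzk]) j hj''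
    exact hne (e₂.symm.trans e₁)
  have hbig : ∀ i, r ≤ (Q i).card := fun i => by
    obtain ⟨k, hk⟩ := hother i
    obtain ⟨x, hx, -⟩ := hex i k hk (Classical.arbitrary A) (Classical.arbitrary A)
    exact ((hcomp i).2.2 _ (hmem x hx)).trans
      (Finset.card_le_card (Finset.subset_biUnion_of_mem (fun c => (D.tree i 1).probed c)
        (hmem x hx)))
  have hsum : n * r ≤ ℓ := by
    calc n * r = ∑ _i : Fin n, r := by simp
      _ ≤ ∑ i, (Q i).card := Finset.sum_le_sum fun i _ => hbig i
      _ = (Finset.univ.biUnion Q).card :=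
        (Finset.card_biUnion fun i _ k _ hik => hdisj i k hik).symm
      _ ≤ (Finset.univ : Finset (Fin ℓ)).card := Finset.card_le_card (Finset.subset_univ _)
      _ = ℓ := by simp
  have hRr := hR r hcard'
  have hn' : (0 : ℝ) < n := by exact_mod_cast (by omega : 0 < n)
  have : (n : ℝ) * r ≤ ℓ := by exact_mod_cast hsum
  nlinarith

theorem le_optimalWorstCase [Nonempty A] {p : A → ℝ} (hp : p ∈ stdSimplex ℝ A)
    (hpos : ∀ a, 0 < p a) {R : ℝ} (hR : ∀ k : ℕ, Fintype.card A = 2 ^ k → R < k) :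
    ((Nat.log 2 (Fintype.card A) + 1 : ℕ) : ℕ∞) ≤ optimalWorstCase p R := by
  unfold optimalWorstCase
  refine le_iInf fun ℓ => le_iInf fun S => le_iInf fun D => le_iInf fun hℓ => le_iInf fun hP => ?_
  obtain ⟨a₀, ha₀⟩ := Finite.exists_min p
  refine le_liminf_of_le (by isBoundedDefault) ?_
  filter_upwards [eventually_ge_atTop 2, hP.eventually_lt_const (mul_pos (hpos a₀) (hpos a₀))]
    with n hn he
  exact_mod_cast log_card_lt_worstCase hp (hpos a₀) ha₀ hR hn (D n) (hℓ n) he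

end LowerBound

/-! ### Straight-line programs -/

section Circuits

/-- The words `w x` can be computed from the words `u x` with at most `m` bit operations. -/
def Computes {X ι κ : Type*} (m : ℕ) (u : X → ι → Bool) (w : X → κ → Bool) : Prop :=
  ∃ m' ≤ m, ∃ P : BitProgram ι κ m', ∀ x, P.Outputs (u x) (w x)

/-- The value of a constant, an input bit or an output bit. -/
def selectBit {ι κ : Type*} (u : ι → Bool) (w : κ → Bool) : Bool ⊕ ι ⊕ κ → Bool
  | Sum.inl b => b
  | Sum.inr (Sum.inl i) => u i
  | Sum.inr (Sum.inr k) => w k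

namespace Computes

variable {X ι κ κ' μ : Type*} {m m₁ m₂ : ℕ} {u : X → ι → Bool} {v : X → κ → Bool}
  {w : X → μ → Bool}

theorem mono (h : Computes m₁ u v) (hm : m₁ ≤ m₂) : Computes m₂ u v := by
  obtain ⟨m', hm', P, hP⟩ := h
  exact ⟨m', hm'.trans hm, P, hP⟩

theorem select (h : Computes m u v) (f : κ' → Bool ⊕ ι ⊕ κ) :
    Computes m u fun x k => selectBit (u x) (v x) (f k) := by
  obtain ⟨m', hm', P, hP⟩ := h
  let o : Bool ⊕ ι ⊕ κ → Bool ⊕ ι ⊕ Fin m'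
    | Sum.inl b => Sum.inl b
    | Sum.inr (Sum.inl i) => Sum.inr (Sum.inl i)
    | Sum.inr (Sum.inr k) => P.out k
  refine ⟨m', hm', ⟨P.left, P.right, fun k => o (f k), P.left_lt, P.right_lt⟩, fun x => ?_⟩
  obtain ⟨g, hg, ho⟩ := hP x
  refine ⟨g, hg, fun k => ?_⟩
  change wireValue (u x) g (o (f k)) = selectBit (u x) (v x) (f k)
  rcases f k with b | i | k
  · rfl
  · rfl
  · exact ho k

theorem input (u : X → ι → Bool) : Computes 0 u u :=
  ⟨0, le_rfl, ⟨Fin.elim0, Fin.elim0, fun i => Sum.inr (Sum.inl i), fun g => g.elim0,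
    fun g => g.elim0⟩, fun _ => ⟨Fin.elim0, fun g => g.elim0, fun _ => rfl⟩⟩

theorem nand (u : X → ι → Bool) (i j : ι) :
    Computes 1 u fun x (_ : Unit) => !(u x i && u x j) := by
  refine ⟨1, le_rfl, ⟨fun _ => Sum.inr (Sum.inl i), fun _ => Sum.inr (Sum.inl j),
    fun _ => Sum.inr (Sum.inr 0), fun _ _ h => by simp at h, fun _ _ h => by simp at h⟩,
    fun x => ⟨fun _ => !(u x i && u x j), fun _ => rfl, fun _ => rfl⟩⟩

/-- The gates of the second program follow those of the first, and its input wires become output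
wires of the first. -/
theorem comp (h₁ : Computes m₁ u v) (h₂ : Computes m₂ v w) : Computes (m₁ + m₂) u w := by
  obtain ⟨a, ha, P, hP⟩ := h₁
  obtain ⟨b, hb, Q, hQ⟩ := h₂
  let e₁ : Bool ⊕ ι ⊕ Fin a → Bool ⊕ ι ⊕ Fin (a + b)
    | Sum.inl c => Sum.inl c
    | Sum.inr (Sum.inl i) => Sum.inr (Sum.inl i)
    | Sum.inr (Sum.inr g) => Sum.inr (Sum.inr (Fin.castAdd b g))
  let e₂ : Bool ⊕ κ ⊕ Fin b → Bool ⊕ ι ⊕ Fin (a + b)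
    | Sum.inl c => Sum.inl c
    | Sum.inr (Sum.inl k) => e₁ (P.out k)
    | Sum.inr (Sum.inr g) => Sum.inr (Sum.inr (Fin.natAdd a g))
  have l₁ : ∀ s g', e₁ s = Sum.inr (Sum.inr g') →
      ∃ g'', s = Sum.inr (Sum.inr g'') ∧ (g' : ℕ) = g'' := by
    rintro (c | i | g) g' h
    · simp [e₁] at h
    · simp [e₁] at h
    · refine ⟨g, rfl, ?_⟩
      simp only [e₁, Sum.inr.injEq] at h
      rw [← h]; rfl
  have l₂ : ∀ s g', e₂ s = Sum.inr (Sum.inr g') → (g' : ℕ) < a ∨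
      ∃ g'', s = Sum.inr (Sum.inr g'') ∧ (g' : ℕ) = a + g'' := by
    rintro (c | k | g) g' h
    · simp [e₂] at h
    · obtain ⟨g'', -, h⟩ := l₁ _ _ h
      left; omega
    · refine Or.inr ⟨g, rfl, ?_⟩
      simp only [e₂, Sum.inr.injEq] at h
      rw [← h]; rfl
  have lt : ∀ (p : Fin a → Bool ⊕ ι ⊕ Fin a) (q : Fin b → Bool ⊕ κ ⊕ Fin b),
      (∀ g g', p g = Sum.inr (Sum.inr g') → g' < g) →
      (∀ g g', q g = Sum.inr (Sum.inr g') → g' < g) →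
      ∀ g g', Fin.append (fun g => e₁ (p g)) (fun g => e₂ (q g)) g = Sum.inr (Sum.inr g') →
        g' < g := by
    intro p q hp hq g
    refine Fin.addCases (fun g g' h => ?_) (fun g g' h => ?_) g
    · rw [Fin.append_left] at h
      obtain ⟨g'', h₁, h₂⟩ := l₁ _ _ h
      have := hp _ _ h₁
      rw [Fin.lt_def] at this ⊢
      simp; omega
    · rw [Fin.append_right] at h
      rcases l₂ _ _ h with h₁ | ⟨g'', h₁, h₂⟩
      · rw [Fin.lt_def]; simp; omega
      · have := hq _ _ h₁
        rw [Fin.lt_def] at this ⊢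
        simp; omega
  refine ⟨a + b, by omega, ⟨Fin.append (fun g => e₁ (P.left g)) (fun g => e₂ (Q.left g)),
    Fin.append (fun g => e₁ (P.right g)) (fun g => e₂ (Q.right g)), fun k => e₂ (Q.out k),
    lt _ _ P.left_lt Q.left_lt, lt _ _ P.right_lt Q.right_lt⟩, fun x => ?_⟩
  obtain ⟨g₁, hg₁, ho₁⟩ := hP x
  obtain ⟨g₂, hg₂, ho₂⟩ := hQ x
  have v₁ : ∀ s, wireValue (u x) (Fin.append g₁ g₂) (e₁ s) = wireValue (u x) g₁ s := by
    rintro (c | i | g)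
    · rfl
    · rfl
    · exact Fin.append_left _ _ _
  have v₂ : ∀ s, wireValue (u x) (Fin.append g₁ g₂) (e₂ s) = wireValue (v x) g₂ s := by
    rintro (c | k | g)
    · rfl
    · exact (v₁ _).trans (ho₁ k)
    · exact Fin.append_right _ _ _
  refine ⟨Fin.append g₁ g₂, fun g => ?_, fun k => (v₂ _).trans (ho₂ k)⟩
  refine Fin.addCases (fun g => ?_) (fun g => ?_) g
  · simp only [Fin.append_left, v₁]; exact hg₁ g
  · simp only [Fin.append_right, v₂]; exact hg₂ g

theorem reindex (h : Computes m u v) (f : κ' → κ) : Computes m u fun x k => v x (f k) :=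
  h.select fun k => Sum.inr (Sum.inr (f k))

theorem pair (h₁ : Computes m₁ u v) (h₂ : Computes m₂ u w) :
    Computes (m₁ + m₂) u fun x => Sum.elim (v x) (w x) := by
  have a : Computes m₁ u fun x => Sum.elim (u x) (v x) := by
    convert h₁.select (Sum.elim (fun i => Sum.inr (Sum.inl i)) fun k => Sum.inr (Sum.inr k)) using 1
    funext x k
    rcases k with i | k <;> rfl
  have b : Computes m₂ (fun x => Sum.elim (u x) (v x)) w := by
    have := ((input fun x => Sum.elim (u x) (v x)).reindex Sum.inl).comp (w := w)
      (m₂ := m₂) h₂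
    simpa using this
  have c := b.select (Sum.elim (fun k => Sum.inr (Sum.inl (Sum.inr k))) fun k => Sum.inr (Sum.inr k))
  convert a.comp c using 1
  funext x k
  rcases k with i | k <;> rfl

theorem nand_of (f g : X → Bool) (hf : Computes m₁ u fun x (_ : Unit) => f x)
    (hg : Computes m₂ u fun x (_ : Unit) => g x) :
    Computes (m₁ + m₂ + 1) u fun x (_ : Unit) => !(f x && g x) :=
  (hf.pair hg).comp (nand _ (Sum.inl ()) (Sum.inr ()))

theorem const (b : Bool) : Computes 0 u fun _ (_ : κ') => b :=
  (input u).select fun _ => Sum.inl b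

theorem ite (i : ι) (f g : X → Bool) (hf : Computes m₁ u fun x (_ : Unit) => f x)
    (hg : Computes m₂ u fun x (_ : Unit) => g x) :
    Computes (m₁ + m₂ + 4) u fun x (_ : Unit) => if u x i then f x else g x := by
  have hi := (input u).reindex fun _ : Unit => i
  -- A multiplexer: NAND of `NAND(c, f)` and `NAND(NAND(c, 1), g)`.
  have h := nand_of _ _ (nand_of _ _ hi hf) (nand_of _ _ (nand_of _ _ hi (const true)) hg)
  refine Computes.mono (m₁ := 0 + m₁ + 1 + (0 + 0 + 1 + m₂ + 1) + 1) ?_ (by omega)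
  convert h using 1
  funext x _
  cases u x i <;> simp

/-- Each inner node becomes one multiplexer of four gates, and a tree of depth `d` has at most `2 ^
d - 1` inner nodes. -/
theorem eval_tree {ℓ : ℕ} {u : X → Fin ℓ → Bool} (t : DecisionTree ℓ Bool) :
    Computes (4 * (2 ^ t.depth - 1)) u fun x (_ : Unit) => t.eval (u x) := by
  induction t with
  | leaf b => exact (const b).mono (Nat.zero_le _)
  | query j t₀ t₁ h₀ h₁ =>
    refine (ite j _ _ h₁ h₀).mono ?_
    have a₀ : 2 ^ t₀.depth ≤ 2 ^ max t₀.depth t₁.depth :=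
      Nat.pow_le_pow_right (by norm_num) (le_max_left _ _)
    have a₁ : 2 ^ t₁.depth ≤ 2 ^ max t₀.depth t₁.depth :=
      Nat.pow_le_pow_right (by norm_num) (le_max_right _ _)
    have b₀ : 0 < 2 ^ t₀.depth := by positivity
    have b₁ : 0 < 2 ^ t₁.depth := by positivity
    simp only [DecisionTree.depth]
    rw [pow_add]
    omega

theorem all_fin {n : ℕ} {w : X → Fin n → Bool}
    (h : ∀ k, Computes m u fun x (_ : Unit) => w x k) : Computes (n * m) u w := by
  induction n with
  | zero =>
    refine Computes.mono (m₁ := 0) ?_ (Nat.zero_le _)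
    convert (const (u := u) (κ' := Fin 0) true) using 1
  | succ n ih =>
    have := (ih fun k => h k.castSucc).pair (h (Fin.last n))
    rw [Nat.succ_mul]
    convert this.reindex (Fin.lastCases (Sum.inr ()) fun k => Sum.inl k) using 1
    funext x k
    refine Fin.lastCases ?_ (fun k => ?_) k <;> simp

theorem all [Fintype κ] (h : ∀ k, Computes m u fun x (_ : Unit) => v x k) :
    Computes (Fintype.card κ * m) u v := by
  have := all_fin (w := fun x k => v x ((Fintype.equivFin κ).symm k))
    fun k => h ((Fintype.equivFin κ).symm k)
  convert this.reindex (Fintype.equivFin κ) using 1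
  funext x k; simp

/-- A function of `d` bits takes at most `4 * 2 ^ d` bit operations. -/
theorem of_dependsOn (s : Finset ι) (f : X → Bool)
    (h : ∀ x y, (∀ i ∈ s, u x i = u y i) → f x = f y) :
    Computes (4 * 2 ^ s.card) u fun x (_ : Unit) => f x := by
  classical
  let e := s.equivFin
  -- The words `u x` need not exhaust all words of bits, so the output is defined through the
  -- existence of an input with the bits read; `h` makes the choice of that input irrelevant.
  let t : DecisionTree s.card Bool := (DecisionTree.readFam fun k => k).map fun z =>
    decide (∃ x, (∀ k, u x (e.symm k) = z k) ∧ f x = true)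
  have h₁ : Computes (0 + 4 * (2 ^ t.depth - 1)) u
      fun x (_ : Unit) => t.eval fun k => u x (e.symm k) :=
    ((input u).reindex fun k => (e.symm k : ι)).comp (eval_tree t)
  have hd : t.depth ≤ s.card :=
    (DecisionTree.depth_map _ _).trans (DecisionTree.depth_readFam _)
  have hp : 2 ^ t.depth ≤ 2 ^ s.card := Nat.pow_le_pow_right (by norm_num) hd
  refine Computes.mono (m₁ := 0 + 4 * (2 ^ t.depth - 1)) ?_ (by omega)
  convert h₁ using 1
  funext x _
  simp only [t, DecisionTree.eval_map, DecisionTree.eval_readFam]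
  cases hf : f x
  · symm
    rw [decide_eq_false_iff_not]
    rintro ⟨y, hy, hfy⟩
    have := h x y fun i hi => by simpa using (hy (e ⟨i, hi⟩)).symm
    rw [hf, hfy] at this
    exact absurd this (by simp)
  · symm
    rw [decide_eq_true_iff]
    exact ⟨x, fun _ => rfl, hf⟩

theorem all_of_dependsOn [Fintype κ] (s : κ → Finset ι) (d : ℕ) (hs : ∀ k, (s k).card ≤ d)
    (h : ∀ k x y, (∀ i ∈ s k, u x i = u y i) → v x k = v y k) :
    Computes (Fintype.card κ * (4 * 2 ^ d)) u v :=
  all fun k => (of_dependsOn (s k) (fun x => v x k) (h k)).mono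
    (Nat.mul_le_mul_left _ (Nat.pow_le_pow_right (by norm_num) (hs k)))

theorem exists_of_dependsOn [Fintype ι] [Fintype κ]
    (h : ∀ x y, u x = u y → v x = v y) : ∃ m, Computes m u v :=
  ⟨_, all_of_dependsOn (fun _ => Finset.univ) _ (fun _ => le_rfl) fun k x y hxy =>
    congrFun (h x y (funext fun i => hxy i (Finset.mem_univ i))) k⟩

end Computes

end Circuits

/-! ### Slots with pointers into a list of exceptions -/

section Pack

/-- The positions of the bits in the joint encoding of `m` units: a pointer of `w` bits and a slot
for each unit, and `k` entries for units that do not fit into their slots. -/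
abbrev PackIndex (m w k : ℕ) (σ ρ : Type) : Type :=
  (Fin m × Fin w) ⊕ (Fin m × σ) ⊕ (Fin k × ρ)

variable {m w k : ℕ} {σ ρ : Type}

/-- The number of units before `j` that do not fit into their slots. -/
def rank (bad : Fin m → Bool) (j : Fin m) : ℕ :=
  (Finset.univ.filter fun i => i < j ∧ bad i = true).card

/-- The number of units that do not fit into their slots. -/
def badCount (bad : Fin m → Bool) : ℕ := (Finset.univ.filter fun i => bad i = true).card

open Classical in
/-- The joint encoding of units with encodings `sl j` in their slots and `rw j` in the list of
exceptions. -/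
def pack (bad : Fin m → Bool) (sl : Fin m → σ → Bool) (rw : Fin m → ρ → Bool) :
    PackIndex m w k σ ρ → Bool
  | Sum.inl (j, t) => bad j && (rank bad j + 1).testBit t
  | Sum.inr (Sum.inl (j, u)) => sl j u
  | Sum.inr (Sum.inr (e, r)) => decide (∃ j, bad j = true ∧ rank bad j = e ∧ rw j r = true)

theorem badCount_le (bad : Fin m → Bool) : badCount bad ≤ m :=
  (Finset.card_le_univ _).trans (by simp)

theorem rank_lt_badCount {bad : Fin m → Bool} {j : Fin m} (hj : bad j = true) :
    rank bad j < badCount bad := by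
  refine Finset.card_lt_card (Finset.ssubset_iff_subset_ne.2 ⟨fun i hi => ?_, fun h => ?_⟩)
  · simp at hi ⊢; exact hi.2
  · have : j ∈ Finset.univ.filter fun i => bad i = true := by simpa using hj
    rw [← h] at this
    simp at this

theorem rank_lt_rank {bad : Fin m → Bool} {i j : Fin m} (hi : bad i = true) (hij : i < j) :
    rank bad i < rank bad j := by
  refine Finset.card_lt_card (Finset.ssubset_iff_subset_ne.2 ⟨fun l hl => ?_, fun h => ?_⟩)
  · simp at hl ⊢; exact ⟨hl.1.trans hij, hl.2⟩
  · have : i ∈ Finset.univ.filter fun l => l < j ∧ bad l = true := by simp [hi, hij]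
    rw [← h] at this
    simp at this

theorem rank_inj {bad : Fin m → Bool} {i j : Fin m} (hi : bad i = true) (hj : bad j = true)
    (h : rank bad i = rank bad j) : i = j := by
  rcases lt_trichotomy i j with h' | h' | h'
  · have := rank_lt_rank hi h'; omega
  · exact h'
  · have := rank_lt_rank hj h'; omega

/-- The pointer `0` means that the unit is in its slot, so entry `e` is addressed by `e + 1`. A rank
plus one is at most `m`, which is why `m < 2 ^ w` suffices. -/
theorem ofBits_pack (hw : m < 2 ^ w) (bad : Fin m → Bool) (sl : Fin m → σ → Bool)
    (rw : Fin m → ρ → Bool) (j : Fin m) :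
    Nat.ofBits (fun t : Fin w => pack (k := k) bad sl rw (Sum.inl (j, t))) =
      if bad j then rank bad j + 1 else 0 := by
  by_cases hj : bad j = true
  · have h₁ := rank_lt_badCount hj
    have h₂ := badCount_le bad
    simp only [pack, hj, Bool.true_and, if_true]
    rw [Nat.ofBits_testBit, Nat.mod_eq_of_lt (by omega)]
  · simp only [Bool.not_eq_true] at hj
    simp only [pack, hj, Bool.false_and, Bool.false_eq_true, if_false]
    apply Nat.eq_of_testBit_eq
    intro i
    rw [Nat.testBit_ofBits]
    simp

theorem pack_entry {bad : Fin m → Bool} (sl : Fin m → σ → Bool) (rw : Fin m → ρ → Bool)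
    {j : Fin m} (hj : bad j = true) (h : rank bad j < k) (r : ρ) :
    pack (w := w) bad sl rw (Sum.inr (Sum.inr (⟨rank bad j, h⟩, r))) = rw j r := by
  simp only [pack]
  cases hr : rw j r
  · rw [decide_eq_false_iff_not]
    rintro ⟨i, hi, hij, hri⟩
    rw [rank_inj hi hj hij, hr] at hri
    exact absurd hri (by simp)
  · rw [decide_eq_true_iff]
    exact ⟨j, hj, rfl, hr⟩

theorem bad_eq_of_pack_eq (hw : m < 2 ^ w) {bad bad' : Fin m → Bool} {sl sl' : Fin m → σ → Bool}
    {rw rw' : Fin m → ρ → Bool} {j : Fin m}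
    (h : ∀ t : Fin w, pack (k := k) bad sl rw (Sum.inl (j, t)) =
      pack (k := k) bad' sl' rw' (Sum.inl (j, t))) : bad j = bad' j := by
  have h₁ := ofBits_pack (k := k) hw bad sl rw j
  rw [funext h, ofBits_pack hw] at h₁
  cases hb : bad j <;> cases hb' : bad' j <;> simp_all

/-- The pointers reveal which units are exceptional, and each of these owns an entry as long as the
list does not overflow. An updater recovers the units it has probed in this way. -/
theorem eq_of_pack_eq (hw : m < 2 ^ w) {bad bad' : Fin m → Bool} {sl sl' : Fin m → σ → Bool}
    {rw rw' : Fin m → ρ → Bool}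
    (h : (pack bad sl rw : PackIndex m w k σ ρ → Bool) = pack bad' sl' rw')
    (hk : badCount bad ≤ k) : bad = bad' ∧ sl = sl' ∧ ∀ j, bad j = true → rw j = rw' j := by
  have hb : bad = bad' := funext fun j => bad_eq_of_pack_eq (k := k) hw fun t => congrFun h _
  subst hb
  refine ⟨rfl, ?_, fun j hj => ?_⟩
  · funext j u
    exact congrFun h (Sum.inr (Sum.inl (j, u)))
  · funext r
    have hlt : rank bad j < k := (rank_lt_badCount hj).trans_le hk
    rw [← pack_entry (w := w) sl rw hj hlt r, ← pack_entry (w := w) sl' rw' hj hlt r, h]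

/-- Only exceptional units reach the list. Hence changing units that are and remain unexceptional
affects nothing but their slots. -/
theorem pack_congr {bad : Fin m → Bool} {sl sl' : Fin m → σ → Bool} {rw rw' : Fin m → ρ → Bool}
    (h : ∀ j, bad j = true → rw j = rw' j) (t : PackIndex m w k σ ρ)
    (ht : ∀ j u, t = Sum.inr (Sum.inl (j, u)) → sl j u = sl' j u) :
    pack bad sl rw t = pack bad sl' rw' t := by
  rcases t with ⟨j, t⟩ | ⟨j, u⟩ | ⟨e, r⟩
  · rfl
  · exact ht j u rfl
  · simp only [pack]
    congr 1
    refine propext (exists_congr fun j => and_congr_right fun hj => ?_)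
    rw [h j hj]

end Pack

/-! ### The two-level code: layout, codewords and the reader of a block -/

/-- A code for blocks of `b` symbols that reproduces the typical blocks. -/
structure BlockCode (A : Type*) (b : ℕ) where
  width : ℕ
  typical : (Fin b → A) → Prop
  enc : (Fin b → A) → Fin width → Bool
  dec : (Fin width → Bool) → Fin b → A
  dec_enc : ∀ x, typical x → dec (enc x) = x

/-- The parameters of a two-level code for messages of length `n`: a message is cut into
`sections` sections of `groups` groups of `blocks` blocks of `size` symbols; a group has entries for
`spare₁` atypical blocks, and a section has entries for `spare₂` groups with more atypical blocks. -/
structure Layout (A : Type*) (n : ℕ) where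
  size : ℕ
  blocks : ℕ
  groups : ℕ
  sections : ℕ
  ptr₁ : ℕ
  ptr₂ : ℕ
  spare₁ : ℕ
  spare₂ : ℕ
  raw : BlockCode A size
  coder : Fin sections → BlockCode A size
  blank : A
  size_pos : 0 < size
  blocks_pos : 0 < blocks
  groups_pos : 0 < groups
  blocks_lt : blocks < 2 ^ ptr₁
  groups_lt : groups < 2 ^ ptr₂
  raw_typical : ∀ x, raw.typical x
  blank_typical : ∀ s, (coder s).typical fun _ => blank
  le_length : n ≤ sections * groups * blocks * size

namespace Layout

variable {A : Type*} {n : ℕ} (L : Layout A n)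

abbrev GroupIndex (C : BlockCode A L.size) : Type :=
  PackIndex L.blocks L.ptr₁ L.spare₁ (Fin C.width) (Fin L.raw.width)

abbrev SectionIndex (C : BlockCode A L.size) : Type :=
  PackIndex L.groups L.ptr₂ L.spare₂ (L.GroupIndex C) (Fin L.blocks × Fin L.raw.width)

/-- The positions of the bits of a codeword. -/
abbrev Index : Type := Σ s : Fin L.sections, L.SectionIndex (L.coder s)

/-- The length of the codewords. -/
def len : ℕ := Fintype.card L.Index

/-- The order in which the bits of a codeword are arranged. -/
def loc : L.Index ≃ Fin L.len := Fintype.equivFin _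

open Classical in
def badBlock (C : BlockCode A L.size) (G : Fin L.blocks → Fin L.size → A) (j : Fin L.blocks) :
    Bool := decide (¬ C.typical (G j))

def groupBits (C : BlockCode A L.size) (G : Fin L.blocks → Fin L.size → A) :
    L.GroupIndex C → Bool :=
  pack (L.badBlock C G) (fun j => C.enc (G j)) fun j => L.raw.enc (G j)

def rawGroup (G : Fin L.blocks → Fin L.size → A) (q : Fin L.blocks × Fin L.raw.width) : Bool :=
  L.raw.enc (G q.1) q.2

def badGroup (C : BlockCode A L.size) (S : Fin L.groups → Fin L.blocks → Fin L.size → A)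
    (c : Fin L.groups) : Bool := decide (L.spare₁ < badCount (L.badBlock C (S c)))

def sectionBits (C : BlockCode A L.size) (S : Fin L.groups → Fin L.blocks → Fin L.size → A) :
    L.SectionIndex C → Bool :=
  pack (L.badGroup C S) (fun c => L.groupBits C (S c)) fun c => L.rawGroup (S c)

/-- The section can be encoded. -/
def SectionOk (C : BlockCode A L.size) (S : Fin L.groups → Fin L.blocks → Fin L.size → A) :
    Prop := badCount (L.badGroup C S) ≤ L.spare₂

/-- The section that is encoded in place of a section that cannot be encoded. -/
def blankSection : Fin L.groups → Fin L.blocks → Fin L.size → A := fun _ _ _ => L.blank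

open Classical in
def fixSection (C : BlockCode A L.size) (S : Fin L.groups → Fin L.blocks → Fin L.size → A) :
    Fin L.groups → Fin L.blocks → Fin L.size → A :=
  if L.SectionOk C S then S else L.blankSection

/-- The position in the message of a symbol of a block. -/
def pos (s c j o : ℕ) : ℕ := ((s * L.groups + c) * L.blocks + j) * L.size + o

/-- The message, cut into blocks and padded with blanks. -/
def cut (x : Fin n → A) (s : Fin L.sections) (c : Fin L.groups) (j : Fin L.blocks)
    (o : Fin L.size) : A :=
  if h : L.pos s c j o < n then x ⟨L.pos s c j o, h⟩ else L.blank

/-- All sections of the message can be encoded. -/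
def Ok (x : Fin n → A) : Prop := ∀ s, L.SectionOk (L.coder s) (L.cut x s)

def word (x : Fin n → A) (q : L.Index) : Bool :=
  L.sectionBits (L.coder q.1) (L.fixSection (L.coder q.1) (L.cut x q.1)) q.2

def enc (x : Fin n → A) (k : Fin L.len) : Bool := L.word x (L.loc.symm k)

@[simp] theorem enc_loc (x : Fin n → A) (q : L.Index) : L.enc x (L.loc q) = L.word x q := by
  simp [enc]

/-- The algorithm that reads a block. -/
def blockTree (s : Fin L.sections) (c : Fin L.groups) (j : Fin L.blocks) :
    DecisionTree L.len (Fin L.size → A) :=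
  (DecisionTree.readFam fun t => L.loc ⟨s, Sum.inl (c, t)⟩).bind fun z₂ =>
    if Nat.ofBits z₂ = 0 then
      (DecisionTree.readFam fun t => L.loc ⟨s, Sum.inr (Sum.inl (c, Sum.inl (j, t)))⟩).bind
        fun z₁ =>
        if Nat.ofBits z₁ = 0 then
          (DecisionTree.readFam fun u =>
            L.loc ⟨s, Sum.inr (Sum.inl (c, Sum.inr (Sum.inl (j, u))))⟩).map (L.coder s).dec
        else if h : Nat.ofBits z₁ - 1 < L.spare₁ then
          (DecisionTree.readFam fun r =>
            L.loc ⟨s, Sum.inr (Sum.inl (c, Sum.inr (Sum.inr (⟨_, h⟩, r))))⟩).map L.raw.dec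
        else DecisionTree.leaf fun _ => L.blank
    else if h : Nat.ofBits z₂ - 1 < L.spare₂ then
      (DecisionTree.readFam fun r =>
        L.loc ⟨s, Sum.inr (Sum.inr (⟨_, h⟩, (j, r)))⟩).map L.raw.dec
    else DecisionTree.leaf fun _ => L.blank

theorem depth_blockTree {d : ℕ} (hd : L.raw.width ≤ d) (hd' : ∀ s, (L.coder s).width ≤ d)
    (s : Fin L.sections) (c : Fin L.groups) (j : Fin L.blocks) :
    (L.blockTree s c j).depth ≤ L.ptr₂ + L.ptr₁ + d := by
  have hm : ∀ {m : ℕ} {γ : Type _} (f : Fin m → Fin L.len) (k : (Fin m → Bool) → γ),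
      ((DecisionTree.readFam f).map k).depth ≤ m := fun f k =>
    (DecisionTree.depth_map _ _).trans (DecisionTree.depth_readFam f)
  refine (DecisionTree.depth_bind_le _ _ (L.ptr₁ + d) fun z₂ => ?_).trans ?_
  · split_ifs
    · refine (DecisionTree.depth_bind_le _ _ d fun z₁ => ?_).trans
        (Nat.add_le_add_right (DecisionTree.depth_readFam _) _)
      split_ifs
      · exact (hm _ _).trans (hd' s)
      · exact (hm _ _).trans hd
      · simp [DecisionTree.depth]
    · exact (hm _ _).trans (by omega)
    · simp [DecisionTree.depth]
  · have := DecisionTree.depth_readFam fun t => L.loc ⟨s, Sum.inl (c, t)⟩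
    omega

theorem badBlock_eq_false {C : BlockCode A L.size} {G : Fin L.blocks → Fin L.size → A}
    {j : Fin L.blocks} : L.badBlock C G j = false ↔ C.typical (G j) := by
  simp [badBlock]

theorem badGroup_eq_false {C : BlockCode A L.size}
    {S : Fin L.groups → Fin L.blocks → Fin L.size → A} {c : Fin L.groups} :
    L.badGroup C S c = false ↔ badCount (L.badBlock C (S c)) ≤ L.spare₁ := by
  simp [badGroup]

theorem sectionOk_blankSection (s : Fin L.sections) :
    L.SectionOk (L.coder s) L.blankSection := by
  have h₁ : ∀ c j, L.badBlock (L.coder s) (L.blankSection c) j = false := fun c j =>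
    L.badBlock_eq_false.2 (L.blank_typical s)
  have h₂ : ∀ c, L.badGroup (L.coder s) L.blankSection c = false := fun c =>
    L.badGroup_eq_false.2 (by simp [badCount, h₁])
  simp [SectionOk, badCount, h₂]

theorem sectionOk_fixSection (s : Fin L.sections)
    (S : Fin L.groups → Fin L.blocks → Fin L.size → A) :
    L.SectionOk (L.coder s) (L.fixSection (L.coder s) S) := by
  unfold fixSection
  split_ifs with h
  · exact h
  · exact L.sectionOk_blankSection s

theorem raw_dec_enc (x : Fin L.size → A) : L.raw.dec (L.raw.enc x) = x :=
  L.raw.dec_enc x (L.raw_typical x)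

/-- This needs no assumption on the message: the section actually encoded is the repaired one, whose
list never overflows. -/
theorem eval_blockTree (x : Fin n → A) (s : Fin L.sections) (c : Fin L.groups)
    (j : Fin L.blocks) :
    (L.blockTree s c j).eval (L.enc x) = L.fixSection (L.coder s) (L.cut x s) c j := by
  set S := L.fixSection (L.coder s) (L.cut x s) with hS
  have hok : L.SectionOk (L.coder s) S := L.sectionOk_fixSection s _
  have hw : ∀ t, L.word x ⟨s, t⟩ = L.sectionBits (L.coder s) S t := fun t => rfl
  simp only [blockTree, DecisionTree.eval_bind, DecisionTree.eval_readFam, enc_loc, hw]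
  have h₂ := ofBits_pack (k := L.spare₂) L.groups_lt (L.badGroup (L.coder s) S)
    (fun c => L.groupBits (L.coder s) (S c)) (fun c => L.rawGroup (S c)) c
  have h₁ := ofBits_pack (k := L.spare₁) L.blocks_lt (L.badBlock (L.coder s) (S c))
    (fun j => (L.coder s).enc (S c j)) (fun j => L.raw.enc (S c j)) j
  change Nat.ofBits (fun t => L.sectionBits (L.coder s) S (Sum.inl (c, t))) = _ at h₂
  change Nat.ofBits (fun t =>
    L.sectionBits (L.coder s) S (Sum.inr (Sum.inl (c, Sum.inl (j, t))))) = _ at h₁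
  rcases hb₂ : L.badGroup (L.coder s) S c with _ | _
  · rw [hb₂] at h₂
    simp only [h₂, Bool.false_eq_true, if_false, if_true, DecisionTree.eval_bind,
      DecisionTree.eval_readFam, enc_loc, hw]
    rcases hb₁ : L.badBlock (L.coder s) (S c) j with _ | _
    · rw [hb₁] at h₁
      simp only [h₁, Bool.false_eq_true, if_false, if_true, DecisionTree.eval_map,
        DecisionTree.eval_readFam, enc_loc, hw]
      exact (L.coder s).dec_enc _ (L.badBlock_eq_false.1 hb₁)
    · rw [hb₁] at h₁
      have hlt : rank (L.badBlock (L.coder s) (S c)) j < L.spare₁ :=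
        (rank_lt_badCount hb₁).trans_le (L.badGroup_eq_false.1 hb₂)
      simp only [h₁, if_true, Nat.add_sub_cancel, Nat.add_eq_zero_iff, one_ne_zero, and_false,
        if_false, hlt, dif_pos, DecisionTree.eval_map, DecisionTree.eval_readFam, enc_loc, hw]
      rw [← L.raw_dec_enc (S c j)]
      congr 1
      funext r
      exact pack_entry (w := L.ptr₁) (fun j => (L.coder s).enc (S c j))
        (fun j => L.raw.enc (S c j)) hb₁ hlt r
  · rw [hb₂] at h₂
    have hlt : rank (L.badGroup (L.coder s) S) c < L.spare₂ :=
      (rank_lt_badCount hb₂).trans_le hok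
    simp only [h₂, if_true, Nat.add_sub_cancel, Nat.add_eq_zero_iff, one_ne_zero, and_false,
      if_false, hlt, dif_pos, DecisionTree.eval_map, DecisionTree.eval_readFam, enc_loc, hw]
    rw [← L.raw_dec_enc (S c j)]
    congr 1
    funext r
    exact pack_entry (w := L.ptr₂) (fun c => L.groupBits (L.coder s) (S c))
      (fun c => L.rawGroup (S c)) hb₂ hlt (j, r)

/-- The algorithm that reads the block with number `B`. -/
def flatTree (B : ℕ) : DecisionTree L.len (Fin L.size → A) :=
  if h : B / L.blocks / L.groups < L.sections then
    L.blockTree ⟨_, h⟩ ⟨B / L.blocks % L.groups, Nat.mod_lt _ L.groups_pos⟩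
      ⟨B % L.blocks, Nat.mod_lt _ L.blocks_pos⟩
  -- The reader of a fragment may ask for blocks beyond the last section; their content is
  -- irrelevant.
  else DecisionTree.leaf fun _ => L.blank

theorem depth_flatTree {d : ℕ} (hd : L.raw.width ≤ d) (hd' : ∀ s, (L.coder s).width ≤ d)
    (B : ℕ) : (L.flatTree B).depth ≤ L.ptr₂ + L.ptr₁ + d := by
  unfold flatTree
  split_ifs
  · exact L.depth_blockTree hd hd' _ _ _
  · simp [DecisionTree.depth]

def scheme : CompressionScheme A n L.len where
  enc := L.enc
  dec c k := (L.flatTree (k / L.size)).eval c ⟨k % L.size, Nat.mod_lt _ L.size_pos⟩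

theorem pos_div_mod (k : ℕ) :
    L.pos (k / L.size / L.blocks / L.groups) (k / L.size / L.blocks % L.groups)
      (k / L.size % L.blocks) (k % L.size) = k := by
  unfold pos
  rw [Nat.div_add_mod', Nat.div_add_mod', Nat.div_add_mod']

theorem section_lt {k : ℕ} (hk : k < n) : k / L.size / L.blocks / L.groups < L.sections := by
  rw [Nat.div_lt_iff_lt_mul L.groups_pos, Nat.div_lt_iff_lt_mul L.blocks_pos,
    Nat.div_lt_iff_lt_mul L.size_pos]
  exact hk.trans_le L.le_length

theorem pos_div_mod_size (s : Fin L.sections) (c : Fin L.groups) (j : Fin L.blocks)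
    (o : Fin L.size) : L.pos s c j o / L.size = (s * L.groups + c) * L.blocks + j ∧
      L.pos s c j o % L.size = o := by
  unfold pos
  constructor
  · rw [mul_comm, Nat.mul_add_div L.size_pos, Nat.div_eq_of_lt o.2, add_zero]
  · rw [Nat.add_comm, Nat.add_mul_mod_self_right, Nat.mod_eq_of_lt o.2]

end Layout

/-! ### A single stage of an updater -/

namespace DecisionTree

variable {ℓ : ℕ} {β : Type*}

open Classical in
/-- Probe the bits of `Q`. -/
def readSet (Q : Finset (Fin ℓ)) : DecisionTree ℓ (Fin ℓ → Bool) :=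
  (readFam fun k => (Q.equivFin.symm k : Fin ℓ)).map fun z j =>
    if h : j ∈ Q then z (Q.equivFin ⟨j, h⟩) else false

theorem eval_readSet (c : Fin ℓ → Bool) (Q : Finset (Fin ℓ)) {j : Fin ℓ} (hj : j ∈ Q) :
    (readSet Q).eval c j = c j := by
  simp [readSet, hj]

theorem queries_readSet (c : Fin ℓ → Bool) (Q : Finset (Fin ℓ)) :
    (readSet Q).queries c ≤ Q.card :=
  (queries_le_depth _ _).trans ((depth_map _ _).trans (depth_readFam _))

end DecisionTree

section UpdateStep

variable {X : Type*} {ℓ : ℕ} (E : X → Fin ℓ → Bool) (f : X → X) (good app : X → Prop)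
  (Q : Finset (Fin ℓ))

open Classical in
/-- One stage of an updater: probe the bits of `Q`; if they are those of a codeword to which this
stage applies, then rewrite them, and otherwise go on with `next`. -/
def updateStep (next : DecisionTree ℓ (Fin ℓ → Option Bool)) :
    DecisionTree ℓ (Fin ℓ → Option Bool) :=
  (DecisionTree.readSet Q).bind fun z =>
    if h : ∃ x, (good x ∧ app x) ∧ ∀ j ∈ Q, E x j = z j then
      DecisionTree.leaf fun j => if j ∈ Q then some (E (f h.choose) j) else none
    else next

variable {E f good app Q}

/-- The input found by the stage need not be the current one. By `hdet` the probed bits alone decide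
whether the stage applies and which bits are to be written there; by `hoff` nothing else changes. -/
theorem applyWrites_updateStep
    (hdet : ∀ x x', good x → good x' → app x → (∀ j ∈ Q, E x j = E x' j) →
      app x' ∧ ∀ j ∈ Q, E (f x) j = E (f x') j)
    (hoff : ∀ x, good x → app x → ∀ j, j ∉ Q → E (f x) j = E x j)
    {next : DecisionTree ℓ (Fin ℓ → Option Bool)} {x : X} (hx : good x)
    (hnext : ¬ app x → applyWrites (next.eval (E x)) (E x) = E (f x)) :
    applyWrites ((updateStep E f good app Q next).eval (E x)) (E x) = E (f x) := by
  simp only [updateStep, DecisionTree.eval_bind]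
  split_ifs with h
  · obtain ⟨⟨hg, ha⟩, he⟩ := h.choose_spec
    have he' : ∀ j ∈ Q, E h.choose j = E x j := fun j hj =>
      (he j hj).trans (DecisionTree.eval_readSet _ _ hj)
    obtain ⟨hax, hw⟩ := hdet _ _ hg hx ha he'
    funext j
    simp only [DecisionTree.eval, applyWrites]
    by_cases hj : j ∈ Q
    · simpa [hj] using hw j hj
    · simpa [hj] using (hoff x hx hax j hj).symm
  · refine hnext fun ha => h ⟨x, ⟨hx, ha⟩, fun j hj => ?_⟩
    rw [DecisionTree.eval_readSet _ _ hj]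

open Classical in
theorem cost_updateStep (next : DecisionTree ℓ (Fin ℓ → Option Bool)) (x : X) :
    (updateStep E f good app Q next).queries (E x) +
      writeCount ((updateStep E f good app Q next).eval (E x)) ≤
    2 * Q.card + if good x ∧ app x then 0 else
      next.queries (E x) + writeCount (next.eval (E x)) := by
  have hq := DecisionTree.queries_readSet (E x) Q
  have hw : ∀ g : Fin ℓ → Bool,
      writeCount (fun j => if j ∈ Q then some (g j) else none) ≤ Q.card := by
    intro g
    refine Finset.card_le_card fun j hj => ?_
    simp only [Finset.mem_filter] at hj
    by_contra h
    simp [h] at hj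
  simp only [updateStep, DecisionTree.eval_bind, DecisionTree.queries_bind]
  by_cases h : ∃ y, (good y ∧ app y) ∧
      ∀ j ∈ Q, E y j = (DecisionTree.readSet Q).eval (E x) j
  · rw [dif_pos h]
    simp only [DecisionTree.queries, DecisionTree.eval]
    have := hw (E (f h.choose))
    omega
  · rw [dif_neg h, if_neg]
    · omega
    · exact fun ha => h ⟨x, ha, fun j hj => (DecisionTree.eval_readSet _ _ hj).symm⟩

end UpdateStep

/-! ### Correctness of the local decoder and the local updater -/

namespace Layout

variable {A : Type*} {n : ℕ} (L : Layout A n)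

theorem flatTree_eq (s : Fin L.sections) (c : Fin L.groups) (j : Fin L.blocks) :
    L.flatTree ((s * L.groups + c) * L.blocks + j) = L.blockTree s c j := by
  have h₁ : (((s : ℕ) * L.groups + c) * L.blocks + j) / L.blocks = s * L.groups + c := by
    rw [mul_comm, Nat.mul_add_div L.blocks_pos, Nat.div_eq_of_lt j.2, add_zero]
  have h₂ : (((s : ℕ) * L.groups + c) * L.blocks + j) % L.blocks = j := by
    rw [Nat.add_comm, Nat.add_mul_mod_self_right, Nat.mod_eq_of_lt j.2]
  have h₃ : ((s : ℕ) * L.groups + c) / L.groups = s := by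
    rw [mul_comm, Nat.mul_add_div L.groups_pos, Nat.div_eq_of_lt c.2, add_zero]
  have h₄ : ((s : ℕ) * L.groups + c) % L.groups = c := by
    rw [Nat.add_comm, Nat.add_mul_mod_self_right, Nat.mod_eq_of_lt c.2]
  unfold flatTree
  simp only [h₁, h₂, h₃, h₄, s.2, dif_pos]

theorem dec_enc_of_ok {x : Fin n → A} (hx : L.Ok x) : L.scheme.dec (L.scheme.enc x) = x := by
  funext k
  have hs := L.section_lt k.2
  have hp := L.pos_div_mod (k : ℕ)
  change (L.flatTree (k / L.size)).eval (L.enc x) _ = x k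
  unfold flatTree
  rw [dif_pos hs, L.eval_blockTree]
  unfold fixSection
  rw [if_pos (hx _)]
  unfold cut
  simp only [hp, k.2, dif_pos]

/-- A section that cannot be encoded is decoded as blanks. If the message is reproduced all the
same, that section consists of blanks, the padding included, and then it can be encoded. So `Ok`
describes exactly the messages on which the updater must be correct. -/
theorem ok_of_dec_enc {x : Fin n → A} (hx : L.scheme.dec (L.scheme.enc x) = x) : L.Ok x := by
  intro s
  by_contra hs
  have hcut : L.cut x s = L.blankSection := by
    funext c j o
    by_cases h : L.pos s c j o < n
    · have h₁ := congrFun hx ⟨_, h⟩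
      change (L.flatTree (L.pos s c j o / L.size)).eval (L.enc x)
        ⟨L.pos s c j o % L.size, _⟩ = _ at h₁
      obtain ⟨h₂, h₃⟩ := L.pos_div_mod_size s c j o
      simp only [h₂, h₃, L.flatTree_eq, L.eval_blockTree] at h₁
      unfold fixSection at h₁
      rw [if_neg hs] at h₁
      unfold cut
      rw [dif_pos h, ← h₁]
    · unfold cut
      rw [dif_neg h]; rfl
  exact hs (hcut ▸ L.sectionOk_blankSection s)

/-- The algorithm that reads a fragment reads the blocks that the fragment meets. -/
def decoder : LocalDecoder L.scheme where
  tree i s := (DecisionTree.collect (fun _ => L.blank) L.flatTree (s / L.size + 2)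
    (i / L.size)).map fun f k => f ((i + k) / L.size) ⟨(i + k) % L.size, Nat.mod_lt _ L.size_pos⟩
  correct i s h x hx := by
    funext k
    rw [DecisionTree.eval_map, DecisionTree.eval_collect]
    · exact congrFun hx ⟨i + k, by omega⟩
    · exact Nat.div_le_div_right (by omega)
    · rw [Nat.div_lt_iff_lt_mul L.size_pos]
      have h₁ := Nat.lt_div_mul_add L.size_pos (a := i)
      have h₂ := Nat.lt_div_mul_add L.size_pos (a := s)
      have := k.2
      rw [add_mul, add_mul]
      omega

theorem worstCase_decoder_le [Fintype A] {d : ℕ} (hd : L.raw.width ≤ d)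
    (hd' : ∀ s, (L.coder s).width ≤ d) (s : ℕ) :
    L.decoder.worstCase s ≤ (s / L.size + 2) * (L.ptr₂ + L.ptr₁ + d) :=
  L.decoder.worstCase_le _ _ fun _ =>
    (DecisionTree.depth_map _ _).trans
      (DecisionTree.depth_collect _ _ _ (L.depth_flatTree hd hd') _ _)

/-- The block meets the fragment of length `s` at position `i`. -/
def TouchBlock (i s : ℕ) (e : Fin L.sections) (c : Fin L.groups) (j : Fin L.blocks) : Prop :=
  ∃ o : Fin L.size, i ≤ L.pos e c j o ∧ L.pos e c j o < i + s

def TouchGroup (i s : ℕ) (e : Fin L.sections) (c : Fin L.groups) : Prop :=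
  ∃ j, L.TouchBlock i s e c j

def TouchSection (i s : ℕ) (e : Fin L.sections) : Prop := ∃ c, L.TouchGroup i s e c

open Classical in
def probes₀ (i s : ℕ) : Finset L.Index :=
  (Finset.univ.filter fun q : Fin L.sections × Fin L.groups × Fin L.blocks =>
    L.TouchBlock i s q.1 q.2.1 q.2.2).biUnion fun q =>
      (Finset.univ.image fun t : Fin L.ptr₂ => (⟨q.1, Sum.inl (q.2.1, t)⟩ : L.Index)) ∪
      ((Finset.univ.image fun t : Fin L.ptr₁ =>
        (⟨q.1, Sum.inr (Sum.inl (q.2.1, Sum.inl (q.2.2, t)))⟩ : L.Index)) ∪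
      (Finset.univ.image fun u : Fin (L.coder q.1).width =>
        (⟨q.1, Sum.inr (Sum.inl (q.2.1, Sum.inr (Sum.inl (q.2.2, u))))⟩ : L.Index)))

open Classical in
def probes₁ (i s : ℕ) : Finset L.Index :=
  (Finset.univ.filter fun q : Fin L.sections × Fin L.groups =>
    L.TouchGroup i s q.1 q.2).biUnion fun q =>
      (Finset.univ.image fun t : Fin L.ptr₂ => (⟨q.1, Sum.inl (q.2, t)⟩ : L.Index)) ∪
      (Finset.univ.image fun u : L.GroupIndex (L.coder q.1) =>
        (⟨q.1, Sum.inr (Sum.inl (q.2, u))⟩ : L.Index))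

open Classical in
def probes₂ (i s : ℕ) : Finset L.Index :=
  (Finset.univ.filter fun q : Fin L.sections => L.TouchSection i s q).biUnion fun q =>
    Finset.univ.image fun t : L.SectionIndex (L.coder q) => (⟨q, t⟩ : L.Index)

/-- The touched blocks are typical before and after the update, and they lie in groups that are
not exceptional. -/
def Clean₀ (i s : ℕ) (x x' : Fin n → A) : Prop :=
  (∀ e c, L.TouchGroup i s e c → L.badGroup (L.coder e) (L.cut x e) c = false) ∧
  ∀ e c j, L.TouchBlock i s e c j →
    (L.coder e).typical (L.cut x e c j) ∧ (L.coder e).typical (L.cut x' e c j)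

/-- The touched groups are not exceptional before and after the update. -/
def Clean₁ (i s : ℕ) (x x' : Fin n → A) : Prop :=
  ∀ e c, L.TouchGroup i s e c → L.badGroup (L.coder e) (L.cut x e) c = false ∧
    L.badGroup (L.coder e) (L.cut x' e) c = false

variable {L}

theorem cut_replace_of_not_touch {i s : ℕ} {y : Fin s → A} (x : Fin n → A) {e : Fin L.sections}
    {c : Fin L.groups} {j : Fin L.blocks} (h : ¬ L.TouchBlock i s e c j) :
    L.cut (replaceFragment x i y) e c j = L.cut x e c j := by
  funext o
  unfold cut
  split_ifs with hn
  · unfold replaceFragment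
    exact dif_neg fun h' => h ⟨o, h'⟩
  · rfl

theorem cut_replace_congr {i s : ℕ} {y : Fin s → A} {x x' : Fin n → A} {e : Fin L.sections}
    {c : Fin L.groups} {j : Fin L.blocks} (h : L.cut x e c j = L.cut x' e c j) :
    L.cut (replaceFragment x i y) e c j = L.cut (replaceFragment x' i y) e c j := by
  funext o
  have ho := congrFun h o
  unfold cut at ho ⊢
  split_ifs at ho ⊢ with hn
  · unfold replaceFragment
    split_ifs
    · rfl
    · exact ho
  · rfl

theorem word_of_ok {x : Fin n → A} (hx : L.Ok x) (e : Fin L.sections)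
    (t : L.SectionIndex (L.coder e)) :
    L.word x ⟨e, t⟩ = L.sectionBits (L.coder e) (L.cut x e) t := by
  unfold word fixSection
  rw [if_pos (hx e)]

theorem group_eq_of_groupBits_eq {C : BlockCode A L.size} {G G' : Fin L.blocks → Fin L.size → A}
    (h : L.groupBits C G = L.groupBits C G') (hk : badCount (L.badBlock C G) ≤ L.spare₁) :
    G = G' := by
  obtain ⟨hb, hs, hr⟩ := eq_of_pack_eq L.blocks_lt h hk
  funext j
  cases hj : L.badBlock C G j
  · have hj' := hj
    rw [hb] at hj'
    rw [← C.dec_enc _ (L.badBlock_eq_false.1 hj), ← C.dec_enc _ (L.badBlock_eq_false.1 hj')]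
    exact congrArg C.dec (congrFun hs j)
  · rw [← L.raw_dec_enc (G j), hr j hj, L.raw_dec_enc]

theorem section_eq_of_sectionBits_eq {C : BlockCode A L.size}
    {S S' : Fin L.groups → Fin L.blocks → Fin L.size → A}
    (h : L.sectionBits C S = L.sectionBits C S') (hk : L.SectionOk C S) : S = S' := by
  obtain ⟨hb, hs, hr⟩ := eq_of_pack_eq L.groups_lt h hk
  funext c
  cases hc : L.badGroup C S c
  · exact group_eq_of_groupBits_eq (congrFun hs c) (L.badGroup_eq_false.1 hc)
  · funext j
    rw [← L.raw_dec_enc (S c j), ← L.raw_dec_enc (S' c j)]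
    congr 1
    funext r
    exact congrFun (hr c hc) (j, r)

theorem badGroup_eq_of_sectionBits_eq {C : BlockCode A L.size}
    {S S' : Fin L.groups → Fin L.blocks → Fin L.size → A} {c : Fin L.groups}
    (h : ∀ t, L.sectionBits C S (Sum.inl (c, t)) = L.sectionBits C S' (Sum.inl (c, t))) :
    L.badGroup C S c = L.badGroup C S' c :=
  bad_eq_of_pack_eq L.groups_lt h

theorem badBlock_eq_of_groupBits_eq {C : BlockCode A L.size}
    {G G' : Fin L.blocks → Fin L.size → A} {j : Fin L.blocks}
    (h : ∀ t, L.groupBits C G (Sum.inl (j, t)) = L.groupBits C G' (Sum.inl (j, t))) :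
    L.badBlock C G j = L.badBlock C G' j :=
  bad_eq_of_pack_eq L.blocks_lt h

theorem badGroup_replace {i s : ℕ} {y : Fin s → A} {x : Fin n → A}
    (h : L.Clean₁ i s x (replaceFragment x i y)) (e : Fin L.sections) :
    L.badGroup (L.coder e) (L.cut (replaceFragment x i y) e) =
      L.badGroup (L.coder e) (L.cut x e) := by
  funext c
  by_cases ht : L.TouchGroup i s e c
  · rw [(h e c ht).1, (h e c ht).2]
  · have : L.cut (replaceFragment x i y) e c = L.cut x e c :=
      funext fun j => cut_replace_of_not_touch x fun hj => ht ⟨j, hj⟩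
    unfold badGroup
    rw [this]

theorem badBlock_replace {i s : ℕ} {y : Fin s → A} {x : Fin n → A}
    (h : L.Clean₀ i s x (replaceFragment x i y)) (e : Fin L.sections) (c : Fin L.groups) :
    L.badBlock (L.coder e) (L.cut (replaceFragment x i y) e c) =
      L.badBlock (L.coder e) (L.cut x e c) := by
  funext j
  by_cases ht : L.TouchBlock i s e c j
  · rw [L.badBlock_eq_false.2 (h.2 e c j ht).1, L.badBlock_eq_false.2 (h.2 e c j ht).2]
  · unfold badBlock
    rw [cut_replace_of_not_touch x ht]

/-- The typicality of every block is unchanged, so a group has as many exceptions as before. -/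
theorem Clean₀.clean₁ {i s : ℕ} {y : Fin s → A} {x : Fin n → A}
    (h : L.Clean₀ i s x (replaceFragment x i y)) : L.Clean₁ i s x (replaceFragment x i y) := by
  intro e c ht
  refine ⟨h.1 e c ht, ?_⟩
  rw [← h.1 e c ht]
  unfold badGroup
  rw [badBlock_replace h]

theorem ok_replace {i s : ℕ} {y : Fin s → A} {x : Fin n → A} (hx : L.Ok x)
    (h : L.Clean₁ i s x (replaceFragment x i y)) : L.Ok (replaceFragment x i y) := by
  intro e
  unfold SectionOk
  rw [badGroup_replace h]
  exact hx e

theorem word_replace_of_notMem_probes₁ {i s : ℕ} {y : Fin s → A} {x : Fin n → A} (hx : L.Ok x)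
    (h : L.Clean₁ i s x (replaceFragment x i y)) {q : L.Index} (hq : q ∉ L.probes₁ i s) :
    L.word (replaceFragment x i y) q = L.word x q := by
  obtain ⟨e, t⟩ := q
  rw [word_of_ok hx, word_of_ok (ok_replace hx h)]
  have hcut : ∀ c, ¬ L.TouchGroup i s e c →
      L.cut (replaceFragment x i y) e c = L.cut x e c := fun c hc =>
    funext fun j => cut_replace_of_not_touch x fun hj => hc ⟨j, hj⟩
  unfold sectionBits
  rw [badGroup_replace h]
  refine pack_congr (fun c hc => ?_) t fun c u htu => ?_
  · rw [hcut c fun ht => by rw [(h e c ht).1] at hc; exact absurd hc (by simp)]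
  · rw [hcut c fun ht => hq ?_]
    rw [htu, probes₁]
    simp only [Finset.mem_biUnion, Finset.mem_filter, Finset.mem_univ, true_and]
    exact ⟨(e, c), ht, Finset.mem_union_right _ (Finset.mem_image_of_mem _ (Finset.mem_univ u))⟩

/-- The flags at both levels are unchanged and the touched units are unexceptional, so both lists
contain untouched material only; only the slots of touched blocks can change. -/
theorem word_replace_of_notMem_probes₀ {i s : ℕ} {y : Fin s → A} {x : Fin n → A} (hx : L.Ok x)
    (h : L.Clean₀ i s x (replaceFragment x i y)) {q : L.Index} (hq : q ∉ L.probes₀ i s) :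
    L.word (replaceFragment x i y) q = L.word x q := by
  obtain ⟨e, t⟩ := q
  have h₁ := h.clean₁
  rw [word_of_ok hx, word_of_ok (ok_replace hx h₁)]
  have hcut : ∀ c, ¬ L.TouchGroup i s e c →
      L.cut (replaceFragment x i y) e c = L.cut x e c := fun c hc =>
    funext fun j => cut_replace_of_not_touch x fun hj => hc ⟨j, hj⟩
  unfold sectionBits
  rw [badGroup_replace h₁]
  refine pack_congr (fun c hc => ?_) t fun c u htu => ?_
  · rw [hcut c fun ht => by rw [(h₁ e c ht).1] at hc; exact absurd hc (by simp)]
  · unfold groupBits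
    rw [badBlock_replace h]
    refine pack_congr (fun j hj => ?_) u fun j v huv => ?_
    · rw [cut_replace_of_not_touch x fun ht => by
        rw [L.badBlock_eq_false.2 (h.2 e c j ht).1] at hj; exact absurd hj (by simp)]
    · rw [cut_replace_of_not_touch x fun ht => hq ?_]
      rw [htu, huv, probes₀]
      simp only [Finset.mem_biUnion, Finset.mem_filter, Finset.mem_univ, true_and]
      exact ⟨(e, c, j), ht, Finset.mem_union_right _ (Finset.mem_union_right _
        (Finset.mem_image_of_mem _ (Finset.mem_univ v)))⟩

theorem word_replace_of_notMem_probes₂ {i s : ℕ} {y : Fin s → A} (x : Fin n → A)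
    {q : L.Index} (hq : q ∉ L.probes₂ i s) :
    L.word (replaceFragment x i y) q = L.word x q := by
  obtain ⟨e, t⟩ := q
  have : L.cut (replaceFragment x i y) e = L.cut x e :=
    funext fun c => funext fun j => cut_replace_of_not_touch x fun hj => hq (by
      simp only [probes₂, Finset.mem_biUnion, Finset.mem_filter, Finset.mem_univ, true_and]
      exact ⟨e, ⟨c, j, hj⟩, Finset.mem_image_of_mem _ (Finset.mem_univ t)⟩)
  unfold word
  rw [this]

/-- The probed bits determine the touched sections entirely. The updated section may fail to be
encodable, but then the blank section is written for both messages. -/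
theorem replace_determined₂ {i s : ℕ} {y : Fin s → A} {x x' : Fin n → A} (hx : L.Ok x)
    (hx' : L.Ok x') (h : ∀ q ∈ L.probes₂ i s, L.word x q = L.word x' q) :
    ∀ q ∈ L.probes₂ i s,
      L.word (replaceFragment x i y) q = L.word (replaceFragment x' i y) q := by
  intro q hq
  have hq' := hq
  simp only [probes₂, Finset.mem_biUnion, Finset.mem_filter, Finset.mem_univ, true_and,
    Finset.mem_image] at hq'
  obtain ⟨e, he, t, rfl⟩ := hq'
  have hcut : L.cut x e = L.cut x' e := by
    refine section_eq_of_sectionBits_eq (C := L.coder e) (funext fun t => ?_) (hx e)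
    rw [← word_of_ok hx, ← word_of_ok hx']
    refine h _ ?_
    simp only [probes₂, Finset.mem_biUnion, Finset.mem_filter, Finset.mem_univ, true_and]
    exact ⟨e, he, Finset.mem_image_of_mem _ (Finset.mem_univ t)⟩
  have hcut' : L.cut (replaceFragment x i y) e = L.cut (replaceFragment x' i y) e :=
    funext fun c => funext fun j => cut_replace_congr (congrFun (congrFun hcut c) j)
  unfold word
  rw [hcut']

theorem replace_determined₁ {i s : ℕ} {y : Fin s → A} {x x' : Fin n → A} (hx : L.Ok x)
    (hx' : L.Ok x') (ha : L.Clean₁ i s x (replaceFragment x i y))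
    (h : ∀ q ∈ L.probes₁ i s, L.word x q = L.word x' q) :
    L.Clean₁ i s x' (replaceFragment x' i y) ∧ ∀ q ∈ L.probes₁ i s,
      L.word (replaceFragment x i y) q = L.word (replaceFragment x' i y) q := by
  have hbad : ∀ e c, L.TouchGroup i s e c →
      L.badGroup (L.coder e) (L.cut x' e) c = false := by
    intro e c ht
    rw [← (ha e c ht).1]
    refine (badGroup_eq_of_sectionBits_eq fun t => ?_).symm
    · have := h ⟨e, Sum.inl (c, t)⟩ (by
        simp only [probes₁, Finset.mem_biUnion, Finset.mem_filter, Finset.mem_univ, true_and]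
        exact ⟨(e, c), ht, Finset.mem_union_left _ (Finset.mem_image_of_mem _ (Finset.mem_univ t))⟩)
      rwa [word_of_ok hx, word_of_ok hx'] at this
  have hcut : ∀ e c, L.TouchGroup i s e c → L.cut x e c = L.cut x' e c := by
    intro e c ht
    refine group_eq_of_groupBits_eq (C := L.coder e) (funext fun u => ?_)
      (L.badGroup_eq_false.1 (ha e c ht).1)
    have := h ⟨e, Sum.inr (Sum.inl (c, u))⟩ (by
      simp only [probes₁, Finset.mem_biUnion, Finset.mem_filter, Finset.mem_univ, true_and]
      exact ⟨(e, c), ht, Finset.mem_union_right _ (Finset.mem_image_of_mem _ (Finset.mem_univ u))⟩)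
    rwa [word_of_ok hx, word_of_ok hx'] at this
  have hcut' : ∀ e c, L.TouchGroup i s e c →
      L.cut (replaceFragment x i y) e c = L.cut (replaceFragment x' i y) e c := fun e c ht =>
    funext fun j => cut_replace_congr (congrFun (hcut e c ht) j)
  have ha' : L.Clean₁ i s x' (replaceFragment x' i y) := by
    intro e c ht
    refine ⟨hbad e c ht, ?_⟩
    rw [← (ha e c ht).2]
    unfold badGroup
    rw [hcut' e c ht]
  refine ⟨ha', fun q hq => ?_⟩
  simp only [probes₁, Finset.mem_biUnion, Finset.mem_filter, Finset.mem_univ, true_and,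
    Finset.mem_union, Finset.mem_image] at hq
  obtain ⟨⟨e, c⟩, ht, ⟨t, rfl⟩ | ⟨u, rfl⟩⟩ := hq
  · rw [word_of_ok (ok_replace hx ha), word_of_ok (ok_replace hx' ha')]
    simp only [sectionBits, pack, (ha e c ht).2, (ha' e c ht).2, Bool.false_and]
  · rw [word_of_ok (ok_replace hx ha), word_of_ok (ok_replace hx' ha')]
    simp only [sectionBits, pack, hcut' e c ht]

/-- The pointers show that the touched blocks of `x'` are typical and in unexceptional groups as
well, so their slots can be decoded and agree with those of `x`. After the update the pointers of
touched units are zero for both messages. -/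
theorem replace_determined₀ {i s : ℕ} {y : Fin s → A} {x x' : Fin n → A} (hx : L.Ok x)
    (hx' : L.Ok x') (ha : L.Clean₀ i s x (replaceFragment x i y))
    (h : ∀ q ∈ L.probes₀ i s, L.word x q = L.word x' q) :
    L.Clean₀ i s x' (replaceFragment x' i y) ∧ ∀ q ∈ L.probes₀ i s,
      L.word (replaceFragment x i y) q = L.word (replaceFragment x' i y) q := by
  have hbad : ∀ e c, L.TouchGroup i s e c →
      L.badGroup (L.coder e) (L.cut x' e) c = false := by
    intro e c ht
    rw [← ha.1 e c ht]
    refine (badGroup_eq_of_sectionBits_eq fun t => ?_).symm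
    · obtain ⟨j, hj⟩ := ht
      have := h ⟨e, Sum.inl (c, t)⟩ (by
        simp only [probes₀, Finset.mem_biUnion, Finset.mem_filter, Finset.mem_univ, true_and]
        exact ⟨(e, c, j), hj, Finset.mem_union_left _
          (Finset.mem_image_of_mem _ (Finset.mem_univ t))⟩)
      rwa [word_of_ok hx, word_of_ok hx'] at this
  have htyp : ∀ e c j, L.TouchBlock i s e c j → (L.coder e).typical (L.cut x' e c j) := by
    intro e c j ht
    rw [← L.badBlock_eq_false, ← L.badBlock_eq_false.2 (ha.2 e c j ht).1]
    refine (badBlock_eq_of_groupBits_eq fun t => ?_).symm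
    · have := h ⟨e, Sum.inr (Sum.inl (c, Sum.inl (j, t)))⟩ (by
        simp only [probes₀, Finset.mem_biUnion, Finset.mem_filter, Finset.mem_univ, true_and]
        exact ⟨(e, c, j), ht, Finset.mem_union_right _ (Finset.mem_union_left _
          (Finset.mem_image_of_mem _ (Finset.mem_univ t)))⟩)
      rwa [word_of_ok hx, word_of_ok hx'] at this
  have hcut : ∀ e c j, L.TouchBlock i s e c j → L.cut x e c j = L.cut x' e c j := by
    intro e c j ht
    rw [← (L.coder e).dec_enc _ (ha.2 e c j ht).1, ← (L.coder e).dec_enc _ (htyp e c j ht)]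
    congr 1
    funext u
    have := h ⟨e, Sum.inr (Sum.inl (c, Sum.inr (Sum.inl (j, u))))⟩ (by
      simp only [probes₀, Finset.mem_biUnion, Finset.mem_filter, Finset.mem_univ, true_and]
      exact ⟨(e, c, j), ht, Finset.mem_union_right _ (Finset.mem_union_right _
        (Finset.mem_image_of_mem _ (Finset.mem_univ u)))⟩)
    rwa [word_of_ok hx, word_of_ok hx'] at this
  have hcut' : ∀ e c j, L.TouchBlock i s e c j →
      L.cut (replaceFragment x i y) e c j = L.cut (replaceFragment x' i y) e c j :=
    fun e c j ht => cut_replace_congr (hcut e c j ht)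
  have ha' : L.Clean₀ i s x' (replaceFragment x' i y) := by
    refine ⟨hbad, fun e c j ht => ⟨htyp e c j ht, ?_⟩⟩
    rw [← hcut' e c j ht]
    exact (ha.2 e c j ht).2
  refine ⟨ha', fun q hq => ?_⟩
  simp only [probes₀, Finset.mem_biUnion, Finset.mem_filter, Finset.mem_univ, true_and,
    Finset.mem_union, Finset.mem_image] at hq
  obtain ⟨⟨e, c, j⟩, ht, ⟨t, rfl⟩ | ⟨t, rfl⟩ | ⟨u, rfl⟩⟩ := hq
  · rw [word_of_ok (ok_replace hx ha.clean₁), word_of_ok (ok_replace hx' ha'.clean₁)]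
    simp only [sectionBits, pack, (ha.clean₁ e c ⟨j, ht⟩).2, (ha'.clean₁ e c ⟨j, ht⟩).2,
      Bool.false_and]
  · rw [word_of_ok (ok_replace hx ha.clean₁), word_of_ok (ok_replace hx' ha'.clean₁)]
    simp only [sectionBits, groupBits, pack, L.badBlock_eq_false.2 (ha.2 e c j ht).2,
      L.badBlock_eq_false.2 (ha'.2 e c j ht).2, Bool.false_and]
  · rw [word_of_ok (ok_replace hx ha.clean₁), word_of_ok (ok_replace hx' ha'.clean₁)]
    simp only [sectionBits, groupBits, pack, hcut' e c j ht]

variable (L)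

/-- Rewrite the touched blocks if they stay typical, else the touched groups if they stay
unexceptional, else the touched sections. -/
def updater : LocalUpdater L.scheme where
  tree i s y :=
    updateStep L.enc (fun x => replaceFragment x i y) L.Ok
      (fun x => L.Clean₀ i s x (replaceFragment x i y)) ((L.probes₀ i s).map L.loc.toEmbedding) <|
    updateStep L.enc (fun x => replaceFragment x i y) L.Ok
      (fun x => L.Clean₁ i s x (replaceFragment x i y)) ((L.probes₁ i s).map L.loc.toEmbedding) <|
    -- Rewriting whole sections always works for encodable messages, so for them the final leaf is
    -- never reached.
    updateStep L.enc (fun x => replaceFragment x i y) L.Ok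
      (fun _ => True) ((L.probes₂ i s).map L.loc.toEmbedding) <|
    DecisionTree.leaf fun _ => none
  correct i s h y x hx := by
    have hok := L.ok_of_dec_enc hx
    have mem : ∀ (Q : Finset L.Index) (j : Fin L.len), j ∉ Q.map L.loc.toEmbedding →
        L.loc.symm j ∉ Q := fun Q j hj hm => hj (Finset.mem_map.2 ⟨_, hm, by simp⟩)
    have all : ∀ (Q : Finset L.Index) (z z' : Fin n → A),
        (∀ j ∈ Q.map L.loc.toEmbedding, L.scheme.enc z j = L.scheme.enc z' j) ↔
          ∀ q ∈ Q, L.word z q = L.word z' q := fun Q z z' => by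
      rw [Finset.forall_mem_map]
      refine forall₂_congr fun q _ => ?_
      change L.enc z (L.loc q) = L.enc z' (L.loc q) ↔ _
      rw [enc_loc, enc_loc]
    refine applyWrites_updateStep ?_ ?_ hok fun _ => applyWrites_updateStep ?_ ?_ hok fun _ =>
      applyWrites_updateStep ?_ ?_ hok fun h => absurd trivial h
    · intro z z' hz hz' ha he
      rw [all] at he ⊢
      exact replace_determined₀ hz hz' ha he
    · intro z hz ha j hj
      exact word_replace_of_notMem_probes₀ hz ha (mem _ j hj)
    · intro z z' hz hz' ha he
      rw [all] at he ⊢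
      exact replace_determined₁ hz hz' ha he
    · intro z hz ha j hj
      exact word_replace_of_notMem_probes₁ hz ha (mem _ j hj)
    · intro z z' hz hz' ha he
      rw [all] at he ⊢
      exact ⟨trivial, replace_determined₂ hz hz' he⟩
    · intro z hz ha j hj
      exact word_replace_of_notMem_probes₂ z (mem _ j hj)

open Classical in
theorem cost_updater_le (i : ℕ) {s : ℕ} (y : Fin s → A) (x : Fin n → A) :
    L.updater.cost i y x ≤ 2 * (L.probes₀ i s).card +
      ((if ¬ (L.Ok x ∧ L.Clean₀ i s x (replaceFragment x i y)) then 2 * (L.probes₁ i s).card else 0) +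
      if ¬ (L.Ok x ∧ L.Clean₁ i s x (replaceFragment x i y)) then 2 * (L.probes₂ i s).card
        else 0) := by
  unfold LocalUpdater.cost updater
  simp only
  refine (cost_updateStep _ x).trans ?_
  rw [Finset.card_map]
  refine Nat.add_le_add_left ?_ _
  by_cases h₀ : L.Ok x ∧ L.Clean₀ i s x (replaceFragment x i y)
  · rw [if_pos h₀]; exact Nat.zero_le _
  rw [if_neg h₀, if_pos h₀]
  refine (cost_updateStep _ x).trans ?_
  rw [Finset.card_map]
  refine Nat.add_le_add_left ?_ _
  by_cases h₁ : L.Ok x ∧ L.Clean₁ i s x (replaceFragment x i y)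
  · rw [if_pos h₁]; exact Nat.zero_le _
  rw [if_neg h₁, if_pos h₁]
  refine (cost_updateStep _ x).trans ?_
  rw [Finset.card_map]
  split_ifs <;> simp [DecisionTree.queries, DecisionTree.eval, writeCount]

end Layout

/-! ### Counting touched units and probed bits -/

theorem card_le_of_div {σ : Type*} (F : Finset σ) (f : σ → ℕ) (hf : Set.InjOn f F) {z i s : ℕ}
    (hz : 0 < z) (h : ∀ q ∈ F, ∃ k, i ≤ k ∧ k < i + s ∧ k / z = f q) : F.card ≤ s / z + 2 := by
  -- An interval of length `s` meets at most `s / z + 2` cells of length `z`: rounding and a partial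
  -- cell at either end.
  have hsub : F.image f ⊆ Finset.Icc (i / z) (i / z + s / z + 1) := by
    intro v hv
    obtain ⟨q, hq, rfl⟩ := Finset.mem_image.1 hv
    obtain ⟨k, h₁, h₂, h₃⟩ := h q hq
    rw [← h₃, Finset.mem_Icc]
    refine ⟨Nat.div_le_div_right h₁, Nat.lt_succ_iff.1 ?_⟩
    rw [Nat.div_lt_iff_lt_mul hz]
    have a₁ := Nat.lt_div_mul_add hz (a := i)
    have a₂ := Nat.lt_div_mul_add hz (a := s)
    have a₃ : (i / z + s / z + 1 + 1) * z = i / z * z + s / z * z + z + z := by ring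
    change k < (i / z + s / z + 1 + 1) * z
    rw [a₃]
    linarith
  rw [← Finset.card_image_of_injOn hf]
  refine (Finset.card_le_card hsub).trans ?_
  rw [Nat.card_Icc]
  generalize i / z = u
  generalize s / z = v
  omega

theorem card_packIndex (m w k : ℕ) (σ ρ : Type) [Fintype σ] [Fintype ρ] :
    Fintype.card (PackIndex m w k σ ρ) = m * w + (m * Fintype.card σ + k * Fintype.card ρ) := by
  simp

namespace Layout

variable {A : Type*} {n : ℕ} (L : Layout A n)

theorem flat_inj {a b m : ℕ} {c c' : Fin m} (h : a * m + (c : ℕ) = b * m + c') :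
    a = b ∧ c = c' := by
  have hm : 0 < m := c.pos
  have h₁ : (a * m + (c : ℕ)) / m = a := by
    rw [mul_comm, Nat.mul_add_div hm, Nat.div_eq_of_lt c.2, add_zero]
  have h₂ : (b * m + (c' : ℕ)) / m = b := by
    rw [mul_comm, Nat.mul_add_div hm, Nat.div_eq_of_lt c'.2, add_zero]
  have : a = b := by rw [← h₁, h, h₂]
  subst this
  exact ⟨rfl, Fin.ext (by omega)⟩

open Classical in
def touchedBlocks (i s : ℕ) : Finset (Fin L.sections × Fin L.groups × Fin L.blocks) :=
  Finset.univ.filter fun q => L.TouchBlock i s q.1 q.2.1 q.2.2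

open Classical in
def touchedGroups (i s : ℕ) : Finset (Fin L.sections × Fin L.groups) :=
  Finset.univ.filter fun q => L.TouchGroup i s q.1 q.2

open Classical in
def touchedSections (i s : ℕ) : Finset (Fin L.sections) :=
  Finset.univ.filter fun q => L.TouchSection i s q

theorem mem_touchedBlocks {i s : ℕ} {q : Fin L.sections × Fin L.groups × Fin L.blocks} :
    q ∈ L.touchedBlocks i s ↔ L.TouchBlock i s q.1 q.2.1 q.2.2 := by
  simp [touchedBlocks]

theorem mem_touchedGroups {i s : ℕ} {q : Fin L.sections × Fin L.groups} :
    q ∈ L.touchedGroups i s ↔ L.TouchGroup i s q.1 q.2 := by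
  simp [touchedGroups]

theorem mem_touchedSections {i s : ℕ} {q : Fin L.sections} :
    q ∈ L.touchedSections i s ↔ L.TouchSection i s q := by
  simp [touchedSections]

theorem card_touchedBlocks_le (i s : ℕ) : (L.touchedBlocks i s).card ≤ s / L.size + 2 := by
  refine card_le_of_div (i := i) _
    (fun q => ((q.1 : ℕ) * L.groups + (q.2.1 : ℕ)) * L.blocks + q.2.2) ?_ L.size_pos ?_
  · rintro ⟨e, c, j⟩ - ⟨e', c', j'⟩ - h
    obtain ⟨h₁, h₂⟩ := flat_inj h
    obtain ⟨h₃, h₄⟩ := flat_inj h₁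
    exact Prod.ext (Fin.ext h₃) (Prod.ext h₄ h₂)
  · rintro ⟨e, c, j⟩ h
    obtain ⟨o, h₁, h₂⟩ := (L.mem_touchedBlocks).1 h
    exact ⟨_, h₁, h₂, (L.pos_div_mod_size e c j o).1⟩

theorem card_touchedGroups_le (i s : ℕ) :
    (L.touchedGroups i s).card ≤ s / (L.size * L.blocks) + 2 := by
  refine card_le_of_div (i := i) _ (fun q => (q.1 : ℕ) * L.groups + (q.2 : ℕ)) ?_
    (mul_pos L.size_pos L.blocks_pos) ?_
  · rintro ⟨e, c⟩ - ⟨e', c'⟩ - h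
    obtain ⟨h₁, h₂⟩ := flat_inj h
    exact Prod.ext (Fin.ext h₁) h₂
  · rintro ⟨e, c⟩ h
    obtain ⟨j, o, h₁, h₂⟩ := L.mem_touchedGroups.1 h
    refine ⟨_, h₁, h₂, ?_⟩
    rw [← Nat.div_div_eq_div_mul, (L.pos_div_mod_size e c j o).1, mul_comm,
      Nat.mul_add_div L.blocks_pos, Nat.div_eq_of_lt j.2, add_zero]

theorem card_touchedSections_le (i s : ℕ) :
    (L.touchedSections i s).card ≤ s / (L.size * L.blocks * L.groups) + 2 := by
  refine card_le_of_div (i := i) (L.touchedSections i s) (fun q => (q : ℕ)) ?_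
    (mul_pos (mul_pos L.size_pos L.blocks_pos) L.groups_pos) ?_
  · rintro e - e' - h
    exact Fin.ext h
  · rintro e h
    obtain ⟨c, j, o, h₁, h₂⟩ := L.mem_touchedSections.1 h
    refine ⟨_, h₁, h₂, ?_⟩
    rw [← Nat.div_div_eq_div_mul, ← Nat.div_div_eq_div_mul, (L.pos_div_mod_size e c j o).1, mul_comm,
      Nat.mul_add_div L.blocks_pos, Nat.div_eq_of_lt j.2, add_zero, mul_comm,
      Nat.mul_add_div L.groups_pos, Nat.div_eq_of_lt c.2, add_zero]

theorem card_image_fin_le {ι : Type*} [DecidableEq ι] {κ : Type*} [Fintype κ] (f : κ → ι) :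
    (Finset.univ.image f).card ≤ Fintype.card κ :=
  Finset.card_image_le.trans_eq Finset.card_univ

variable {L}

theorem card_probes₀_le {d : ℕ} (hd : ∀ s, (L.coder s).width ≤ d) (i s : ℕ) :
    (L.probes₀ i s).card ≤ (s / L.size + 2) * (L.ptr₂ + L.ptr₁ + d) := by
  classical
  unfold probes₀
  refine (Finset.card_biUnion_le_card_mul _ _ (L.ptr₂ + L.ptr₁ + d) fun q _ => ?_).trans
    (Nat.mul_le_mul_right _ (L.card_touchedBlocks_le i s))
  refine (Finset.card_union_le _ _).trans ?_
  have h₁ := card_image_fin_le fun t : Fin L.ptr₂ => (⟨q.1, Sum.inl (q.2.1, t)⟩ : L.Index)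
  have h₂ := card_image_fin_le fun t : Fin L.ptr₁ =>
    (⟨q.1, Sum.inr (Sum.inl (q.2.1, Sum.inl (q.2.2, t)))⟩ : L.Index)
  have h₃ := card_image_fin_le fun u : Fin (L.coder q.1).width =>
    (⟨q.1, Sum.inr (Sum.inl (q.2.1, Sum.inr (Sum.inl (q.2.2, u))))⟩ : L.Index)
  rw [Fintype.card_fin] at h₁ h₂ h₃
  have h₄ := hd q.1
  refine (Nat.add_le_add_left (Finset.card_union_le _ _) _).trans ?_
  omega

theorem card_probes₁_le {W : ℕ}
    (hW : ∀ s, Fintype.card (L.GroupIndex (L.coder s)) ≤ W) (i s : ℕ) :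
    (L.probes₁ i s).card ≤ (s / (L.size * L.blocks) + 2) * (L.ptr₂ + W) := by
  classical
  unfold probes₁
  refine (Finset.card_biUnion_le_card_mul _ _ (L.ptr₂ + W) fun q _ => ?_).trans
    (Nat.mul_le_mul_right _ (L.card_touchedGroups_le i s))
  refine (Finset.card_union_le _ _).trans ?_
  have h₁ := card_image_fin_le fun t : Fin L.ptr₂ => (⟨q.1, Sum.inl (q.2, t)⟩ : L.Index)
  have h₂ := card_image_fin_le fun u : L.GroupIndex (L.coder q.1) =>
    (⟨q.1, Sum.inr (Sum.inl (q.2, u))⟩ : L.Index)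
  rw [Fintype.card_fin] at h₁
  have h₃ := hW q.1
  omega

theorem card_probes₂_le {W : ℕ}
    (hW : ∀ s, Fintype.card (L.SectionIndex (L.coder s)) ≤ W) (i s : ℕ) :
    (L.probes₂ i s).card ≤ (s / (L.size * L.blocks * L.groups) + 2) * W := by
  classical
  unfold probes₂
  refine (Finset.card_biUnion_le_card_mul _ _ W fun q _ => ?_).trans
    (Nat.mul_le_mul_right _ (L.card_touchedSections_le i s))
  exact (card_image_fin_le _).trans (hW q)

/-- The positions of a group that lies in the message. -/
def groupEmb {e : Fin L.sections} (h : ∀ c : Fin L.groups, ∀ j : Fin L.blocks, ∀ o : Fin L.size,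
    L.pos e c j o < n) (c : Fin L.groups) : Fin L.blocks × Fin L.size ↪ Fin n where
  toFun q := ⟨L.pos e c q.1 q.2, h _ _ _⟩
  inj' := by
    rintro ⟨j, o⟩ ⟨j', o'⟩ hq
    obtain ⟨h₁, rfl⟩ := flat_inj (Fin.mk.inj hq)
    obtain ⟨-, rfl⟩ := flat_inj h₁
    rfl

theorem cut_eq_groupEmb {e : Fin L.sections} (h : ∀ c : Fin L.groups, ∀ j : Fin L.blocks,
    ∀ o : Fin L.size, L.pos e c j o < n) (x : Fin n → A) (c : Fin L.groups) :
    L.cut x e c = fun j o => (x ∘ groupEmb h c) (j, o) := by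
  funext j o
  simp only [cut, h c j o, dif_pos]
  rfl

/-- The embedding of the positions of a fragment. -/
def fragmentEmb {i s : ℕ} (h : i + s ≤ n) : Fin s ↪ Fin n where
  toFun k := ⟨i + k, by omega⟩
  inj' := fun k k' hk => Fin.ext (by have := Fin.mk.inj hk; omega)

theorem replaceFragment_eq_extend {i s : ℕ} (h : i + s ≤ n) (x : Fin n → A) (y : Fin s → A) :
    replaceFragment x i y = Function.extend (fragmentEmb h) y x := by
  funext k
  unfold replaceFragment
  split_ifs with hk
  · have : k = fragmentEmb h ⟨k - i, by omega⟩ := by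
      ext; change (k : ℕ) = i + (k - i); omega
    conv_rhs => rw [this, (fragmentEmb h).injective.extend_apply]
  · rw [Function.extend_apply']
    rintro ⟨l, rfl⟩
    exact hk ⟨Nat.le_add_right _ _, Nat.add_lt_add_left l.2 _⟩

/-! ### Failure probabilities and the average cost of an update -/

section Probability

variable [Fintype A] {p : A → ℝ}

/-- Each section is either coded without exceptions, or it lies in the message and its blocks are
atypical with probability at most `δ`. -/
def Reliable (L : Layout A n) (p : A → ℝ) (δ : ℝ) : Prop :=
  ∀ e, (∀ z, (L.coder e).typical z) ∨
    ((∀ c : Fin L.groups, ∀ j : Fin L.blocks, ∀ o : Fin L.size, L.pos e c j o < n) ∧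
      prob p (fun z => ¬ (L.coder e).typical z) ≤ δ)

theorem prob_not_typical_le (hp : p ∈ stdSimplex ℝ A) {δ : ℝ} (hδ : 0 ≤ δ)
    (hL : L.Reliable p δ) (e : Fin L.sections) (c : Fin L.groups) (j : Fin L.blocks) :
    prob p (fun x => ¬ (L.coder e).typical (L.cut x e c j)) ≤ δ := by
  rcases hL e with h | ⟨hpos, h⟩
  · simp only [h, not_true_eq_false, prob_false, hδ]
  · let f : Fin L.size ↪ Fin n :=
      (⟨fun o => (j, o), fun o o' h => (Prod.mk.inj h).2⟩ :
        Fin L.size ↪ Fin L.blocks × Fin L.size).trans (groupEmb hpos c)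
    refine le_trans (le_of_eq ?_) h
    rw [← prob_comp_embedding hp f]
    congr 1
    funext x
    rw [cut_eq_groupEmb hpos]
    rfl

theorem prob_badGroup_le_of_embedding (hp : p ∈ stdSimplex ℝ A) {δ : ℝ} (hδ : 0 ≤ δ)
    {C : BlockCode A L.size} (h : prob p (fun z => ¬ C.typical z) ≤ δ) :
    prob p (fun z : Fin L.blocks × Fin L.size → A =>
      L.spare₁ < badCount (L.badBlock C fun j o => z (j, o))) ≤
      2 ^ L.blocks * δ ^ (L.spare₁ + 1) := by
  classical
  let f : Fin L.blocks → (Fin L.size ↪ Fin L.blocks × Fin L.size) := fun j =>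
    ⟨fun o => (j, o), fun o o' h => (Prod.mk.inj h).2⟩
  have := prob_card_lt_le hp f (fun j j' hj k k' hk => hj (Prod.mk.inj hk).1)
    (fun _ z => ¬ C.typical z) hδ (fun _ => h) L.spare₁
  refine le_trans (prob_mono hp fun z hz => ?_) this
  convert hz using 1
  unfold badCount badBlock
  congr 1
  ext j
  simp only [Finset.mem_filter, decide_eq_true_iff]
  rfl

theorem prob_badGroup_le (hp : p ∈ stdSimplex ℝ A) {δ : ℝ} (hδ : 0 ≤ δ)
    (hL : L.Reliable p δ) (e : Fin L.sections) (c : Fin L.groups) :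
    prob p (fun x => L.badGroup (L.coder e) (L.cut x e) c = true) ≤
      2 ^ L.blocks * δ ^ (L.spare₁ + 1) := by
  rcases hL e with h | ⟨hpos, h⟩
  · have : ∀ x, ¬ L.badGroup (L.coder e) (L.cut x e) c = true := fun x => by
      rw [Bool.not_eq_true, L.badGroup_eq_false]
      simp [badCount, badBlock, h]
    simp only [this, Bool.false_eq_true, prob_false]
    positivity
  · refine le_trans (le_of_eq ?_) (prob_badGroup_le_of_embedding (L := L) hp hδ h)
    rw [← prob_comp_embedding hp (groupEmb hpos c)]
    congr 1
    funext x
    unfold badGroup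
    rw [cut_eq_groupEmb hpos, decide_eq_true_iff]

/-- The groups of a section are independent, so the bound for independent events applies once more,
with the bound for an exceptional group in the role of `δ`. -/
theorem prob_not_sectionOk_le (hp : p ∈ stdSimplex ℝ A) {δ : ℝ} (hδ : 0 ≤ δ)
    (hL : L.Reliable p δ) (e : Fin L.sections) :
    prob p (fun x => ¬ L.SectionOk (L.coder e) (L.cut x e)) ≤
      2 ^ L.groups * (2 ^ L.blocks * δ ^ (L.spare₁ + 1)) ^ (L.spare₂ + 1) := by
  classical
  rcases hL e with h | ⟨hpos, h⟩
  · have : ∀ x, ¬ ¬ L.SectionOk (L.coder e) (L.cut x e) := fun x => by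
      rw [not_not]
      have : ∀ c, L.badGroup (L.coder e) (L.cut x e) c = false := fun c => by
        rw [L.badGroup_eq_false]
        simp [badCount, badBlock, h]
      simp [SectionOk, badCount, this]
    simp only [this, prob_false]
    positivity
  · have := prob_card_lt_le hp (groupEmb hpos) (fun c c' hc k k' hk => by
        obtain ⟨j, o⟩ := k
        obtain ⟨j', o'⟩ := k'
        obtain ⟨h₁, -⟩ := flat_inj (Fin.mk.inj hk)
        obtain ⟨h₂, -⟩ := flat_inj h₁
        obtain ⟨-, h₃⟩ := flat_inj h₂
        exact hc h₃)
      (fun _ z => L.spare₁ < badCount (L.badBlock (L.coder e) fun j o => z (j, o)))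
      (δ := 2 ^ L.blocks * δ ^ (L.spare₁ + 1)) (by positivity)
      (fun _ => prob_badGroup_le_of_embedding (L := L) hp hδ h) L.spare₂
    refine le_trans (prob_mono hp fun x hx => ?_) this
    refine lt_of_lt_of_eq (not_le.1 hx) ?_
    conv_lhs => unfold badCount badGroup
    refine congrArg Finset.card (Finset.ext fun c => ?_)
    simp only [Finset.mem_filter, Finset.mem_univ, true_and, decide_eq_true_iff]
    rw [cut_eq_groupEmb hpos]

theorem prob_not_ok_le (hp : p ∈ stdSimplex ℝ A) {δ : ℝ} (hδ : 0 ≤ δ) (hL : L.Reliable p δ) :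
    prob p (fun x => ¬ L.Ok x) ≤
      L.sections * (2 ^ L.groups * (2 ^ L.blocks * δ ^ (L.spare₁ + 1)) ^ (L.spare₂ + 1)) := by
  refine le_trans (prob_mono hp fun x hx => ?_) (le_trans (prob_exists_le hp Finset.univ
    fun e x => ¬ L.SectionOk (L.coder e) (L.cut x e)) ?_)
  · unfold Ok at hx
    push Not at hx
    obtain ⟨e, he⟩ := hx
    exact ⟨e, Finset.mem_univ _, he⟩
  · refine (Finset.sum_le_sum fun e _ => prob_not_sectionOk_le hp hδ hL e).trans ?_
    simp

theorem errorProb_scheme_le (hp : p ∈ stdSimplex ℝ A) {δ : ℝ} (hδ : 0 ≤ δ)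
    (hL : L.Reliable p δ) : errorProb p L.scheme ≤
      L.sections * (2 ^ L.groups * (2 ^ L.blocks * δ ^ (L.spare₁ + 1)) ^ (L.spare₂ + 1)) := by
  rw [errorProb_eq_prob]
  exact (prob_mono hp fun x hx h => hx (L.dec_enc_of_ok h)).trans (prob_not_ok_le hp hδ hL)

/-- The updated message has the law of the original one, so failures before and after the update are
bounded by the same kind of probability. The cap `1` serves long fragments, for which the union
bound says nothing. -/
theorem expect_replace_le (hp : p ∈ stdSimplex ℝ A) {i s : ℕ} (h : i + s ≤ n)
    {E : (Fin n → A) → (Fin s → A) → Prop} [∀ x y, Decidable (E x y)] {U V : (Fin n → A) → Prop}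
    (hE : ∀ x y, E x y → U x ∨ V (replaceFragment x i y)) {r : ℝ} (hr : prob p U + prob p V ≤ r) :
    (expect p fun x => expect p fun y => if E x y then (1 : ℝ) else 0) ≤
      min 1 r := by
  classical
  refine le_min ?_ (le_trans ?_ hr)
  · refine le_trans (expect_mono hp fun x => expect_mono hp (g := fun _ => 1) fun y => ?_) ?_
    · split_ifs <;> norm_num
    · simp only [expect_const hp, le_refl]
  · have h₁ : prob p U = expect p fun x => expect p fun _ : Fin s → A =>
        if U x then (1 : ℝ) else 0 := by
      simp only [expect_const hp]; rfl
    have h₂ : prob p V = expect p fun x => expect p fun y : Fin s → A =>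
        if V (replaceFragment x i y) then (1 : ℝ) else 0 := by
      simp only [replaceFragment_eq_extend h]
      exact (expect_extend hp (fragmentEmb h) fun x => if V x then (1 : ℝ) else 0).symm
    rw [h₁, h₂, ← expect_add]
    refine expect_mono hp fun x => ?_
    rw [← expect_add]
    refine expect_mono hp fun y => ?_
    have := hE x y
    by_cases a : E x y <;> by_cases b : U x <;> by_cases c : V (replaceFragment x i y) <;>
      first | (simp [a, b, c]; done) | tauto

/-- The cost of a stage is weighted with the probability that it is reached. The blocks are counted
twice, before and after the update; for the first stage the groups need counting only before it,
since `Clean₀` keeps them unexceptional. -/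
theorem average_updater_le (hp : p ∈ stdSimplex ℝ A) {δ δ₂ π : ℝ}
    (hδ : ∀ e c j, prob p (fun x => ¬ (L.coder e).typical (L.cut x e c j)) ≤ δ)
    (hδ₂ : ∀ e c, prob p (fun x => L.badGroup (L.coder e) (L.cut x e) c = true) ≤ δ₂)
    (hπ : prob p (fun x => ¬ L.Ok x) ≤ π) (hδ0 : 0 ≤ δ) (hδ₂0 : 0 ≤ δ₂)
    {s : ℕ} (hs : s ≤ n) {b₀ b₁ b₂ t₀ t₁ : ℕ}
    (h₀ : ∀ i, (L.probes₀ i s).card ≤ b₀) (h₁ : ∀ i, (L.probes₁ i s).card ≤ b₁)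
    (h₂ : ∀ i, (L.probes₂ i s).card ≤ b₂) (ht₀ : ∀ i, (L.touchedBlocks i s).card ≤ t₀)
    (ht₁ : ∀ i, (L.touchedGroups i s).card ≤ t₁) :
    L.updater.average p s ≤ 2 * (b₀ + min 1 (π + t₁ * δ₂ + 2 * t₀ * δ) * b₁ +
      min 1 (π + 2 * t₁ * δ₂) * b₂) := by
  classical
  unfold LocalUpdater.average
  have : Nonempty (Fin (n + 1 - s)) := ⟨⟨0, by omega⟩⟩
  refine ciSup_le fun i => ?_
  have hi : (i : ℕ) + s ≤ n := by omega
  have hsumB : ∑ q ∈ L.touchedBlocks i s,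
      prob p (fun x => ¬ (L.coder q.1).typical (L.cut x q.1 q.2.1 q.2.2)) ≤ t₀ * δ := by
    refine (Finset.sum_le_card_nsmul _ _ δ fun q _ => hδ _ _ _).trans ?_
    rw [nsmul_eq_mul]
    exact mul_le_mul_of_nonneg_right (by exact_mod_cast ht₀ i) hδ0
  have hsumG : ∑ q ∈ L.touchedGroups i s,
      prob p (fun x => L.badGroup (L.coder q.1) (L.cut x q.1) q.2 = true) ≤ t₁ * δ₂ := by
    refine (Finset.sum_le_card_nsmul _ _ δ₂ fun q _ => hδ₂ _ _).trans ?_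
    rw [nsmul_eq_mul]
    exact mul_le_mul_of_nonneg_right (by exact_mod_cast ht₁ i) hδ₂0
  let B : (Fin n → A) → Prop := fun x => ∃ q ∈ L.touchedBlocks i s,
    ¬ (L.coder q.1).typical (L.cut x q.1 q.2.1 q.2.2)
  let G : (Fin n → A) → Prop := fun x => ∃ q ∈ L.touchedGroups i s,
    L.badGroup (L.coder q.1) (L.cut x q.1) q.2 = true
  have hB : prob p B ≤ t₀ * δ := (prob_exists_le hp _ _).trans hsumB
  have hG : prob p G ≤ t₁ * δ₂ := (prob_exists_le hp _ _).trans hsumG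
  have memB : ∀ e c j, L.TouchBlock i s e c j → (e, c, j) ∈ L.touchedBlocks i s := fun e c j h =>
    (by simpa [mem_touchedBlocks, mem_touchedGroups] using h)
  have memG : ∀ e c, L.TouchGroup i s e c → (e, c) ∈ L.touchedGroups i s := fun e c h =>
    (by simpa [mem_touchedBlocks, mem_touchedGroups] using h)
  have e₀ := expect_replace_le hp hi
    (E := fun x y => ¬ (L.Ok x ∧ L.Clean₀ i s x (replaceFragment x i y)))
    (U := fun x => ¬ L.Ok x ∨ (G x ∨ B x)) (V := B) (r := π + t₁ * δ₂ + 2 * t₀ * δ)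
    (fun x y hE => by
      by_contra hno
      push Not at hno
      obtain ⟨⟨a₁, a₂, a₃⟩, a₄⟩ := hno
      refine hE ⟨a₁, fun e c ht => ?_, fun e c j ht => ⟨?_, ?_⟩⟩
      · by_contra hb
        exact a₂ ⟨_, memG _ _ ht, by simpa using hb⟩
      · by_contra hb
        exact a₃ ⟨_, memB _ _ _ ht, hb⟩
      · by_contra hb
        exact a₄ ⟨_, memB _ _ _ ht, hb⟩)
    (by
      have a := prob_or_le hp (fun x => ¬ L.Ok x) fun x => G x ∨ B x
      have b := prob_or_le hp G B
      linarith)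
  have e₁ := expect_replace_le hp hi
    (E := fun x y => ¬ (L.Ok x ∧ L.Clean₁ i s x (replaceFragment x i y)))
    (U := fun x => ¬ L.Ok x ∨ G x) (V := G) (r := π + 2 * t₁ * δ₂)
    (fun x y hE => by
      by_contra hno
      push Not at hno
      obtain ⟨⟨a₁, a₂⟩, a₄⟩ := hno
      refine hE ⟨a₁, fun e c ht => ⟨?_, ?_⟩⟩
      · by_contra hb
        exact a₂ ⟨_, memG _ _ ht, by simpa using hb⟩
      · by_contra hb
        exact a₄ ⟨_, memG _ _ ht, by simpa using hb⟩)
    (by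
      have a := prob_or_le hp (fun x => ¬ L.Ok x) G
      linarith)
  have hcost : ∀ (x : Fin n → A) (y : Fin s → A), (L.updater.cost i y x : ℝ) ≤ 2 * b₀ +
      (2 * b₁ * (if ¬ (L.Ok x ∧ L.Clean₀ i s x (replaceFragment x i y)) then 1 else 0) +
      2 * b₂ * if ¬ (L.Ok x ∧ L.Clean₁ i s x (replaceFragment x i y)) then 1 else 0) := by
    intro x y
    have := L.cost_updater_le i y x
    have c₀ : ((L.probes₀ i s).card : ℝ) ≤ b₀ := by exact_mod_cast h₀ i
    have c₁ : ((L.probes₁ i s).card : ℝ) ≤ b₁ := by exact_mod_cast h₁ i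
    have c₂ : ((L.probes₂ i s).card : ℝ) ≤ b₂ := by exact_mod_cast h₂ i
    have hc : (L.updater.cost i y x : ℝ) ≤ 2 * ((L.probes₀ i s).card : ℝ) +
      ((if ¬ (L.Ok x ∧ L.Clean₀ i s x (replaceFragment x i y)) then
        2 * ((L.probes₁ i s).card : ℝ) else 0) +
      if ¬ (L.Ok x ∧ L.Clean₁ i s x (replaceFragment x i y)) then
        2 * ((L.probes₂ i s).card : ℝ) else 0) := by exact_mod_cast this
    split_ifs at hc ⊢ <;> linarith
  have hexp : ∑ x : Fin n → A, ∑ y : Fin s → A,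
      iidProb p x * iidProb p y * (L.updater.cost i y x : ℝ) =
      expect p fun x => expect p fun y : Fin s → A => (L.updater.cost i y x : ℝ) := by
    simp only [expect_def, Finset.mul_sum, iidProb, mul_assoc]
  rw [hexp]
  refine (expect_mono hp fun x => expect_mono hp fun y => hcost x y).trans ?_
  simp only [expect_add, expect_const_mul, expect_const hp]
  have n₁ : (0 : ℝ) ≤ b₁ := Nat.cast_nonneg _
  have n₂ : (0 : ℝ) ≤ b₂ := Nat.cast_nonneg _
  have f₀ := mul_le_mul_of_nonneg_left e₀ n₁
  have f₁ := mul_le_mul_of_nonneg_left e₁ n₂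
  linarith

end Probability

end Layout

/-! ### Circuits for the encoder and the decoder -/

theorem pack_congr_of_eq {m w k : ℕ} {σ ρ : Type} {bad bad' : Fin m → Bool}
    {sl sl' : Fin m → σ → Bool} {rw rw' : Fin m → ρ → Bool} (hb : bad = bad')
    (t : PackIndex m w k σ ρ) (hs : ∀ j u, t = Sum.inr (Sum.inl (j, u)) → sl j u = sl' j u)
    (hr : ∀ e r, t = Sum.inr (Sum.inr (e, r)) → ∀ j, rw j r = rw' j r) :
    pack bad sl rw t = pack bad' sl' rw' t := by
  subst hb
  rcases t with ⟨j, t⟩ | ⟨j, u⟩ | ⟨e, r⟩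
  · rfl
  · exact hs j u rfl
  · simp only [pack, hr e r rfl]

/-- A set of wires from which a bit of the joint encoding of `m` units can be computed, given the
wires `bw j`, `sw j`, `rw j` of the units. -/
def packWires {m w k : ℕ} {σ ρ κ : Type} [DecidableEq κ] (bw : Fin m → κ) (sw : Fin m → σ → κ)
    (rw : Fin m → ρ → κ) (t : PackIndex m w k σ ρ) : Finset κ :=
  Finset.univ.image bw ∪ Finset.univ.image fun i : Fin m =>
    match t with
    | Sum.inl _ => bw i
    | Sum.inr (Sum.inl (j, u)) => sw j u
    | Sum.inr (Sum.inr (_, r)) => rw i r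

section PackWires

variable {m w k : ℕ} {σ ρ κ : Type} [DecidableEq κ] (bw : Fin m → κ) (sw : Fin m → σ → κ)
  (rw : Fin m → ρ → κ) (t : PackIndex m w k σ ρ)

theorem card_packWires_le : (packWires bw sw rw t).card ≤ 2 * m := by
  refine (Finset.card_union_le _ _).trans ?_
  have h₁ := Layout.card_image_fin_le bw
  have h₂ := fun f : Fin m → κ => Layout.card_image_fin_le f
  rw [Fintype.card_fin] at h₁
  rw [two_mul]
  exact Nat.add_le_add h₁ ((h₂ _).trans_eq (Fintype.card_fin m))

theorem bad_mem_packWires (j : Fin m) : bw j ∈ packWires bw sw rw t :=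
  Finset.mem_union_left _ (Finset.mem_image_of_mem _ (Finset.mem_univ j))

theorem slot_mem_packWires (j : Fin m) (u : σ) :
    sw j u ∈ packWires bw sw rw (Sum.inr (Sum.inl (j, u)) : PackIndex m w k σ ρ) :=
  Finset.mem_union_right _ (Finset.mem_image.2 ⟨j, Finset.mem_univ _, rfl⟩)

theorem raw_mem_packWires (j : Fin m) (e : Fin k) (r : ρ) :
    rw j r ∈ packWires bw sw rw (Sum.inr (Sum.inr (e, r)) : PackIndex m w k σ ρ) :=
  Finset.mem_union_right _ (Finset.mem_image.2 ⟨j, Finset.mem_univ _, rfl⟩)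

end PackWires

namespace Layout

variable {A : Type*} {n : ℕ} (L : Layout A n)

theorem decodesWithin [Fintype A] {d : ℕ} (hd : L.raw.width ≤ d) (hd' : ∀ s, (L.coder s).width ≤ d) :
    DecodesWithin L.scheme (n * Fintype.card A * (4 * 2 ^ (L.ptr₂ + L.ptr₁ + d))) := by
  classical
  have h : Computes (Fintype.card (Fin n × A) * (4 * 2 ^ (L.ptr₂ + L.ptr₁ + d)))
      (fun c : Fin L.len → Bool => c) fun c => messageBits (L.scheme.dec c) := by
    refine Computes.all fun q => ?_
    have ht := Computes.eval_tree (u := fun c : Fin L.len → Bool => c)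
      ((L.flatTree (q.1 / L.size)).map fun z =>
        decide (z ⟨q.1 % L.size, Nat.mod_lt _ L.size_pos⟩ = q.2))
    have hdep := (DecisionTree.depth_map (L.flatTree (q.1 / L.size)) fun z =>
        decide (z ⟨q.1 % L.size, Nat.mod_lt _ L.size_pos⟩ = q.2)).trans
      (L.depth_flatTree hd hd' (q.1 / L.size))
    have hp := Nat.pow_le_pow_right (n := 2) (by norm_num) hdep
    convert ht.mono (show _ ≤ 4 * 2 ^ (L.ptr₂ + L.ptr₁ + d) by omega) using 1
    funext c _
    rw [DecisionTree.eval_map]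
    unfold messageBits
    congr 1
  rw [Fintype.card_prod, Fintype.card_fin] at h
  exact h

/-- The wires that carry, for each block, whether it is atypical and its two encodings. -/
abbrev BlockWire : Type := Σ s : Fin L.sections,
  Fin L.groups × Fin L.blocks × (Unit ⊕ Fin (L.coder s).width ⊕ Fin L.raw.width)

/-- The wires that carry, for each group, whether it is exceptional and its two encodings. -/
abbrev GroupWire : Type := Σ s : Fin L.sections,
  Fin L.groups × (Unit ⊕ L.GroupIndex (L.coder s) ⊕ (Fin L.blocks × Fin L.raw.width))

def blockWire (x : Fin n → A) : L.BlockWire → Bool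
  | ⟨s, c, j, Sum.inl _⟩ => L.badBlock (L.coder s) (L.cut x s c) j
  | ⟨s, c, j, Sum.inr (Sum.inl u)⟩ => (L.coder s).enc (L.cut x s c j) u
  | ⟨s, c, j, Sum.inr (Sum.inr r)⟩ => L.raw.enc (L.cut x s c j) r

def groupWire (x : Fin n → A) : L.GroupWire → Bool
  | ⟨s, c, Sum.inl _⟩ => L.badGroup (L.coder s) (L.cut x s) c
  | ⟨s, c, Sum.inr (Sum.inl u)⟩ => L.groupBits (L.coder s) (L.cut x s c) u
  | ⟨s, c, Sum.inr (Sum.inr r)⟩ => L.rawGroup (L.cut x s c) r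

theorem computes_blockWire [Fintype A] : Computes
    (Fintype.card L.BlockWire * (4 * 2 ^ (L.size * Fintype.card A))) messageBits L.blockWire := by
  classical
  refine Computes.all_of_dependsOn (fun q => Finset.univ.filter fun k : Fin n × A =>
    (k.1 : ℕ) / L.size = (q.1 * L.groups + q.2.1) * L.blocks + q.2.2.1) _ (fun q => ?_)
    fun q x y hxy => ?_
  · have hu : L.size * Fintype.card A = (Finset.univ : Finset (Fin L.size × A)).card := by simp
    refine le_of_le_of_eq (Finset.card_le_card_of_injOn
      (fun k => (⟨k.1 % L.size, Nat.mod_lt _ L.size_pos⟩, k.2)) (fun _ _ => Finset.mem_univ _) ?_) hu.symm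
    rintro ⟨k, a⟩ hk ⟨k', a'⟩ hk' h
    simp only [Finset.coe_filter, Set.mem_ofPred_eq, Finset.mem_univ, true_and] at hk hk'
    obtain ⟨h₁, rfl⟩ := Prod.mk.inj h
    have h₂ := Fin.mk.inj h₁
    have : (k : ℕ) = k' := by
      rw [← Nat.div_add_mod (k : ℕ) L.size, ← Nat.div_add_mod (k' : ℕ) L.size, hk, hk', h₂]
    rw [Fin.ext this]
  · obtain ⟨s, c, j, t⟩ := q
    have hcut : L.cut x s c j = L.cut y s c j := by
      funext o
      unfold cut
      split_ifs with h
      · have := hxy (⟨_, h⟩, x ⟨_, h⟩) (by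
          simp only [Finset.mem_filter, Finset.mem_univ, true_and]
          exact (L.pos_div_mod_size s c j o).1)
        simp only [messageBits, decide_true] at this
        exact (of_decide_eq_true this.symm).symm
      · rfl
    rcases t with t | u | r
    · simp only [blockWire, badBlock, hcut]
    · simp only [blockWire, hcut]
    · simp only [blockWire, hcut]

theorem computes_groupWire : Computes
    (Fintype.card L.GroupWire * (4 * 2 ^ (2 * L.blocks))) L.blockWire L.groupWire := by
  classical
  have hpos := L.blocks_pos
  let bw : ∀ (s : Fin L.sections) (c : Fin L.groups), Fin L.blocks → L.BlockWire :=
    fun s c j => ⟨s, c, j, Sum.inl ()⟩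
  let sw : ∀ (s : Fin L.sections) (c : Fin L.groups), Fin L.blocks →
    Fin (L.coder s).width → L.BlockWire := fun s c j u => ⟨s, c, j, Sum.inr (Sum.inl u)⟩
  let rw : ∀ (s : Fin L.sections) (c : Fin L.groups), Fin L.blocks →
    Fin L.raw.width → L.BlockWire := fun s c j r => ⟨s, c, j, Sum.inr (Sum.inr r)⟩
  let S : L.GroupWire → Finset L.BlockWire := fun q => match q with
    | ⟨s, c, Sum.inl _⟩ => Finset.univ.image (bw s c)
    | ⟨s, c, Sum.inr (Sum.inl t)⟩ => packWires (bw s c) (sw s c) (rw s c) t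
    | ⟨s, c, Sum.inr (Sum.inr (j, r))⟩ => {rw s c j r}
  refine Computes.all_of_dependsOn S _ (fun q => ?_) fun q x y hxy => ?_
  · obtain ⟨s, c, t | t | ⟨j, r⟩⟩ := q
    · have := card_image_fin_le (bw s c)
      rw [Fintype.card_fin] at this
      exact this.trans (by omega)
    · exact card_packWires_le _ _ _ t
    · exact (Finset.card_singleton _).le.trans (by omega)
  · obtain ⟨s, c, t | t | ⟨j, r⟩⟩ := q
    · have : L.badBlock (L.coder s) (L.cut x s c) = L.badBlock (L.coder s) (L.cut y s c) :=
        funext fun j => hxy (bw s c j) (Finset.mem_image_of_mem _ (Finset.mem_univ j))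
      simp only [groupWire, badGroup, this]
    · refine pack_congr_of_eq (funext fun j => ?_) t (fun j u ht => ?_) fun e r ht j => ?_
      · exact hxy (bw s c j) (bad_mem_packWires _ _ _ t j)
      · subst ht
        exact hxy (sw s c j u) (slot_mem_packWires _ _ _ j u)
      · subst ht
        exact hxy (rw s c j r) (raw_mem_packWires _ _ _ j e r)
    · exact hxy (rw s c j r) (Finset.mem_singleton_self _)

/-- Whether the blank section is substituted depends on the flags of the groups alone, so a bit of
the codeword depends on these flags and on one further wire per group. -/
theorem word_congr {x y : Fin n → A} {s : Fin L.sections} (t : L.SectionIndex (L.coder s))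
    (hbad : L.badGroup (L.coder s) (L.cut x s) = L.badGroup (L.coder s) (L.cut y s))
    (hs : ∀ c u, t = Sum.inr (Sum.inl (c, u)) →
      L.groupBits (L.coder s) (L.cut x s c) u = L.groupBits (L.coder s) (L.cut y s c) u)
    (hr : ∀ e r, t = Sum.inr (Sum.inr (e, r)) → ∀ c,
      L.rawGroup (L.cut x s c) r = L.rawGroup (L.cut y s c) r) :
    L.word x ⟨s, t⟩ = L.word y ⟨s, t⟩ := by
  have hok : L.SectionOk (L.coder s) (L.cut x s) ↔ L.SectionOk (L.coder s) (L.cut y s) := by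
    unfold SectionOk
    rw [hbad]
  unfold word fixSection
  by_cases h : L.SectionOk (L.coder s) (L.cut x s)
  · rw [if_pos h, if_pos (hok.1 h)]
    exact pack_congr_of_eq hbad t hs hr
  · rw [if_neg h, if_neg fun h' => h (hok.2 h')]

theorem groupWire_bad (x : Fin n → A) (s : Fin L.sections) (c : Fin L.groups) :
    L.groupWire x ⟨s, c, Sum.inl ()⟩ = L.badGroup (L.coder s) (L.cut x s) c := rfl

theorem groupWire_slot (x : Fin n → A) (s : Fin L.sections) (c : Fin L.groups)
    (u : L.GroupIndex (L.coder s)) :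
    L.groupWire x ⟨s, c, Sum.inr (Sum.inl u)⟩ = L.groupBits (L.coder s) (L.cut x s c) u := rfl

theorem groupWire_raw (x : Fin n → A) (s : Fin L.sections) (c : Fin L.groups)
    (r : Fin L.blocks × Fin L.raw.width) :
    L.groupWire x ⟨s, c, Sum.inr (Sum.inr r)⟩ = L.rawGroup (L.cut x s c) r := rfl

/-- The wires from which a bit of the codeword is computed. -/
def wordWires [DecidableEq L.GroupWire] (q : L.Index) : Finset L.GroupWire :=
  packWires (fun c => ⟨q.1, c, Sum.inl ()⟩) (fun c u => ⟨q.1, c, Sum.inr (Sum.inl u)⟩)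
    (fun c r => ⟨q.1, c, Sum.inr (Sum.inr r)⟩) q.2

theorem computes_word : Computes
    (Fintype.card L.Index * (4 * 2 ^ (2 * L.groups))) L.groupWire L.word := by
  classical
  refine Computes.all_of_dependsOn L.wordWires _
    (fun q => card_packWires_le _ _ _ q.2) fun q x y hxy => ?_
  obtain ⟨s, t⟩ := q
  refine L.word_congr t (funext fun c => ?_) (fun c u ht => ?_) fun e r ht c => ?_
  · rw [← groupWire_bad, ← groupWire_bad]
    exact hxy _ (bad_mem_packWires _ _ _ t c)
  · subst ht
    rw [← groupWire_slot, ← groupWire_slot]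
    exact hxy _ (slot_mem_packWires _ _ _ c u)
  · subst ht
    rw [← groupWire_raw, ← groupWire_raw]
    exact hxy _ (raw_mem_packWires _ _ _ c e r)

theorem encodesWithin [Fintype A] : EncodesWithin L.scheme
    (Fintype.card L.BlockWire * (4 * 2 ^ (L.size * Fintype.card A)) +
      Fintype.card L.GroupWire * (4 * 2 ^ (2 * L.blocks)) +
      Fintype.card L.Index * (4 * 2 ^ (2 * L.groups))) :=
  ((L.computes_blockWire.comp L.computes_groupWire).comp L.computes_word).reindex L.loc.symm

theorem card_blockWire_le {d : ℕ} (hd : L.raw.width ≤ d) (hd' : ∀ s, (L.coder s).width ≤ d) :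
    Fintype.card L.BlockWire ≤ L.sections * (L.groups * (L.blocks * (1 + (d + d)))) := by
  rw [Fintype.card_sigma]
  refine (Finset.sum_le_card_nsmul _ _ (L.groups * (L.blocks * (1 + (d + d)))) fun s _ => ?_).trans
    (by simp)
  have := hd' s
  simp only [Fintype.card_prod, Fintype.card_fin, Fintype.card_sum, Fintype.card_unit]
  gcongr

theorem card_groupWire_le {d W : ℕ} (hd : L.raw.width ≤ d)
    (hW : ∀ s, Fintype.card (L.GroupIndex (L.coder s)) ≤ W) :
    Fintype.card L.GroupWire ≤ L.sections * (L.groups * (1 + (W + L.blocks * d))) := by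
  rw [Fintype.card_sigma]
  refine (Finset.sum_le_card_nsmul _ _ (L.groups * (1 + (W + L.blocks * d))) fun s _ => ?_).trans
    (by simp)
  have := hW s
  rw [Fintype.card_prod, Fintype.card_sum, Fintype.card_sum, Fintype.card_fin, Fintype.card_unit,
    Fintype.card_prod, Fintype.card_fin, Fintype.card_fin]
  gcongr

end Layout

/-! ### Universal block codes from type classes -/

/-- An injective numbering of a finite set by words of bits. -/
def bitEmb {B : Type*} (T : Finset B) : T ↪ (Fin (Nat.clog 2 T.card) → Bool) :=
  (Function.Embedding.nonempty_of_card_le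
    (by simpa using Nat.le_pow_clog (by norm_num) T.card)).some

open Classical in
/-- A code that reproduces the blocks of a given set. -/
def BlockCode.ofSet {A : Type*} {b : ℕ} (T : Finset (Fin b → A)) (a₀ : A) : BlockCode A b where
  width := Nat.clog 2 T.card
  typical x := x ∈ T
  enc x := if h : x ∈ T then bitEmb T ⟨x, h⟩ else fun _ => false
  dec z := if h : ∃ x : T, bitEmb T x = z then (h.choose : Fin b → A) else fun _ => a₀
  dec_enc x hx := by
    have h : ∃ y : T, bitEmb T y = bitEmb T ⟨x, hx⟩ := ⟨_, rfl⟩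
    simp only [dif_pos hx, dif_pos h]
    exact congrArg Subtype.val ((bitEmb T).injective h.choose_spec)

section Types

variable {A : Type*} [Fintype A] {b : ℕ}

open Classical in
/-- The number of occurrences of a letter. -/
def letterCount (x : Fin b → A) (a : A) : ℕ := (Finset.univ.filter fun i => x i = a).card

open Classical in
/-- The words with the same letters as `x`. -/
def typeClass (x : Fin b → A) : Finset (Fin b → A) :=
  Finset.univ.filter fun y => letterCount y = letterCount x

theorem prod_eq_prod_letterCount (p : A → ℝ) (x : Fin b → A) :
    ∏ i, p (x i) = ∏ a, p a ^ letterCount x a := by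
  classical
  rw [← Finset.prod_fiberwise' Finset.univ x p]
  refine Finset.prod_congr rfl fun a _ => ?_
  rw [Finset.prod_const]
  congr 1

/-- The words of a type class are equally likely, and their total probability is at most one. -/
theorem prod_mul_card_typeClass_le {p : A → ℝ} (hp : p ∈ stdSimplex ℝ A) (x : Fin b → A) :
    (∏ i, p (x i)) * (typeClass x).card ≤ 1 := by
  classical
  have h₁ : (∏ i, p (x i)) * (typeClass x).card = ∑ y ∈ typeClass x, ∏ i, p (y i) := by
    rw [Finset.sum_congr rfl fun y hy => ?_, Finset.sum_const, nsmul_eq_mul, mul_comm]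
    rw [prod_eq_prod_letterCount, prod_eq_prod_letterCount, (Finset.mem_filter.1 hy).2]
  have h₂ := expect_one (ι := Fin b) hp
  rw [expect_def] at h₂
  simp only [mul_one] at h₂
  rw [h₁, ← h₂]
  exact Finset.sum_le_univ_sum_of_nonneg fun y => prod_nonneg_of_mem hp y

open Classical in
/-- The words whose type class has size at most `2 ^ (b * h)`. -/
def typicalSet (A : Type*) [Fintype A] (b : ℕ) (h : ℝ) : Finset (Fin b → A) :=
  Finset.univ.filter fun x => ((typeClass x).card : ℝ) ≤ max 1 (2 ^ (b * h))

/-- The type class of a constant word is a singleton; the lower cap `1` in `typicalSet` admits it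
for every `h`. -/
theorem const_mem_typicalSet (h : ℝ) (a : A) : (fun _ => a) ∈ typicalSet A b h := by
  classical
  have : typeClass (fun _ : Fin b => a) ⊆ {fun _ => a} := by
    intro y hy
    have := congrFun (Finset.mem_filter.1 hy).2 a
    simp only [letterCount, Finset.filter_true, Finset.card_univ, Fintype.card_fin] at this
    rw [Finset.mem_singleton]
    have h₂ : (Finset.univ.filter fun i => y i = a) = Finset.univ :=
      Finset.eq_univ_of_card _ (by simpa using this)
    funext i
    have := Finset.mem_univ i
    rw [← h₂] at this
    exact (Finset.mem_filter.1 this).2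
  refine Finset.mem_filter.2 ⟨Finset.mem_univ _, le_max_of_le_left ?_⟩
  exact_mod_cast (Finset.card_le_card this).trans (by simp)

/-- There are at most `(2 ^ w) ^ |A|` vectors of letter counts, and each contributes at most `2 ^ ⌈b
* h⌉` words. -/
theorem card_typicalSet_le {w : ℕ} (hw : b < 2 ^ w) (h : ℝ) :
    (typicalSet A b h).card ≤ 2 ^ (w * Fintype.card A + ⌈b * h⌉₊) := by
  classical
  have h₁ : ((2 : ℝ) ^ (b * h)) ≤ 2 ^ ⌈(b : ℝ) * h⌉₊ := by
    rw [← Real.rpow_natCast]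
    exact Real.rpow_le_rpow_of_exponent_le (by norm_num) (Nat.le_ceil _)
  have h₂ : (1 : ℝ) ≤ 2 ^ ⌈(b : ℝ) * h⌉₊ := one_le_pow₀ (by norm_num)
  let f : (Fin b → A) → (A → Fin (2 ^ w)) := fun x a => ⟨letterCount x a,
    lt_of_le_of_lt ((Finset.card_le_univ _).trans (by simp)) hw⟩
  have h₃ := Finset.card_le_mul_card_image (f := f) (typicalSet A b h) (2 ^ ⌈(b : ℝ) * h⌉₊)
    fun c hc => by
      obtain ⟨x, hx, rfl⟩ := Finset.mem_image.1 hc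
      have : ((typeClass x).card : ℝ) ≤ 2 ^ ⌈(b : ℝ) * h⌉₊ :=
        (Finset.mem_filter.1 hx).2.trans (max_le h₂ h₁)
      refine le_trans (Finset.card_le_card fun y hy => ?_) (by exact_mod_cast this)
      refine Finset.mem_filter.2 ⟨Finset.mem_univ _, funext fun a => ?_⟩
      have := congrFun (Finset.mem_filter.1 hy).2 a
      exact Fin.mk.inj this
  refine h₃.trans ?_
  rw [pow_add, mul_comm]
  refine Nat.mul_le_mul_right _ ((Finset.card_le_univ _).trans ?_)
  simp [pow_mul]

/-- Chernoff's bound for the probability of atypical words. -/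
theorem exists_prob_not_typical_le {p : A → ℝ} (hp : p ∈ stdSimplex ℝ A) {h : ℝ}
    (hh : entropy p < h) : ∃ θ : ℝ, 0 ≤ θ ∧ θ < 1 ∧
      ∀ b : ℕ, prob p (fun z : Fin b → A => z ∉ typicalSet A b h) ≤ θ ^ b := by
  classical
  -- The moment generating function, to base 2, of `-log p(a) - h`. Its value at `0` is `1` and its
  -- slope there has the sign of `entropy p - h < 0`, so `φ t < 1` for some `t > 0`.
  let φ : ℝ → ℝ := fun t => ∑ a, p a * (p a * 2 ^ h) ^ (-t)
  have h2h : (0 : ℝ) < 2 ^ h := Real.rpow_pos_of_pos (by norm_num) h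
  have hφ0 : φ 0 = 1 := by simp [φ, hp.2]
  have hderiv : HasDerivAt φ (Real.log 2 * (entropy p - h)) 0 := by
    have : HasDerivAt φ (∑ a, p a * (-Real.log (p a * 2 ^ h))) 0 := by
      refine HasDerivAt.fun_sum fun a _ => ?_
      rcases (hp.1 a).eq_or_lt with h0 | h0
      · simp only [← h0, zero_mul]
        exact hasDerivAt_const _ _
      · have := ((hasDerivAt_neg (0 : ℝ)).const_rpow (a := p a * 2 ^ h) (mul_pos h0 h2h))
        simp only [neg_zero, Real.rpow_zero] at this
        have e : p a * -Real.log (p a * 2 ^ h) = p a * (Real.log (p a * 2 ^ h) * -1 * 1) := by ring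
        rw [e]
        exact this.const_mul (p a)
    convert this using 1
    unfold entropy
    have e : ∀ a, p a * (-Real.log (p a * 2 ^ h)) =
        - (Real.log 2 * (p a * Real.logb 2 (p a))) - Real.log 2 * h * p a := by
      intro a
      rcases (hp.1 a).eq_or_lt with h0 | h0
      · simp [← h0]
      · rw [Real.log_mul h0.ne' h2h.ne', Real.log_rpow (by norm_num), Real.logb]
        have := (Real.log_pos (by norm_num : (1 : ℝ) < 2)).ne'
        field_simp
        ring
    simp only [e, Finset.sum_sub_distrib, Finset.sum_neg_distrib, ← Finset.mul_sum, hp.2]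
    ring
  have hneg : Real.log 2 * (entropy p - h) < 0 :=
    mul_neg_of_pos_of_neg (Real.log_pos (by norm_num)) (by linarith)
  obtain ⟨t, ht0, ht⟩ : ∃ t > 0, φ t < 1 := by
    have h₁ := (hasDerivAt_iff_tendsto_slope.1 hderiv).eventually_lt_const hneg
    have h₂ : ∀ᶠ t in 𝓝[>] (0 : ℝ), slope φ 0 t < 0 :=
      h₁.filter_mono (nhdsWithin_mono _ fun t ht => ne_of_gt ht)
    obtain ⟨t, ht, ht0⟩ := (h₂.and self_mem_nhdsWithin).exists
    have ht0' : 0 < t := ht0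
    refine ⟨t, ht0', ?_⟩
    rw [slope_def_field, hφ0, sub_zero, div_neg_iff] at ht
    rcases ht with ht | ht <;> linarith
  refine ⟨φ t, Finset.sum_nonneg fun a _ => mul_nonneg (hp.1 a)
    (Real.rpow_nonneg (mul_nonneg (hp.1 a) h2h.le) _), ht, fun b => ?_⟩
  have hprod := expect_prod (p := p) (ι := Fin b) fun _ a => (p a * 2 ^ h) ^ (-t)
  simp only [Finset.prod_const, Finset.card_univ, Fintype.card_fin] at hprod
  change _ ≤ (∑ a, p a * (p a * 2 ^ h) ^ (-t)) ^ b
  rw [← hprod]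
  unfold prob
  rw [expect_def, expect_def]
  refine Finset.sum_le_sum fun z _ => ?_
  rcases (prod_nonneg_of_mem hp z).eq_or_lt with h0 | h0
  · simp [← h0]
  refine mul_le_mul_of_nonneg_left ?_ h0.le
  have hpr : ∏ i, (p (z i) * 2 ^ h) ^ (-t) = ((∏ i, p (z i)) * 2 ^ (b * h)) ^ (-t) := by
    rw [Real.finsetProd_rpow _ _ fun i _ => mul_nonneg (hp.1 _) h2h.le, Finset.prod_mul_distrib,
      Finset.prod_const, Finset.card_univ, Fintype.card_fin, ← Real.rpow_mul_natCast (by norm_num),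
      mul_comm h]
  rw [hpr]
  have hb : (0 : ℝ) < 2 ^ (b * h) := Real.rpow_pos_of_pos (by norm_num) _
  split_ifs with hz
  · refine Real.one_le_rpow_of_pos_of_le_one_of_nonpos (mul_pos h0 hb) ?_ (by linarith)
    -- An atypical word shares its probability with more than `2 ^ (b * h)` others, so its
    -- probability times `2 ^ (b * h)` is at most one and the power `-t` of this product is at least
    -- one.
    have h₁ : (2 : ℝ) ^ (b * h) ≤ (typeClass z).card := by
      by_contra hcon
      refine hz (Finset.mem_filter.2 ⟨Finset.mem_univ _, ?_⟩)
      exact le_max_of_le_right (not_le.1 hcon).le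
    exact (mul_le_mul_of_nonneg_left h₁ h0.le).trans (prod_mul_card_typeClass_le hp z)
  · exact Real.rpow_nonneg (mul_pos h0 hb).le _

end Types

/-! ### Numbers of bits and their growth -/

section BitLength

/-- The number of bits of a positive number. -/
def lg (m : ℕ) : ℕ := Nat.log 2 m + 1

theorem lt_two_pow_lg (m : ℕ) : m < 2 ^ lg m := Nat.lt_pow_succ_log_self (by norm_num) m

theorem lg_pos (m : ℕ) : 0 < lg m := Nat.succ_pos _

theorem two_pow_lg_le {m : ℕ} (hm : m ≠ 0) : 2 ^ lg m ≤ 2 * m := by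
  rw [lg, pow_succ, mul_comm]
  exact Nat.mul_le_mul_left _ (Nat.pow_log_le_self 2 hm)

theorem lg_le {m : ℕ} (hm : m ≠ 0) : lg m ≤ m := Nat.log_lt_self 2 hm

theorem tendsto_lg : Tendsto lg atTop atTop :=
  tendsto_atTop_mono' _ (Eventually.of_forall fun m => Nat.le_succ _) <| by
    refine tendsto_atTop.2 fun j => ?_
    filter_upwards [eventually_ge_atTop (2 ^ j)] with m hm
    exact Nat.le_log_of_pow_le (by norm_num) hm

theorem eventually_mul_pow_mul_pow_le {θ : ℝ} (h0 : 0 ≤ θ) (h1 : θ < 1) (c : ℝ) (k : ℕ) :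
    ∀ᶠ j : ℕ in atTop, c * (j : ℝ) ^ k * θ ^ j ≤ 1 := by
  have := (tendsto_pow_const_mul_const_pow_of_lt_one k h0 h1).const_mul c
  rw [mul_zero] at this
  filter_upwards [this.eventually_le_const one_pos] with j hj
  rwa [mul_assoc]

theorem eventually_mul_lg_pow_le (c k : ℕ) : ∀ᶠ m in atTop, c * lg m ^ k ≤ m := by
  have h := tendsto_lg.eventually
    (eventually_mul_pow_mul_pow_le (θ := 1 / 2) (by norm_num) (by norm_num) (2 * c) k)
  filter_upwards [h, eventually_ne_atTop 0] with m hm h0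
  have h₁ : (2 : ℝ) ^ lg m ≤ 2 * m := by exact_mod_cast two_pow_lg_le h0
  have h₂ : (0 : ℝ) < 2 ^ lg m := by positivity
  rw [one_div, inv_pow, ← div_eq_mul_inv, div_le_one h₂] at hm
  have h₃ : (c : ℝ) * lg m ^ k ≤ m := by linarith
  exact_mod_cast h₃

/-- Each of the two roundings costs at most one bit in the end, and `loglog n ≥ 2` from `n = 16` on.
-/
theorem lg_lg_le {n : ℕ} (hn : 16 ≤ n) : (lg (lg n) : ℝ) ≤ 2 * loglog n := by
  have hn' : (16 : ℝ) ≤ n := by exact_mod_cast hn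
  have h2 : (1 : ℝ) < 2 := by norm_num
  have h₁ : (4 : ℝ) ≤ Real.logb 2 n := by
    rw [Real.le_logb_iff_rpow_le h2 (by linarith)]
    norm_num
    exact hn
  have h₂ : (2 : ℝ) ≤ loglog n := by
    unfold loglog
    rw [Real.le_logb_iff_rpow_le h2 (by linarith)]
    norm_num
    exact h₁
  have h₃ : (lg n : ℝ) ≤ 2 * Real.logb 2 n := by
    have := Real.natLog_le_logb n 2
    unfold lg
    push_cast at this ⊢
    linarith
  have h₄ : Real.logb 2 (lg n) ≤ 1 + loglog n := by
    unfold loglog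
    have h₅ : (0 : ℝ) < lg n := by exact_mod_cast lg_pos n
    refine (Real.logb_le_logb_of_le h2 h₅ h₃).trans ?_
    rw [Real.logb_mul (by norm_num) (by linarith), Real.logb_self_eq_one h2]
  have h₆ := Real.natLog_le_logb (lg n) 2
  unfold lg at h₄ h₆ ⊢
  push_cast at h₄ h₆ ⊢
  linarith

end BitLength

/-! ### The parameters of the code -/

section Parameters

variable (A : Type*) [Fintype A]

/-- The number of symbols of a block per bit of a pointer. -/
def blockFactor : ℕ :=
  -- With factor `K` the pointers cost at most about `2 / K` bits per symbol; this choice makes that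
  -- less than half of the gap `lg |A| - log |A|`.
  ⌈4 / ((lg (Fintype.card A) : ℝ) - Real.logb 2 (Fintype.card A))⌉₊ + 1

def blockSize (n : ℕ) : ℕ := blockFactor A * lg (lg n)

theorem blockFactor_pos : 0 < blockFactor A := Nat.succ_pos _

theorem logb_card_lt [Nonempty A] : Real.logb 2 (Fintype.card A) < lg (Fintype.card A) := by
  rw [Real.logb_lt_iff_lt_rpow (by norm_num) (by exact_mod_cast Fintype.card_pos),
    Real.rpow_natCast]
  exact_mod_cast lt_two_pow_lg _

theorem lg_lg_le_blockSize (n : ℕ) : lg (lg n) ≤ blockSize A n :=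
  Nat.le_mul_of_pos_left _ (blockFactor_pos A)

theorem blockSize_pos (n : ℕ) : 0 < blockSize A n :=
  Nat.mul_pos (blockFactor_pos A) (lg_pos _)

theorem tendsto_blockSize : Tendsto (blockSize A) atTop atTop :=
  tendsto_atTop_mono (lg_lg_le_blockSize A) (tendsto_lg.comp tendsto_lg)

theorem eventually_mul_blockSize_pow_le (c k : ℕ) :
    ∀ᶠ n in atTop, c * blockSize A n ^ k ≤ lg n := by
  filter_upwards [tendsto_lg.eventually (eventually_mul_lg_pow_le (c * blockFactor A ^ k) k)]
    with n hn
  rwa [blockSize, mul_pow, ← mul_assoc]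

theorem lg_le_two_pow_blockSize (n : ℕ) : lg n ≤ 2 ^ blockSize A n :=
  (lt_two_pow_lg _).le.trans (Nat.pow_le_pow_right (by norm_num) (lg_lg_le_blockSize A n))

theorem lg_blockSize_le (n : ℕ) : lg (blockSize A n) ≤ blockSize A n :=
  lg_le (blockSize_pos A n).ne'

/-- The number of bits of the fixed-length code for blocks. -/
def rawWidth (n : ℕ) : ℕ := Nat.clog 2 (Fintype.card (Fin (blockSize A n) → A))

theorem rawWidth_le (n : ℕ) : rawWidth A n ≤ blockSize A n * Nat.clog 2 (Fintype.card A) := by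
  rw [rawWidth, Nat.clog_le_iff_le_pow (by norm_num), Fintype.card_fun, Fintype.card_fin,
    mul_comm, pow_mul]
  exact Nat.pow_le_pow_left (Nat.le_pow_clog (by norm_num) _) _

theorem rawWidth_le_mul_logb [Nonempty A] (n : ℕ) :
    (rawWidth A n : ℝ) ≤ blockSize A n * Real.logb 2 (Fintype.card A) + 1 := by
  rw [rawWidth, ← Real.natCeil_logb_natCast, Fintype.card_fun, Fintype.card_fin]
  have h : (1 : ℝ) ≤ Fintype.card A := by exact_mod_cast Fintype.card_pos
  push_cast
  rw [Real.logb_pow]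
  exact (Nat.ceil_lt_add_one (mul_nonneg (Nat.cast_nonneg _)
    (Real.logb_nonneg (by norm_num) h))).le

/-- A bound for the number of bits per symbol. -/
def bitFactor : ℕ := 3 * Nat.clog 2 (Fintype.card A) + 2

theorem probe_width_le (n : ℕ) : lg (lg n) + lg (blockSize A n) + rawWidth A n ≤
    blockSize A n * bitFactor A := by
  have h₁ := lg_lg_le_blockSize A n
  have h₂ := lg_blockSize_le A n
  have h₃ := rawWidth_le A n
  unfold bitFactor
  nlinarith [Nat.zero_le (blockSize A n * Nat.clog 2 (Fintype.card A))]

variable [Nonempty A]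

/-- The number of sections without padding. -/
def sectionCount (n : ℕ) : ℕ := n / (lg n * blockSize A n * blockSize A n)

/-- The layout of the code; `h` is a bound for the entropy. -/
def layout (h : ℝ) (n : ℕ) : Layout A n where
  size := blockSize A n
  blocks := blockSize A n
  groups := lg n
  sections := sectionCount A n + 1
  ptr₁ := lg (blockSize A n)
  ptr₂ := lg (lg n)
  -- This tends to infinity, so that `θ ^ (b * lg b)` beats the union bound `2 ^ b`, and yet `lg b`
  -- raw blocks are negligible among `b`.
  spare₁ := lg (blockSize A n)
  -- With failure probability `2 ^ (-6 b)` per group, one more failure than this has probability of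
  -- order `2 ^ (-6 lg n)`, enough against the number of sections; the list takes a fraction of
  -- order `1 / b`.
  spare₂ := lg n / blockSize A n
  raw := BlockCode.ofSet Finset.univ (Classical.arbitrary A)
  -- The last section may reach beyond the message. It is coded raw, so its padding needs no
  -- probabilistic statement, and a single such section does not affect the rate.
  coder e := if (e : ℕ) < sectionCount A n then
      BlockCode.ofSet (typicalSet A (blockSize A n) h) (Classical.arbitrary A)
    else BlockCode.ofSet Finset.univ (Classical.arbitrary A)
  blank := Classical.arbitrary A
  size_pos := blockSize_pos A n
  blocks_pos := blockSize_pos A n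
  groups_pos := lg_pos n
  blocks_lt := lt_two_pow_lg _
  groups_lt := lt_two_pow_lg _
  raw_typical x := Finset.mem_univ x
  blank_typical e := by
    split_ifs
    · exact const_mem_typicalSet h _
    · exact Finset.mem_univ _
  le_length := by
    rw [mul_assoc, mul_assoc, ← mul_assoc (lg n), sectionCount, Nat.add_mul, one_mul]
    exact (Nat.lt_div_mul_add (by have := blockSize_pos A n; have := lg_pos n; positivity)).le

variable {A} {h : ℝ} {n : ℕ}

theorem raw_width_layout : (layout A h n).raw.width = rawWidth A n := by
  simp [layout, BlockCode.ofSet, rawWidth]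

theorem coder_width_layout_le (e : Fin (layout A h n).sections) :
    ((layout A h n).coder e).width ≤ rawWidth A n := by
  have : ∀ T : Finset (Fin (blockSize A n) → A), ∀ a,
      (BlockCode.ofSet T a).width ≤ rawWidth A n := fun T a =>
    Nat.clog_mono_right 2 (Finset.card_le_univ T)
  simp only [layout]
  split_ifs <;> exact this _ _

theorem card_groupIndex_layout (C : BlockCode A (layout A h n).size) :
    Fintype.card ((layout A h n).GroupIndex C) = blockSize A n * lg (blockSize A n) +
      (blockSize A n * C.width + lg (blockSize A n) * rawWidth A n) := by
  rw [card_packIndex, Fintype.card_fin, Fintype.card_fin, raw_width_layout]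
  rfl

theorem card_sectionIndex_layout (C : BlockCode A (layout A h n).size) :
    Fintype.card ((layout A h n).SectionIndex C) = lg n * lg (lg n) +
      (lg n * (blockSize A n * lg (blockSize A n) +
        (blockSize A n * C.width + lg (blockSize A n) * rawWidth A n)) +
        lg n / blockSize A n * (blockSize A n * rawWidth A n)) := by
  rw [card_packIndex, card_groupIndex_layout, Fintype.card_prod, Fintype.card_fin,
    Fintype.card_fin, raw_width_layout]
  rfl

theorem card_groupIndex_layout_le (e : Fin (layout A h n).sections) :
    lg (lg n) + Fintype.card ((layout A h n).GroupIndex ((layout A h n).coder e)) ≤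
      blockSize A n * blockSize A n * bitFactor A := by
  rw [card_groupIndex_layout]
  have h₀ := blockSize_pos A n
  have h₁ := lg_lg_le_blockSize A n
  have h₂ := lg_blockSize_le A n
  have h₃ := rawWidth_le A n
  have h₄ := coder_width_layout_le e
  unfold bitFactor
  generalize blockSize A n = b at *
  generalize Nat.clog 2 (Fintype.card A) = c at *
  have h₅ : b * lg b ≤ b * b := Nat.mul_le_mul_left _ h₂
  have h₆ : b * ((layout A h n).coder e).width ≤ b * (b * c) :=
    Nat.mul_le_mul_left _ (h₄.trans h₃)
  have h₇ : lg b * rawWidth A n ≤ b * (b * c) := Nat.mul_le_mul h₂ h₃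
  have h₈ : b ≤ b * b := Nat.le_mul_of_pos_left _ h₀
  have h₉ : b * b * (3 * c + 2) = 3 * (b * (b * c)) + 2 * (b * b) := by ring
  omega

theorem card_sectionIndex_layout_le (e : Fin (layout A h n).sections) :
    Fintype.card ((layout A h n).SectionIndex ((layout A h n).coder e)) ≤
      lg n * blockSize A n * blockSize A n * bitFactor A := by
  rw [card_sectionIndex_layout]
  have h₀ := blockSize_pos A n
  have h₁ := lg_lg_le_blockSize A n
  have h₂ := lg_blockSize_le A n
  have h₃ := rawWidth_le A n
  have h₄ := coder_width_layout_le e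
  have h₅ := Nat.div_mul_le_self (lg n) (blockSize A n)
  unfold bitFactor
  generalize blockSize A n = b at *
  generalize Nat.clog 2 (Fintype.card A) = c at *
  generalize lg n / b = k at *
  generalize lg n = N at *
  have h₆ : b * lg b ≤ b * b := Nat.mul_le_mul_left _ h₂
  have h₇ : b * ((layout A h n).coder e).width ≤ b * (b * c) :=
    Nat.mul_le_mul_left _ (h₄.trans h₃)
  have h₈ : lg b * rawWidth A n ≤ b * (b * c) := Nat.mul_le_mul h₂ h₃
  have h₉ : b ≤ b * b := Nat.le_mul_of_pos_left _ h₀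
  calc _ ≤ N * (b * b) + (N * (b * b + (b * (b * c) + b * (b * c))) + N * (b * (b * c))) := by
        refine Nat.add_le_add (Nat.mul_le_mul_left _ (h₁.trans h₉))
          (Nat.add_le_add (Nat.mul_le_mul_left _ (by omega)) ?_)
        rw [← mul_assoc]
        exact Nat.mul_le_mul h₅ (h₃.trans (Nat.le_mul_of_pos_left _ h₀))
    _ = N * b * b * (3 * c + 2) := by ring

theorem worstCase_layout_le (s : ℕ) : (layout A h n).decoder.worstCase s ≤
    (s / blockSize A n + 2) * (lg (lg n) + lg (blockSize A n) + rawWidth A n) :=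
  (layout A h n).worstCase_decoder_le raw_width_layout.le coder_width_layout_le s

end Parameters

/-! ### Rate and probability of error -/

section Guarantees

variable {A : Type*} [Fintype A]

theorem entropy_nonneg {p : A → ℝ} (hp : p ∈ stdSimplex ℝ A) : 0 ≤ entropy p := by
  unfold entropy
  rw [neg_nonneg]
  refine Finset.sum_nonpos fun a _ => mul_nonpos_of_nonneg_of_nonpos (hp.1 a) ?_
  refine Real.logb_nonpos (by norm_num) (hp.1 a) ?_
  rw [← hp.2]
  exact Finset.single_le_sum (fun a _ => hp.1 a) (Finset.mem_univ a)

theorem clog_card_typicalSet_le {b : ℕ} {h : ℝ} (hh : 0 ≤ h) :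
    (Nat.clog 2 (typicalSet A b h).card : ℝ) ≤ lg b * Fintype.card A + b * h + 1 := by
  have h₁ : Nat.clog 2 (typicalSet A b h).card ≤ lg b * Fintype.card A + ⌈b * h⌉₊ := by
    rw [Nat.clog_le_iff_le_pow (by norm_num)]
    exact card_typicalSet_le (lt_two_pow_lg b) h
  have h₂ := Nat.ceil_lt_add_one (mul_nonneg (Nat.cast_nonneg b) hh)
  have h₃ : (Nat.clog 2 (typicalSet A b h).card : ℝ) ≤ lg b * Fintype.card A + ⌈b * h⌉₊ := by
    exact_mod_cast h₁
  linarith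

theorem two_pow_mul_pow_le {θ : ℝ} (h0 : 0 ≤ θ) (b : ℕ) {w : ℕ} (hw : θ ^ w ≤ (1 / 2) ^ 7) :
    2 ^ b * (θ ^ b) ^ w ≤ ((1 / 2 : ℝ) ^ b) ^ 6 := by
  calc 2 ^ b * (θ ^ b) ^ w = 2 ^ b * (θ ^ w) ^ b := by rw [← pow_mul, ← pow_mul, mul_comm b]
    _ ≤ 2 ^ b * ((1 / 2) ^ 7) ^ b := by gcongr
    _ = ((1 / 2 : ℝ) ^ b) ^ 6 := by
      rw [← mul_pow, ← pow_mul, mul_comm b, pow_mul]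
      norm_num

/-- With `b * (spare₂ + 1) ≥ lg n` the failures contribute `2 ^ (-6 lg n)`; one factor `2 ^ lg n`
pays for the choice of groups and one for the number of sections. -/
theorem sections_mul_le {η : ℝ} {n : ℕ} (h0 : 0 ≤ η)
    (hη : η ≤ ((1 / 2 : ℝ) ^ blockSize A n) ^ 6) :
    ((sectionCount A n + 1 : ℕ) : ℝ) * (2 ^ lg n * η ^ (lg n / blockSize A n + 1)) ≤
      ((1 / 2) ^ lg n) ^ 4 := by
  have h₁ : sectionCount A n + 1 ≤ 2 ^ lg n :=
    (Nat.succ_le_succ (Nat.div_le_self _ _)).trans (lt_two_pow_lg n)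
  have h₂ : ((sectionCount A n + 1 : ℕ) : ℝ) ≤ 2 ^ lg n := by exact_mod_cast h₁
  have h₃ : lg n ≤ blockSize A n * (lg n / blockSize A n + 1) := by
    have := (Nat.lt_div_mul_add (blockSize_pos A n) (a := lg n)).le
    rw [mul_comm, Nat.add_mul, one_mul]
    exact this
  have h₄ : η ^ (lg n / blockSize A n + 1) ≤ ((1 / 2) ^ lg n) ^ 6 := by
    calc η ^ (lg n / blockSize A n + 1)
        ≤ (((1 / 2 : ℝ) ^ blockSize A n) ^ 6) ^ (lg n / blockSize A n + 1) := by gcongr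
      _ = ((1 / 2) ^ (blockSize A n * (lg n / blockSize A n + 1))) ^ 6 := by
        rw [← pow_mul, ← pow_mul, ← pow_mul]
        congr 1
        ring
      _ ≤ ((1 / 2) ^ lg n) ^ 6 := by
        refine pow_le_pow_left₀ (by positivity) ?_ 6
        exact pow_le_pow_of_le_one (by norm_num) (by norm_num) h₃
  calc _ ≤ (2 : ℝ) ^ lg n * (2 ^ lg n * ((1 / 2) ^ lg n) ^ 6) := by gcongr
    _ = ((1 / 2) ^ lg n) ^ 4 := by
      have : (2 : ℝ) ^ lg n * (1 / 2) ^ lg n = 1 := by rw [← mul_pow]; norm_num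
      generalize (2 : ℝ) ^ lg n = x at *
      generalize (1 / 2 : ℝ) ^ lg n = y at *
      calc x * (x * y ^ 6) = (x * y) * (x * y) * y ^ 4 := by ring
        _ = y ^ 4 := by rw [this]; ring

variable [Nonempty A]

section Length

variable {h : ℝ} {n : ℕ}

theorem card_sectionIndex_typical_le (hh : 0 ≤ h) {e : Fin (layout A h n).sections}
    (he : (e : ℕ) < sectionCount A n) :
    (Fintype.card ((layout A h n).SectionIndex ((layout A h n).coder e)) : ℝ) ≤
      lg n * blockSize A n * (blockSize A n * h + lg (blockSize A n) *
        (Fintype.card A + 2 * Nat.clog 2 (Fintype.card A) + 3 : ℕ)) := by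
  have hw : (((layout A h n).coder e).width : ℝ) ≤
      lg (blockSize A n) * Fintype.card A + blockSize A n * h + 1 := by
    refine le_trans (le_of_eq ?_) (clog_card_typicalSet_le hh)
    simp only [layout, if_pos he]
    rfl
  rw [card_sectionIndex_layout]
  have h₁ : (lg (lg n) : ℝ) ≤ blockSize A n := by exact_mod_cast lg_lg_le_blockSize A n
  have h₃ : (rawWidth A n : ℝ) ≤ blockSize A n * Nat.clog 2 (Fintype.card A) := by
    exact_mod_cast rawWidth_le A n
  have h₅ : ((lg n / blockSize A n : ℕ) : ℝ) * blockSize A n ≤ lg n := by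
    exact_mod_cast Nat.div_mul_le_self (lg n) (blockSize A n)
  have h₆ : (1 : ℝ) ≤ lg (blockSize A n) := by exact_mod_cast lg_pos _
  push_cast
  generalize ((lg n / blockSize A n : ℕ) : ℝ) = k at *
  generalize (((layout A h n).coder e).width : ℝ) = t at *
  generalize (blockSize A n : ℝ) = b at *
  generalize hc : (Nat.clog 2 (Fintype.card A) : ℝ) = c at *
  have hc0 : 0 ≤ c := hc ▸ Nat.cast_nonneg _
  have hb0 : 0 ≤ b := (Nat.cast_nonneg _).trans h₁
  have hN : (0 : ℝ) ≤ lg n := Nat.cast_nonneg _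
  calc _ ≤ lg n * b + (lg n * (b * lg (blockSize A n) + (b * (lg (blockSize A n) *
          Fintype.card A + b * h + 1) + lg (blockSize A n) * (b * c))) + lg n * (b * c)) := by
        rw [← mul_assoc k]
        gcongr
    _ = lg n * b * (b * h + lg (blockSize A n) * (Fintype.card A + c + 1) + 1 * (c + 2)) := by
      ring
    _ ≤ lg n * b * (b * h + lg (blockSize A n) * (Fintype.card A + c + 1) +
          lg (blockSize A n) * (c + 2)) := by gcongr
    _ = _ := by ring

theorem len_layout_le {h ε : ℝ} (hh : 0 ≤ h) (hε : 0 < ε) :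
    ∀ᶠ n in atTop, ((layout A h n).len : ℝ) ≤ n * (h + ε) := by
  set k := Fintype.card A + 2 * Nat.clog 2 (Fintype.card A) + 3
  -- `m` makes the overhead of `k * lg b` bits per block at most `b * ε / 2`; `m'` does the same for
  -- the raw last section against `n * ε / 2`.
  obtain ⟨m, hm⟩ := exists_nat_ge (2 * k / ε)
  obtain ⟨m', hm'⟩ := exists_nat_ge (2 * (bitFactor A : ℝ) / ε)
  rw [div_le_iff₀ hε] at hm hm'
  filter_upwards [(tendsto_blockSize A).eventually (eventually_mul_lg_pow_le m 1),
    eventually_mul_blockSize_pow_le A 1 2, eventually_mul_lg_pow_le m' 2] with n h₁ h₂ h₃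
  have hlen : (layout A h n).len = ∑ e : Fin (sectionCount A n + 1),
      Fintype.card ((layout A h n).SectionIndex ((layout A h n).coder e)) := Fintype.card_sigma
  rw [hlen, Fin.sum_univ_castSucc]
  push_cast
  have hq : (sectionCount A n : ℝ) * (lg n * blockSize A n * blockSize A n) ≤ n := by
    exact_mod_cast Nat.div_mul_le_self n (lg n * blockSize A n * blockSize A n)
  have hmain : ∀ e : Fin (sectionCount A n),
      (Fintype.card ((layout A h n).SectionIndex ((layout A h n).coder e.castSucc)) : ℝ) ≤
        lg n * blockSize A n * blockSize A n * (h + ε / 2) := by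
    intro e
    refine (card_sectionIndex_typical_le (e := e.castSucc) hh e.2).trans ?_
    have h₄ : (m : ℝ) * lg (blockSize A n) ≤ blockSize A n := by
      rw [pow_one] at h₁
      exact_mod_cast h₁
    have h₅ : (lg (blockSize A n) : ℝ) * k ≤ blockSize A n * (ε / 2) := by
      nlinarith [Nat.cast_nonneg (α := ℝ) (lg (blockSize A n))]
    calc _ ≤ (lg n : ℝ) * blockSize A n * (blockSize A n * h + blockSize A n * (ε / 2)) := by
          gcongr
      _ = _ := by ring
  have htail : (Fintype.card ((layout A h n).SectionIndex ((layout A h n).coder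
      (Fin.last (sectionCount A n)))) : ℝ) ≤ n * (ε / 2) := by
    have h₄ : (Fintype.card ((layout A h n).SectionIndex ((layout A h n).coder
        (Fin.last (sectionCount A n)))) : ℝ) ≤
        lg n * blockSize A n * blockSize A n * bitFactor A := by
      exact_mod_cast card_sectionIndex_layout_le (h := h) (Fin.last (sectionCount A n))
    have h₅ : (lg n : ℝ) * blockSize A n * blockSize A n ≤ lg n ^ 2 := by
      rw [one_mul] at h₂
      have h₆ : (blockSize A n : ℝ) ^ 2 ≤ lg n := by exact_mod_cast h₂
      nlinarith [Nat.cast_nonneg (α := ℝ) (lg n)]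
    have h₆ : (m' : ℝ) * lg n ^ 2 ≤ n := by exact_mod_cast h₃
    calc _ ≤ (lg n : ℝ) ^ 2 * bitFactor A := h₄.trans (by gcongr)
      _ ≤ (lg n : ℝ) ^ 2 * (m' * (ε / 2)) := by
        gcongr
        linarith
      _ = m' * lg n ^ 2 * (ε / 2) := by ring
      _ ≤ _ := by gcongr
  calc _ ≤ ∑ _e : Fin (sectionCount A n), (lg n : ℝ) * blockSize A n * blockSize A n *
          (h + ε / 2) + n * (ε / 2) := add_le_add (Finset.sum_le_sum fun e _ => hmain e) htail
    _ = sectionCount A n * (lg n * blockSize A n * blockSize A n) * (h + ε / 2) + n * (ε / 2) := by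
      rw [Finset.sum_const, Finset.card_univ, Fintype.card_fin, nsmul_eq_mul]
      ring
    _ ≤ n * (h + ε / 2) + n * (ε / 2) := by gcongr
    _ = n * (h + ε) := by ring

end Length

theorem reliable_layout {p : A → ℝ} {h θ : ℝ} {n : ℕ}
    (hθ : prob p (fun z : Fin (blockSize A n) → A => z ∉ typicalSet A (blockSize A n) h) ≤
      θ ^ blockSize A n) : (layout A h n).Reliable p (θ ^ blockSize A n) := by
  intro e
  by_cases he : (e : ℕ) < sectionCount A n
  · refine Or.inr ⟨fun c j o => ?_, ?_⟩
    · have hc : (c : ℕ) < lg n := c.2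
      have hj : (j : ℕ) < blockSize A n := j.2
      have ho : (o : ℕ) < blockSize A n := o.2
      have h₁ : sectionCount A n * (lg n * blockSize A n * blockSize A n) ≤ n :=
        Nat.div_mul_le_self _ _
      change ((e * lg n + c) * blockSize A n + j) * blockSize A n + o < n
      have lt_of_digits : ∀ {x y m r : ℕ}, x < y → r < m → x * m + r < y * m :=
        fun {x y m r} hx hr => by
          calc x * m + r < x * m + m := by omega
            _ = (x + 1) * m := by ring
            _ ≤ y * m := Nat.mul_le_mul_right _ hx
      refine (lt_of_digits (lt_of_digits (lt_of_digits he hc) hj) ho).trans_le ?_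
      rwa [mul_assoc, mul_assoc, ← mul_assoc (lg n)]
    · refine le_trans (le_of_eq ?_) hθ
      simp only [layout, if_pos he]
      rfl
  · refine Or.inl fun z => ?_
    simp only [layout, if_neg he]
    exact Finset.mem_univ z

section Probability

variable {p : A → ℝ} {h : ℝ}

/-- Atypical blocks and groups, and sections that cannot be encoded, are rare. -/
theorem exists_failure_bounds (hp : p ∈ stdSimplex ℝ A) (hh : entropy p < h) :
    ∃ θ : ℝ, 0 ≤ θ ∧ θ < 1 ∧ ∀ᶠ n in atTop,
      (layout A h n).Reliable p (θ ^ blockSize A n) ∧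
      2 ^ (layout A h n).blocks * (θ ^ blockSize A n) ^ ((layout A h n).spare₁ + 1) ≤
        ((1 / 2 : ℝ) ^ blockSize A n) ^ 6 ∧
      (layout A h n).sections * (2 ^ (layout A h n).groups *
        (2 ^ (layout A h n).blocks * (θ ^ blockSize A n) ^ ((layout A h n).spare₁ + 1)) ^
          ((layout A h n).spare₂ + 1)) ≤ ((1 / 2 : ℝ) ^ lg n) ^ 4 := by
  obtain ⟨θ, h0, h1, hθ⟩ := exists_prob_not_typical_le hp hh
  refine ⟨θ, h0, h1, ?_⟩
  -- The exponent `lg b + 1` tends to infinity; the value `2 ^ (-7)` leaves `2 ^ (-6 b)` after the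
  -- factor `2 ^ b`.
  have hw := ((tendsto_pow_atTop_nhds_zero_of_lt_one h0 h1).comp
    ((tendsto_add_atTop_nat 1).comp (tendsto_lg.comp (tendsto_blockSize A)))).eventually_le_const
      (show (0 : ℝ) < (1 / 2) ^ 7 by norm_num)
  filter_upwards [hw] with n hn
  have h₂ := two_pow_mul_pow_le h0 (blockSize A n) hn
  exact ⟨reliable_layout (hθ _), h₂, sections_mul_le (by positivity) h₂⟩

theorem tendsto_errorProb_layout (hp : p ∈ stdSimplex ℝ A) (hh : entropy p < h) :
    Tendsto (fun n => errorProb p (layout A h n).scheme) atTop (𝓝 0) := by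
  obtain ⟨θ, h0, h1, hθ⟩ := exists_failure_bounds hp hh
  have hlim : Tendsto (fun n => ((1 / 2 : ℝ) ^ lg n) ^ 4) atTop (𝓝 0) := by
    have := ((tendsto_pow_atTop_nhds_zero_of_lt_one (by norm_num : (0 : ℝ) ≤ 1 / 2)
      (by norm_num)).comp tendsto_lg).pow 4
    simpa using this
  refine tendsto_of_tendsto_of_tendsto_of_le_of_le' tendsto_const_nhds hlim
    (Eventually.of_forall fun n => ?_) ?_
  · rw [errorProb_eq_prob]
    exact prob_nonneg hp _
  · filter_upwards [hθ] with n hn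
    exact ((layout A h n).errorProb_scheme_le hp (by positivity) hn.1).trans hn.2.2

end Probability

end Guarantees

/-! ### Average cost of updates -/

section Average

variable {A : Type*} [Fintype A] [Nonempty A]

theorem div_add_two_mul_le {s z m : ℕ} (c : ℕ) (hm : m ≤ z * c) :
    (s / z + 2) * m ≤ c * (s + 2 * z) := by
  calc (s / z + 2) * m ≤ (s / z + 2) * (z * c) := Nat.mul_le_mul_left _ hm
    _ = c * (s / z * z + 2 * z) := by ring
    _ ≤ c * (s + 2 * z) := by gcongr; exact Nat.div_mul_le_self s z

/-- A rare repair contributes little to the average: it is rare for short fragments, and it is not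
more expensive than the fragment for long ones. -/
theorem min_one_mul_le {s z : ℕ} {c x P : ℝ} (hc : 0 ≤ c) (hx0 : 0 ≤ x)
    (hx : x ≤ c * (s + 2 * z)) (hP : s < z → 3 * z * P ≤ 1) :
    min 1 P * x ≤ c * (3 * s + 1) := by
  rcases le_or_gt z s with h | h
  · have h' : (z : ℝ) ≤ s := by exact_mod_cast h
    calc min 1 P * x ≤ 1 * x := by gcongr; exact min_le_left _ _
      _ ≤ c * (s + 2 * z) := by rwa [one_mul]
      _ ≤ c * (3 * s + 1) := mul_le_mul_of_nonneg_left (by linarith) hc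
  · have h' : (s : ℝ) ≤ z := by exact_mod_cast h.le
    have h₁ := hP h
    rcases le_or_gt 0 P with h₀ | h₀
    · calc min 1 P * x ≤ P * (c * (s + 2 * z)) := by gcongr; exact min_le_right _ _
        _ ≤ P * (c * (z + 2 * z)) := by gcongr
        _ = c * (3 * z * P) := by ring
        _ ≤ c * (3 * s + 1) := by gcongr; linarith [Nat.cast_nonneg (α := ℝ) s]
    · calc min 1 P * x ≤ 0 := mul_nonpos_of_nonpos_of_nonneg ((min_le_right _ _).trans h₀.le) hx0
        _ ≤ c * (3 * s + 1) := by positivity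

/-- The blocks contribute `s + 2 b`, and each of the two repair stages contributes `3 s + 1` by
`min_one_mul_le`. -/
theorem average_layout_le {p : A → ℝ} (hp : p ∈ stdSimplex ℝ A) {h : ℝ} (hh : entropy p < h) :
    ∀ᶠ n in atTop, ∀ s ≤ n, (layout A h n).updater.average p s ≤
      2 * bitFactor A * (7 * s + 2 * blockSize A n + 2) := by
  obtain ⟨θ, h0, h1, hθ⟩ := exists_failure_bounds hp hh
  have hb := tendsto_blockSize A
  -- The constants `36` and `30` cover what the repairs require below: `18 b³ δ + 9 b² u` for groups
  -- and `21 b² u` for sections, with `u = 2 ^ (-b)`.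
  have e₀ := hb.eventually (eventually_mul_pow_mul_pow_le h0 h1 36 3)
  have e₁ := hb.eventually (eventually_mul_pow_mul_pow_le (θ := 1 / 2) (by norm_num)
    (by norm_num) 30 2)
  filter_upwards [hθ, e₀, e₁, eventually_mul_blockSize_pow_le A 1 1] with n hn h₀ h₁ hbN s hs
  set L := layout A h n
  set δ := θ ^ blockSize A n
  have hδ0 : 0 ≤ δ := pow_nonneg h0 _
  have hu0 : (0 : ℝ) ≤ (1 / 2) ^ blockSize A n := by positivity
  set b := blockSize A n
  have hb0 : 0 < b := blockSize_pos A n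
  have p₀ : ∀ i, (L.probes₀ i s).card ≤ bitFactor A * (s + 2 * b) := fun i =>
    (L.card_probes₀_le coder_width_layout_le i s).trans
      (div_add_two_mul_le _ (probe_width_le A n))
  have p₁ : ∀ i, (L.probes₁ i s).card ≤ bitFactor A * (s + 2 * (b * b)) := fun i =>
    (L.card_probes₁_le (fun e => (Nat.le_sub_of_add_le' (card_groupIndex_layout_le e))) i s).trans
      (div_add_two_mul_le _ (Nat.add_sub_cancel' ((Nat.le_add_right _ _).trans
        (card_groupIndex_layout_le (h := h) (Fin.last (sectionCount A n))))).le)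
  have p₂ : ∀ i, (L.probes₂ i s).card ≤ bitFactor A * (s + 2 * (b * b * lg n)) := fun i =>
    (L.card_probes₂_le card_sectionIndex_layout_le i s).trans
      (div_add_two_mul_le _ (le_of_eq (by change _ = b * b * lg n * _; ring)))
  have t₀ : ∀ i, (L.touchedBlocks i s).card ≤ s / b + 2 := fun i => L.card_touchedBlocks_le i s
  have t₁ : ∀ i, (L.touchedGroups i s).card ≤ s / (b * b) + 2 := fun i =>
    L.card_touchedGroups_le i s
  have havg := L.average_updater_le hp (L.prob_not_typical_le hp hδ0 hn.1)
    (fun e c => (L.prob_badGroup_le hp hδ0 hn.1 e c).trans hn.2.1)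
    ((L.prob_not_ok_le hp hδ0 hn.1).trans hn.2.2) hδ0 (by positivity) hs p₀ p₁ p₂ t₀ t₁
  set u : ℝ := (1 / 2) ^ b
  have hu1 : u ≤ 1 := pow_le_one₀ (by norm_num) (by norm_num)
  have hb1 : (1 : ℝ) ≤ b := by exact_mod_cast hb0
  have hπ : ((1 / 2 : ℝ) ^ lg n) ^ 4 ≤ u ^ 4 := by
    refine pow_le_pow_left₀ (by positivity) ?_ 4
    refine pow_le_pow_of_le_one (by norm_num) (by norm_num) ?_
    simpa using hbN
  have hN1 : (1 : ℝ) ≤ lg n := by exact_mod_cast lg_pos n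
  -- As `lg n ≤ 2 ^ b`, the probability of an exceptional group outweighs the factor `lg n` in the
  -- cost of rewriting a section.
  have hNu : (lg n : ℝ) * u ≤ 1 := by
    have : (lg n : ℝ) ≤ 2 ^ b := by exact_mod_cast lg_le_two_pow_blockSize A n
    calc (lg n : ℝ) * u ≤ 2 ^ b * u := by gcongr
      _ = 1 := by rw [← mul_pow]; norm_num
  have hpow : ∀ k, u ^ (k + 1) ≤ u := fun k => by
    rw [pow_succ]
    exact mul_le_of_le_one_left hu0 (pow_le_one₀ hu0 hu1)
  have q₁ := min_one_mul_le (s := s) (z := b * b) (c := bitFactor A)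
    (x := ((bitFactor A * (s + 2 * (b * b)) : ℕ) : ℝ))
    (P := ((1 / 2 : ℝ) ^ lg n) ^ 4 + (s / (b * b) + 2 : ℕ) * u ^ 6 + 2 * (s / b + 2 : ℕ) * δ)
    (Nat.cast_nonneg _) (Nat.cast_nonneg _) (by push_cast; rfl) fun hsz => by
      have d₁ : ((s / (b * b) + 2 : ℕ) : ℝ) = 2 := by rw [Nat.div_eq_of_lt hsz]; norm_num
      have d₀ : ((s / b + 2 : ℕ) : ℝ) ≤ 3 * b := by
        have : s / b < b := (Nat.div_lt_iff_lt_mul hb0).2 hsz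
        exact_mod_cast (by omega : s / b + 2 ≤ 3 * b)
      rw [d₁]
      simp only [Nat.cast_mul]
      calc 3 * ((b : ℝ) * b) * (((1 / 2 : ℝ) ^ lg n) ^ 4 + 2 * u ^ 6 + 2 * (s / b + 2 : ℕ) * δ)
          ≤ 3 * ((b : ℝ) * b) * (u + 2 * u + 2 * (3 * b) * δ) := by
            gcongr
            · exact hπ.trans (hpow 3)
            · exact hpow 5
        _ = (3 / 10) * (30 * (b : ℝ) ^ 2 * u) + (1 / 2) * (36 * (b : ℝ) ^ 3 * δ) := by ring
        _ ≤ 1 := by linarith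
  have q₂ := min_one_mul_le (s := s) (z := b * b * lg n) (c := bitFactor A)
    (x := ((bitFactor A * (s + 2 * (b * b * lg n)) : ℕ) : ℝ))
    (P := ((1 / 2 : ℝ) ^ lg n) ^ 4 + 2 * (s / (b * b) + 2 : ℕ) * u ^ 6)
    (Nat.cast_nonneg _) (Nat.cast_nonneg _) (by push_cast; rfl) fun hsz => by
      have d₁ : ((s / (b * b) + 2 : ℕ) : ℝ) ≤ 3 * lg n := by
        have h₂ : s / (b * b) < lg n := by
          rw [Nat.div_lt_iff_lt_mul (by positivity), mul_comm]
          exact hsz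
        have := lg_pos n
        exact_mod_cast (by omega : s / (b * b) + 2 ≤ 3 * lg n)
      simp only [Nat.cast_mul]
      calc 3 * ((b : ℝ) * b * lg n) * (((1 / 2 : ℝ) ^ lg n) ^ 4 + 2 * (s / (b * b) + 2 : ℕ) * u ^ 6)
          ≤ 3 * ((b : ℝ) * b * lg n) * (u ^ 4 + 2 * (3 * lg n) * u ^ 6) := by gcongr
        _ = 3 * (b : ℝ) ^ 2 * ((lg n * u) * u ^ 3 + 6 * ((lg n * u) * (lg n * u)) * u ^ 4) := by
          ring
        _ ≤ 3 * (b : ℝ) ^ 2 * (1 * u + 6 * (1 * 1) * u) := by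
          gcongr
          · exact hpow 2
          · exact hpow 3
        _ = (7 / 10) * (30 * (b : ℝ) ^ 2 * u) := by ring
        _ ≤ 1 := by linarith
  push_cast at havg q₁ q₂ ⊢
  linarith

end Average

/-! ### Fragments against single symbols -/

section Locality

variable {A : Type*} [Fintype A]

variable (A) in
theorem blockSize_le {n : ℕ} (hn : 16 ≤ n) :
    (blockSize A n : ℝ) ≤ 2 * blockFactor A * loglog n := by
  rw [blockSize, Nat.cast_mul]
  calc (blockFactor A : ℝ) * lg (lg n) ≤ blockFactor A * (2 * loglog n) := by
        gcongr; exact lg_lg_le hn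
    _ = _ := by ring

variable [Nonempty A]

theorem worstCase_layout_le_mul (h : ℝ) (n s : ℕ) :
    (layout A h n).decoder.worstCase s ≤ bitFactor A * (s + 2 * blockSize A n) :=
  (worstCase_layout_le s).trans (div_add_two_mul_le _ (probe_width_le A n))

variable (A) in
/-- Long fragments are cheaper than symbols read one by one with `lg (card A)` probes each. -/
theorem exists_worstCase_layout_lt : ∃ α : ℝ, 0 < α ∧ ∀ h : ℝ, ∀ᶠ n in atTop, ∀ s : ℕ,
    α * loglog n ≤ s → (layout A h n).decoder.worstCase s < s * lg (Fintype.card A) := by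
  have hlt := logb_card_lt A
  set M : ℝ := ((lg (Fintype.card A) : ℕ) : ℝ) with hM
  set l : ℝ := Real.logb 2 (Fintype.card A)
  have hl0 : 0 ≤ l := Real.logb_nonneg (by norm_num) (by exact_mod_cast Fintype.card_pos)
  have hgap : 0 < M - l := sub_pos.2 hlt
  set K := blockFactor A with hK
  have hKgap : 4 / (M - l) < K := by
    rw [hK, blockFactor]
    push_cast
    exact (Nat.le_ceil _).trans_lt (lt_add_one _)
  have hK0 : (0 : ℝ) < K := by exact_mod_cast blockFactor_pos A
  -- Since `b ≤ 2 * K * loglog n`, this makes `4 * M * b < s * (M - l)`, the margin that pays for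
  -- the two additional blocks read.
  refine ⟨8 * K * M / (M - l) + 1, by positivity, fun h => ?_⟩
  have hw := (tendsto_lg.comp tendsto_lg).eventually (eventually_mul_lg_pow_le 2 1)
  filter_upwards [eventually_ge_atTop 16, hw,
    (tendsto_lg.comp tendsto_lg).eventually_ge_atTop (2 * (lg K + 1))] with n hn h₁ h₂ s hs
  have hb := blockSize_le A hn
  have hwc := worstCase_layout_le (A := A) (h := h) (n := n) s
  have hρ := rawWidth_le_mul_logb A n
  have hb0 : (0 : ℝ) < blockSize A n := by exact_mod_cast blockSize_pos A n
  have hll : 0 < loglog n := by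
    by_contra hcon
    have : 2 * (K : ℝ) * loglog n ≤ 0 := mul_nonpos_of_nonneg_of_nonpos (by positivity)
      (not_lt.1 hcon)
    linarith
  have hM0 : 0 < M := hl0.trans_lt hlt
  -- `lg b` is of the order of `log log log n`, so the inner pointer and the rounding of the raw
  -- width together cost no more than the outer pointer.
  have hw : lg (blockSize A n) + 1 ≤ lg (lg n) := by
    have h₃ : lg (blockSize A n) ≤ lg K + lg (lg (lg n)) := by
      refine Nat.log_lt_of_lt_pow (blockSize_pos A n).ne' ?_
      rw [pow_add]
      exact Nat.mul_lt_mul'' (lt_two_pow_lg _) (lt_two_pow_lg _)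
    simp only [Function.comp_apply, pow_one] at h₁ h₂
    omega
  have hw' : (lg (blockSize A n) : ℝ) + 1 ≤ lg (lg n) := by exact_mod_cast hw
  have hν : (blockSize A n : ℝ) = K * lg (lg n) := by rw [blockSize, Nat.cast_mul]
  have hdiv : ((s / blockSize A n : ℕ) : ℝ) * blockSize A n ≤ s := by
    exact_mod_cast Nat.div_mul_le_self s (blockSize A n)
  have hK2 : 2 * (2 / (K : ℝ)) < M - l := by
    rw [div_lt_iff₀ hgap] at hKgap
    rw [← mul_div_assoc, div_lt_iff₀ hK0]
    linarith
  have hs' : 4 * M * blockSize A n < s * (M - l) := by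
    have h₄ : 8 * K * M / (M - l) * loglog n < s := by linarith
    rw [div_mul_eq_mul_div, div_lt_iff₀ hgap] at h₄
    nlinarith
  have hfin : (((layout A h n).decoder.worstCase s : ℕ) : ℝ) < s * M := by
    calc (((layout A h n).decoder.worstCase s : ℕ) : ℝ)
        ≤ ((s / blockSize A n : ℕ) + 2) * (lg (lg n) + lg (blockSize A n) + rawWidth A n) := by
          exact_mod_cast hwc
      _ ≤ ((s / blockSize A n : ℕ) + 2) * (blockSize A n * (l + 2 / K)) := by
          gcongr
          have : (blockSize A n : ℝ) * (2 / K) = 2 * lg (lg n) := by rw [hν]; field_simp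
          rw [mul_add, this]
          linarith
      _ = ((s / blockSize A n : ℕ) * blockSize A n + 2 * blockSize A n) * (l + 2 / K) := by ring
      _ ≤ (s + 2 * blockSize A n) * (l + (M - l) / 2) := by
          exact mul_le_mul (by linarith) (by linarith) (by positivity) (by positivity)
      _ < s * M := by nlinarith
  rw [hM] at hfin
  exact_mod_cast hfin

end Locality

/-! ### Polynomial complexity -/

section Complexity

theorem EncodesWithin.mono {A : Type*} {n ℓ m m' : ℕ} {S : CompressionScheme A n ℓ}
    (h : EncodesWithin S m) (hm : m ≤ m') : EncodesWithin S m' :=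
  h.imp fun _ hk => ⟨hk.1.trans hm, hk.2⟩

theorem DecodesWithin.mono {A : Type*} {n ℓ m m' : ℕ} {S : CompressionScheme A n ℓ}
    (h : DecodesWithin S m) (hm : m ≤ m') : DecodesWithin S m' :=
  h.imp fun _ hk => ⟨hk.1.trans hm, hk.2⟩

variable {A : Type*} [Fintype A]

theorem exists_encodesWithin {n ℓ : ℕ} (S : CompressionScheme A n ℓ) : ∃ m, EncodesWithin S m :=
  Computes.exists_of_dependsOn fun x y hxy => by
    have : x = y := funext fun i => by
      have := congrFun hxy (i, x i)
      simpa [messageBits, eq_comm] using this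
    rw [this]

theorem exists_decodesWithin {n ℓ : ℕ} (S : CompressionScheme A n ℓ) : ∃ m, DecodesWithin S m :=
  Computes.exists_of_dependsOn fun _ _ hxy => congrArg (fun c => messageBits (S.dec c)) hxy

/-- The additive constant absorbs the finitely many small lengths. All larger `c'` are included so
that encoder and decoder can share one constant. -/
theorem exists_pow_add_of_eventually {Q : ℕ → ℕ → Prop} {k : ℕ}
    (hmono : ∀ n m m', Q n m → m ≤ m' → Q n m') (hex : ∀ n, ∃ m, Q n m)
    (h : ∀ᶠ n in atTop, Q n (n ^ k)) : ∃ c, ∀ c' ≥ c, ∀ n, Q n (n ^ c' + c') := by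
  choose f hf using hex
  obtain ⟨N, hN⟩ := eventually_atTop.1 h
  refine ⟨k + ∑ n ∈ Finset.range (N + 1), f n, fun c hc n => ?_⟩
  rcases le_or_gt n N with hn | hn
  · refine hmono _ _ _ (hf n) ?_
    have := Finset.single_le_sum (f := f) (fun _ _ => Nat.zero_le _)
      (Finset.mem_range.2 (Nat.lt_succ_of_le hn))
    exact Nat.le_add_left_of_le (this.trans ((Nat.le_add_left _ _).trans hc))
  · refine hmono _ _ _ (hN n hn.le) ((Nat.pow_le_pow_right (by omega) ?_).trans
      (Nat.le_add_right _ _))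
    omega

variable [Nonempty A]

/-- Every exponent is at most `2 * lg n`, so all counts are polynomial in `T = 2 ^ lg n ≤ 2 * n`.
The total is at most `12 * T ^ 5 ≤ 384 * n ^ 5`. -/
theorem encodesWithin_layout (h : ℝ) :
    ∀ᶠ n in atTop, EncodesWithin (layout A h n).scheme (n ^ 6) := by
  set a := Fintype.card A
  filter_upwards [eventually_mul_blockSize_pow_le A (a + 2 * bitFactor A + 2) 2,
    eventually_ge_atTop 384] with n hb hn
  refine (layout A h n).encodesWithin.mono ?_
  have hT : 2 ^ lg n ≤ 2 * n := two_pow_lg_le (by omega)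
  have hNT : lg n ≤ 2 ^ lg n := Nat.lt_two_pow_self.le
  have hb0 := blockSize_pos A n
  have hρ : rawWidth A n ≤ blockSize A n * bitFactor A :=
    (Nat.le_add_left _ _).trans (probe_width_le A n)
  have hq : sectionCount A n + 1 ≤ 2 ^ lg n :=
    (Nat.succ_le_succ (Nat.div_le_self _ _)).trans (lt_two_pow_lg n)
  have c₁ := (layout A h n).card_blockWire_le raw_width_layout.le coder_width_layout_le
  have c₂ := (layout A h n).card_groupWire_le raw_width_layout.le
    fun e => (Nat.le_add_left _ _).trans (card_groupIndex_layout_le e)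
  have c₃ : Fintype.card (layout A h n).Index ≤
      (sectionCount A n + 1) * (lg n * blockSize A n * blockSize A n * bitFactor A) := by
    rw [Fintype.card_sigma]
    refine (Finset.sum_le_sum fun e _ => card_sectionIndex_layout_le e).trans (le_of_eq ?_)
    rw [Finset.sum_const, smul_eq_mul, Finset.card_univ, Fintype.card_fin]
    rfl
  change _ ≤ (sectionCount A n + 1) * (lg n * (blockSize A n * _)) at c₁
  change _ ≤ (sectionCount A n + 1) * (lg n * (1 + (_ + blockSize A n * _))) at c₂
  change _ * (4 * 2 ^ (blockSize A n * a)) + _ * (4 * 2 ^ (2 * blockSize A n)) +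
    _ * (4 * 2 ^ (2 * lg n)) ≤ _
  generalize bitFactor A = E at *
  generalize rawWidth A n = ρ at *
  generalize blockSize A n = b at *
  generalize sectionCount A n = q at *
  have e₁ : b * a ≤ lg n := by nlinarith
  have e₂ : 2 * b ≤ lg n := by nlinarith
  have e₃ : 1 + (ρ + ρ) ≤ lg n := by nlinarith
  have e₄ : 1 + (b * b * E + b * ρ) ≤ lg n := by nlinarith
  have e₅ : b * b * E ≤ lg n := by nlinarith
  have g₁ : 2 ^ (b * a) ≤ 2 ^ lg n := Nat.pow_le_pow_right (by norm_num) e₁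
  have g₂ : 2 ^ (2 * b) ≤ 2 ^ lg n := Nat.pow_le_pow_right (by norm_num) e₂
  have g₃ : 2 ^ (2 * lg n) = 2 ^ lg n * 2 ^ lg n := by rw [two_mul, pow_add]
  have e₆ : b ≤ lg n := by omega
  rw [g₃]
  generalize 2 ^ lg n = T at *
  have k₁ := c₁.trans (Nat.mul_le_mul hq (Nat.mul_le_mul hNT
    (Nat.mul_le_mul (e₆.trans hNT) (e₃.trans hNT))))
  have k₂ := c₂.trans (Nat.mul_le_mul hq (Nat.mul_le_mul hNT (e₄.trans hNT)))
  have k₃ : Fintype.card (layout A h n).Index ≤ T * (T * T) := by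
    refine c₃.trans (Nat.mul_le_mul hq ?_)
    rw [mul_assoc, mul_assoc, ← mul_assoc b]
    exact Nat.mul_le_mul hNT (e₅.trans hNT)
  have hT0 : 1 ≤ T := by omega
  calc _ ≤ T * (T * (T * T)) * (4 * T) + T * (T * T) * (4 * T) + T * (T * T) * (4 * (T * T)) := by
        gcongr
    _ ≤ 12 * T ^ 5 := by nlinarith [Nat.mul_le_mul_left (T ^ 4) hT0]
    _ ≤ 12 * (2 * n) ^ 5 := by gcongr
    _ = 384 * n ^ 5 := by ring
    _ ≤ n * n ^ 5 := by gcongr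
    _ = n ^ 6 := by ring

theorem decodesWithin_layout (h : ℝ) :
    ∀ᶠ n in atTop, DecodesWithin (layout A h n).scheme (n ^ 6) := by
  filter_upwards [eventually_mul_blockSize_pow_le A (bitFactor A) 1, eventually_ge_atTop 2,
    eventually_ge_atTop (Fintype.card A)] with n hb hn ha
  refine ((layout A h n).decodesWithin raw_width_layout.le coder_width_layout_le).mono ?_
  change n * Fintype.card A * (4 * 2 ^ (lg (lg n) + lg (blockSize A n) + rawWidth A n)) ≤ _
  have e : lg (lg n) + lg (blockSize A n) + rawWidth A n ≤ lg n :=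
    (probe_width_le A n).trans (by rwa [pow_one, mul_comm] at hb)
  have g := Nat.pow_le_pow_right (n := 2) (by norm_num) e
  have hT : 2 ^ lg n ≤ 2 * n := two_pow_lg_le (by omega)
  calc _ ≤ n * n * (4 * (2 * n)) := by gcongr; exact g.trans hT
    _ = 2 ^ 3 * n ^ 3 := by ring
    _ ≤ n ^ 3 * n ^ 3 := by gcongr
    _ = n ^ 6 := by ring

end Complexity

/-! ### The final code and the theorem -/

section Code

variable {A : Type*} [Fintype A] [Nonempty A]

variable (A) in
/-- A code with empty codewords. -/
def emptyCode (n : ℕ) : LocalCode A n where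
  len := 0
  scheme := ⟨fun _ => Fin.elim0, fun _ _ => Classical.arbitrary A⟩
  decoder := ⟨fun _ _ => DecisionTree.leaf fun _ => Classical.arbitrary A, fun i s hs x hx =>
    funext fun k => congrFun hx ⟨i + k, by omega⟩⟩
  updater := ⟨fun _ _ _ => DecisionTree.leaf fun _ => none, fun _ _ _ _ _ _ =>
    funext fun j => j.elim0⟩

open Classical in
variable (A) in
/-- The code with a given target rate. -/
def twoLevelCode (ε R : ℝ) (n : ℕ) : LocalCode A n :=
  -- Half of `ε` separates `h` from the entropy and half pays for the overhead. At lengths where the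
  -- overhead is still too large the empty code keeps the rate bound valid.
  if ((layout A (R - ε / 2) n).len : ℝ) ≤ n * R then
    ⟨_, (layout A (R - ε / 2) n).scheme, (layout A (R - ε / 2) n).decoder,
      (layout A (R - ε / 2) n).updater⟩
  else emptyCode A n

theorem len_twoLevelCode_le {ε R : ℝ} (hR : 0 ≤ R) (n : ℕ) :
    ((twoLevelCode A ε R n).len : ℝ) ≤ n * R := by
  unfold twoLevelCode
  split_ifs with h
  · exact h
  · simp only [emptyCode, Nat.cast_zero]
    positivity

theorem eventually_twoLevelCode_eq {p : A → ℝ} (hp : p ∈ stdSimplex ℝ A) {ε : ℝ} (hε : 0 < ε) :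
    ∀ᶠ n in atTop, twoLevelCode A ε (entropy p + ε) n =
      ⟨_, (layout A (entropy p + ε / 2) n).scheme, (layout A (entropy p + ε / 2) n).decoder,
        (layout A (entropy p + ε / 2) n).updater⟩ := by
  have h₀ := entropy_nonneg hp
  filter_upwards [len_layout_le (A := A) (h := entropy p + ε / 2) (ε := ε / 2) (by linarith)
    (by linarith)] with n hn
  have e : entropy p + ε - ε / 2 = entropy p + ε / 2 := by ring
  rw [twoLevelCode, e, if_pos]
  calc _ ≤ _ := hn
    _ = _ := by ring

theorem le_mul_max {c s b t : ℝ} {k : ℝ} (hc : 0 ≤ c) (hs : 1 ≤ s) (hk : 0 ≤ k) (hb : b ≤ k * t) :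
    c * (7 * s + 2 * b + 2) ≤ c * (9 + 2 * k) * max s t := by
  have h₁ := le_max_left s t
  have h₂ : k * t ≤ k * max s t := mul_le_mul_of_nonneg_left (le_max_right s t) hk
  rw [mul_assoc]
  refine mul_le_mul_of_nonneg_left ?_ hc
  linarith

end Code

end LocalSourceCoding

end

open LocalSourceCoding
theorem corollary2 {A : Type*} [Fintype A] [Nonempty A] :
    -- the code knows `ε`, the target rate `R` and the blocklength `n`, but not the source
    ∃ code : ∀ (_ε _R : ℝ) (n : ℕ), LocalCode A n,
      -- rate-locality guarantees and complexity, for all sources on the alphabet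
      (∀ p ∈ stdSimplex ℝ A, ∃ C : ℝ, ∀ ε : ℝ, 0 < ε →
        (∀ n : ℕ, ((code ε (entropy p + ε) n).len : ℝ) ≤ n * (entropy p + ε)) ∧
        Tendsto (fun n : ℕ => errorProb p (code ε (entropy p + ε) n).scheme) atTop (𝓝 0) ∧
        (∃ N : ℕ, ∀ n ≥ N, ∀ s : ℕ, 1 ≤ s → s ≤ n →
          ((code ε (entropy p + ε) n).decoder.worstCase s : ℝ) ≤ C * max (s : ℝ) (loglog n) ∧
          (code ε (entropy p + ε) n).updater.average p s ≤ C * max (s : ℝ) (loglog n)) ∧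
        (∃ c : ℕ, ∀ n : ℕ,
          EncodesWithin (code ε (entropy p + ε) n).scheme (n ^ c + c) ∧
          DecodesWithin (code ε (entropy p + ε) n).scheme (n ^ c + c))) ∧
      -- for non-dyadic sources, fragments are cheaper than single symbols of an optimal scheme
      (∀ p ∈ stdSimplex ℝ A, (∀ a, 0 < p a) → ¬ IsDyadic p →
        ∃ α : ℝ, 0 < α ∧ ∀ ε : ℝ, 0 < ε →
          ((∃ k : ℕ, Fintype.card A = 2 ^ k) →
            entropy p + ε < Real.logb 2 (Fintype.card A)) →
          ∃ N : ℕ, ∀ n ≥ N, ∀ s : ℕ, s ≤ n → α * loglog n ≤ (s : ℝ) →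
            ((code ε (entropy p + ε) n).decoder.worstCase s : ℕ∞)
              < (s : ℕ∞) * optimalWorstCase p (entropy p + ε)) := by
  refine ⟨twoLevelCode A, fun p hp =>
    ⟨2 * bitFactor A * (9 + 2 * (2 * blockFactor A)), fun ε hε => ⟨fun n => ?_, ?_, ?_, ?_⟩⟩, ?_⟩
  · exact len_twoLevelCode_le (by linarith [entropy_nonneg hp]) n
  · refine (tendsto_errorProb_layout (h := entropy p + ε / 2) hp (by linarith)).congr' ?_
    filter_upwards [eventually_twoLevelCode_eq hp hε] with n hn
    rw [hn]
  · rw [← eventually_atTop]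
    filter_upwards [eventually_twoLevelCode_eq hp hε, eventually_ge_atTop 16,
      average_layout_le (h := entropy p + ε / 2) hp (by linarith)] with n hn hn16 havg s hs hsn
    rw [hn]
    have hs' : (1 : ℝ) ≤ s := by exact_mod_cast hs
    have hmax := le_mul_max (c := 2 * bitFactor A) (by positivity) hs'
      (by positivity : (0 : ℝ) ≤ 2 * blockFactor A) (blockSize_le A hn16)
    refine ⟨le_trans ?_ hmax, (havg s hsn).trans hmax⟩
    have hwc : (((layout A (entropy p + ε / 2) n).decoder.worstCase s : ℕ) : ℝ) ≤
        bitFactor A * (s + 2 * blockSize A n) := by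
      exact_mod_cast worstCase_layout_le_mul _ n s
    refine hwc.trans ?_
    rw [mul_comm 2 (bitFactor A : ℝ), mul_assoc]
    refine mul_le_mul_of_nonneg_left ?_ (Nat.cast_nonneg _)
    linarith [Nat.cast_nonneg (α := ℝ) (blockSize A n)]
  · have henc : ∀ᶠ n in atTop,
        EncodesWithin (twoLevelCode A ε (entropy p + ε) n).scheme (n ^ 6) := by
      filter_upwards [eventually_twoLevelCode_eq hp hε,
        encodesWithin_layout (A := A) (entropy p + ε / 2)] with n hn h
      rwa [hn]
    have hdec : ∀ᶠ n in atTop,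
        DecodesWithin (twoLevelCode A ε (entropy p + ε) n).scheme (n ^ 6) := by
      filter_upwards [eventually_twoLevelCode_eq hp hε,
        decodesWithin_layout (A := A) (entropy p + ε / 2)] with n hn h
      rwa [hn]
    obtain ⟨c, hc⟩ := exists_pow_add_of_eventually
      (Q := fun n => EncodesWithin (twoLevelCode A ε (entropy p + ε) n).scheme)
      (fun _ _ _ h => h.mono) (fun _ => exists_encodesWithin _) henc
    obtain ⟨c', hc'⟩ := exists_pow_add_of_eventually
      (Q := fun n => DecodesWithin (twoLevelCode A ε (entropy p + ε) n).scheme)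
      (fun _ _ _ h => h.mono) (fun _ => exists_decodesWithin _) hdec
    exact ⟨max c c', fun n => ⟨hc _ (le_max_left _ _) n, hc' _ (le_max_right _ _) n⟩⟩
  · intro p hp hpos _
    obtain ⟨α, hα, hlt⟩ := exists_worstCase_layout_lt A
    refine ⟨α, hα, fun ε hε hpow => ?_⟩
    rw [← eventually_atTop]
    filter_upwards [eventually_twoLevelCode_eq hp hε, hlt (entropy p + ε / 2)]
      with n hn h s _ hs
    rw [hn]
    -- If `|A|` is a power of two, the rate is below `log |A|` by assumption; otherwise the side
    -- condition of the lower bound is vacuous.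
    have hopt := le_optimalWorstCase hp hpos (R := entropy p + ε) fun k hk => by
      have := hpow ⟨k, hk⟩
      rw [hk, Nat.cast_pow, Nat.cast_ofNat, Real.logb_pow, Real.logb_self_eq_one (by norm_num),
        mul_one] at this
      exact this
    calc (((layout A (entropy p + ε / 2) n).decoder.worstCase s : ℕ) : ℕ∞)
        < ((s * lg (Fintype.card A) : ℕ) : ℕ∞) := by exact_mod_cast h s hs
      _ = (s : ℕ∞) * (lg (Fintype.card A) : ℕ) := by push_cast; rfl
      _ ≤ (s : ℕ∞) * optimalWorstCase p (entropy p + ε) := by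
        gcongr
        exact hopt
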